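/- Let $n\ge 1$ and $m\ge 1$ be integers. Put $A(u)=\prod_{1\le i<j\le n}(u_i-u_j)$, $(\lambda,x)=\sum_{i=1}^n\lambda_ix_i$ and $\bar x=x_1+\dots+x_n$. There is a unique polynomial $P\in\mathbb C[x_1,\dots,x_n,\lambda_1,\dots,\lambda_n]$ such that $P$ has leading term $A(x)^mA(\lambda)^m$ both with respect to $x$ and with respect to $\lambda$ (every monomial of $P-A(x)^mA(\lambda)^m$ has degree less than $mn(n-1)/2$ in the variables $x$ and degree less than $mn(n-1)/2$ in the variables $\lambda$), and such that the function $$\Psi^{(n)}_m(x,\lambda)=\frac{P(x,\lambda)}{A(x)^mA(\lambda)^m}\,e^{(\lambda,x)}$$ satisfies, for all $x\in\mathbb C^n$ with distinct coordinates and all $\lambda\in\mathbb C^n$ with distinct coordinates, the Calogero--Moser equation $$\Bigl(-\sum_{i=1}^n\frac{\partial^2}{\partial x_i^2}+\sum_{i<j}\frac{2m(m+1)}{(x_i-x_j)^2}\Bigr)\Psi^{(n)}_m=-(\lambda,\lambda)\,\Psi^{(n)}_m .$$ The function $\Psi^{(n)}_m$ is the rational Baker--Akhiezer function of type $A_{n-1}$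 with multiplicity $m$. Suppose that $x_1,\dots,x_n\in\mathbb C$ have distinct imaginary parts and that $\operatorname{Re}(\lambda_i-\lambda_j)<0$ for all $i<j$. In the variables $t_{i,j}$, $1\le i\le j\le n-1$, with $t_{i,n}=x_i$ for $1\le i\le n$, let $$\alpha_m=\prod_{j=1}^{n-1}\ \prod_{i=1}^{j}\prod_{l=1}^{j+1}(t_{i,j}-t_{l,j+1})^{m}\ \prod_{j=1}^{n-1}\ \prod_{1\le i<l\le j}(t_{i,j}-t_{l,j})^{-2m}\ \prod_{j=1}^{n-1}\prod_{l=1}^{j}e^{(\lambda_j-\lambda_{j+1})t_{l,j}}\,dt_{l,j},$$ and let $\Gamma$ be the contour $t_{i,j}=t_{i,j+1}+\tau_{i,j}$ with real $\tau_{i,j}$ running from $0$ to $\infty$ (so that $\prod dt_{i,j}=\prod d\tau_{i,j}$ on $\Gamma$). Then $\int_\Gamma\alpha_m$ converges absolutely, and $$\Psi^{(n)}_m(x,\lambda)=(-1)^{m\binom n3}\bigl((-1)^{m+1}m!\bigr)^{-\frac{n(n-1)}2}\,e^{\lambda_n\bar x}\,A(x)^{-m}A(\lambda)^{m+1}\int_\Gamma\alpha_m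 .$$ Equivalently, $$\int_\Gamma\alpha_m=(-1)^{m\binom n3}\bigl((-1)^{m+1}m!\bigr)^{\frac{n(n-1)}2}\,e^{-\lambda_n\bar x}\,A(x)^{m}A(\lambda)^{-m-1}\,\Psi^{(n)}_m(x,\lambda).$$ -/

import Mathlib

open MeasureTheory

noncomputable section

/-- `A(u) = ∏_{i < j} (u_i - u_j)`, for numbers or for variables of a polynomial ring. -/
def diffProd {R : Type*} [CommRing R] {n : ℕ} (u : Fin n → R) : R :=
  ∏ i : Fin n, ∏ j ∈ Finset.Ioi i, (u i - u j)

/-- The `n`-particle Calogero--Moser operator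
`L = -Δ + ∑_{i < j} 2 m (m + 1) / (x_i - x_j)²` applied to `f` at the point `x ∈ ℂⁿ`;
`Δ` is the sum of the second complex partial derivatives. -/
def calogeroMoser {n : ℕ} (m : ℕ) (f : (Fin n → ℂ) → ℂ) (x : Fin n → ℂ) : ℂ :=
  -(∑ i : Fin n, iteratedDeriv 2 (fun s : ℂ => f (Function.update x i s)) (x i)) +
    (∑ i : Fin n, ∑ j ∈ Finset.Ioi i, 2 * (m : ℂ) * ((m : ℂ) + 1) / (x i - x j) ^ 2) * f x

/-- The function `P(x, lam) / (A(x)^m A(lam)^m) * exp (lam, x)`; the variables of `P` with label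
`Sum.inl i` are the `x_i`, those with label `Sum.inr i` are the `lam_i`. -/
def baFun {n : ℕ} (m : ℕ) (P : MvPolynomial (Fin n ⊕ Fin n) ℂ) (x lam : Fin n → ℂ) : ℂ :=
  MvPolynomial.eval (Sum.elim x lam) P / (diffProd x ^ m * diffProd lam ^ m) *
    Complex.exp (∑ i, lam i * x i)

/-- The polynomial `A(x)^m A(lam)^m` in the variables `x` and `lam`. -/
def baLeading (n m : ℕ) : MvPolynomial (Fin n ⊕ Fin n) ℂ :=
  diffProd (fun i : Fin n => MvPolynomial.X (Sum.inl i)) ^ m *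
    diffProd (fun i : Fin n => MvPolynomial.X (Sum.inr i)) ^ m

/-- `P` is the numerator of the rational Baker--Akhiezer function of type `A_{n-1}` with
multiplicity `m`. The leading term is `A(x)^m A(lam)^m`, both with respect to `x` and with respect
to `lam`: every other monomial has degree less than `m n (n - 1) / 2` in `x` and in `lam`. -/
structure IsBakerAkhiezer (n m : ℕ) (P : MvPolynomial (Fin n ⊕ Fin n) ℂ) : Prop where
  leading_left : ∀ d ∈ (P - baLeading n m).support, ∑ i, d (Sum.inl i) < m * (n * (n - 1) / 2)
  leading_right : ∀ d ∈ (P - baLeading n m).support, ∑ i, d (Sum.inr i) < m * (n * (n - 1) / 2)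
  schrodinger : ∀ x lam : Fin n → ℂ, Function.Injective x → Function.Injective lam →
    calogeroMoser m (fun y => baFun m P y lam) x = -(∑ i, lam i ^ 2) * baFun m P x lam

/-! Below there are `n = N + 1` particles. All indices are shifted down by one: the variable
`t_{i,j}`, `1 ≤ i ≤ j ≤ n`, is `t (i - 1) (j - 1)`; so `t i (Fin.last N) = x i`. -/

/-- The index set of the integration variables: pairs `(i, j)`, `1 ≤ i ≤ j ≤ n - 1 = N`
(shifted). -/
abbrev Tri (N : ℕ) : Type := {p : Fin N × Fin N // p.1 ≤ p.2}

/-- The coefficient of `∏ dt_{i,j}` in the form `ω_m`, for an integer `m`: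
`∏_{j ≤ n-1} ∏_{i ≤ j, l ≤ j+1} (t_{i,j} - t_{l,j+1})^{-m-1}`
`* ∏_{j ≤ n-1} ∏_{i < l ≤ j} (t_{i,j} - t_{l,j})^{2+2m}`
`* ∏_{j ≤ n-1} ∏_{l ≤ j} exp ((lam_j - lam_{j+1}) t_{l,j})`. -/
def omegaForm {N : ℕ} (m : ℤ) (lam : Fin (N + 1) → ℂ) (t : Fin (N + 1) → Fin (N + 1) → ℂ) : ℂ :=
  (∏ j : Fin N, ∏ i ∈ Finset.Iic j.castSucc, ∏ l ∈ Finset.Iic j.succ,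
      (t i j.castSucc - t l j.succ) ^ (-m - 1)) *
    (∏ j : Fin N, ∏ l ∈ Finset.Iic j.castSucc, ∏ i ∈ Finset.Iio l,
      (t i j.castSucc - t l j.castSucc) ^ (2 + 2 * m)) *
    ∏ j : Fin N, ∏ l ∈ Finset.Iic j.castSucc,
      Complex.exp ((lam j.castSucc - lam j.succ) * t l j.castSucc)

/-- The Selberg-type integrand `α_m = ω_{-m-1}`. -/
def alphaForm {N : ℕ} (m : ℤ) (lam : Fin (N + 1) → ℂ) (t : Fin (N + 1) → Fin (N + 1) → ℂ) : ℂ :=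
  omegaForm (-m - 1) lam t

/-- The parametrisation of the contour `Γ`: `t_{i,n} = x_i`, `t_{i,j} = t_{i,j+1} + τ_{i,j}`
(see the two lemmas below), that is, `t_{i,j} = x_i + ∑_{s ≥ j} τ_{i,s}`. -/
def gammaPath {N : ℕ} (x : Fin (N + 1) → ℂ) (τ : Tri N → ℝ) (i j : Fin (N + 1)) : ℂ :=
  x i + ∑ p : Tri N, if p.1.1.castSucc = i ∧ j ≤ p.1.2.castSucc then (τ p : ℂ) else 0

theorem gammaPath_last {N : ℕ} (x : Fin (N + 1) → ℂ) (τ : Tri N → ℝ) (i : Fin (N + 1)) :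
    gammaPath x τ i (Fin.last N) = x i := by
  unfold gammaPath
  rw [Finset.sum_eq_zero, add_zero]
  intro p _
  rw [if_neg]
  rintro ⟨_, h⟩
  exact absurd h (not_le.mpr (Fin.castSucc_lt_last _))

theorem gammaPath_castSucc {N : ℕ} (x : Fin (N + 1) → ℂ) (τ : Tri N → ℝ) (p : Tri N) :
    gammaPath x τ p.1.1.castSucc p.1.2.castSucc =
      gammaPath x τ p.1.1.castSucc p.1.2.succ + (τ p : ℂ) := by
  unfold gammaPath
  rw [add_assoc]
  congr 1
  have h : (τ p : ℂ) = ∑ q : Tri N, if q = p then (τ q : ℂ) else 0 := by simp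
  rw [h, ← Finset.sum_add_distrib]
  refine Finset.sum_congr rfl fun q _ => ?_
  by_cases hq : q = p
  · subst hq
    simp
  · rw [if_neg hq, add_zero]
    refine if_congr ?_ rfl rfl
    refine and_congr_right fun h1 => ?_
    rw [Fin.castSucc_inj] at h1
    have h2 : p.1.2 ≠ q.1.2 := fun h2 => hq (Subtype.ext (Prod.ext h1 h2.symm))
    rw [Fin.castSucc_le_castSucc_iff, ← Fin.castSucc_lt_iff_succ_le, Fin.castSucc_lt_castSucc_iff]
    exact ⟨fun h3 => lt_of_le_of_ne h3 h2, le_of_lt⟩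

/-- The parameters of `Γ`: all `τ_{i,j}` run from zero to infinity. -/
def gammaDomain (N : ℕ) : Set (Tri N → ℝ) := {τ | ∀ p, 0 < τ p}

/-- The integral of `α_m` over `Γ`. On `Γ` the form `∏ dt_{i,j}` is Lebesgue measure `dτ`, as the
change of variables from `τ` to `t` is unimodular. -/
def selbergIntegral {N : ℕ} (m : ℤ) (x lam : Fin (N + 1) → ℂ) : ℂ :=
  ∫ τ in gammaDomain N, alphaForm m lam (gammaPath x τ)

end

noncomputable section

section KernelIdentity

/-- The partial fraction identity for the inverse differences of three points. -/
theorem inv_sub_cyclic {K : Type*} [Field K] {α : Type*} [DecidableEq α] {Z : Finset α} (z : α → K)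
    (hz : Set.InjOn z Z) {a b d : α} (ha : a ∈ Z) (hb : b ∈ Z) (hd : d ∈ Z) :
    (z a - z b)⁻¹ * (z a - z d)⁻¹ + (z b - z d)⁻¹ * (z b - z a)⁻¹ +
        (z d - z a)⁻¹ * (z d - z b)⁻¹ =
      (if b = d then (z a - z b)⁻¹ ^ 2 else 0) + (if d = a then (z b - z d)⁻¹ ^ 2 else 0) +
        (if a = b then (z d - z a)⁻¹ ^ 2 else 0) := by
  have key : ∀ {u v : α}, u ∈ Z → v ∈ Z → u ≠ v → z u - z v ≠ 0 := fun hu hv huv h =>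
    huv (hz hu hv (sub_eq_zero.mp h))
  by_cases h1 : b = d
  · subst h1
    by_cases h2 : a = b
    · subst h2; simp
    · have h3 : b ≠ a := fun h => h2 h.symm
      simp [h2, h3, sq]
  · by_cases h2 : d = a
    · subst h2
      have h3 : d ≠ b := fun h => h1 h.symm
      simp [h1, h3, sq]
    · by_cases h3 : a = b
      · subst h3
        simp [h1, h2, sq]
      · have e1 := key ha hb h3
        have e2 := key hb hd h1
        have e3 := key hd ha h2
        have e4 : z a - z d ≠ 0 := key ha hd (fun h => h2 h.symm)
        have e5 : z b - z a ≠ 0 := key hb ha (fun h => h3 h.symm)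
        have e6 : z d - z b ≠ 0 := key hd hb (fun h => h1 h.symm)
        simp only [h1, h2, h3, if_false, add_zero]
        field_simp
        ring

theorem sum_charge_mul_sq {K : Type*} [Field K] [CharZero K] {α : Type*} [DecidableEq α]
    {Z : Finset α} (z c : α → K)
    (hz : Set.InjOn z Z) (hc : ∀ a, c a ^ 2 = 1) :
    ∑ a ∈ Z, c a * (∑ b ∈ Z, c b * (z a - z b)⁻¹) ^ 2 =
      ∑ a ∈ Z, ∑ b ∈ Z, c a * (z a - z b)⁻¹ ^ 2 := by
  set f : α → α → α → K := fun a b d =>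
    c a * c b * c d * ((z a - z b)⁻¹ * (z a - z d)⁻¹) with hf
  have h0 : ∑ a ∈ Z, c a * (∑ b ∈ Z, c b * (z a - z b)⁻¹) ^ 2 =
      ∑ a ∈ Z, ∑ b ∈ Z, ∑ d ∈ Z, f a b d := by
    refine Finset.sum_congr rfl fun a _ => ?_
    rw [sq, Finset.sum_mul_sum, Finset.mul_sum]
    refine Finset.sum_congr rfl fun b _ => ?_
    rw [Finset.mul_sum]
    refine Finset.sum_congr rfl fun d _ => ?_
    simp only [hf]; ring
  have h1' : ∀ F : α → α → α → K, ∑ a ∈ Z, ∑ b ∈ Z, ∑ d ∈ Z, F a b d =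
      ∑ a ∈ Z, ∑ b ∈ Z, ∑ d ∈ Z, F b d a := by
    intro F
    rw [Finset.sum_comm]
    conv_lhs => enter [2, b]; rw [Finset.sum_comm]
    rw [Finset.sum_comm]
    exact Finset.sum_congr rfl fun d _ => Finset.sum_comm
  have h1 := h1' f
  have h2 := h1' (fun a b d => f b d a)
  have h3 : ∑ a ∈ Z, ∑ b ∈ Z, ∑ d ∈ Z, (f a b d + f b d a + f d a b) =
      ∑ a ∈ Z, ∑ b ∈ Z, ∑ d ∈ Z, ((if b = d then c a * (z a - z b)⁻¹ ^ 2 else 0) +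
        (if d = a then c b * (z b - z d)⁻¹ ^ 2 else 0) +
        (if a = b then c d * (z d - z a)⁻¹ ^ 2 else 0)) := by
    refine Finset.sum_congr rfl fun a ha => Finset.sum_congr rfl fun b hb =>
      Finset.sum_congr rfl fun d hd => ?_
    have := inv_sub_cyclic z hz ha hb hd
    have e : f a b d + f b d a + f d a b = c a * c b * c d *
        ((z a - z b)⁻¹ * (z a - z d)⁻¹ + (z b - z d)⁻¹ * (z b - z a)⁻¹ +
        (z d - z a)⁻¹ * (z d - z b)⁻¹) := by simp only [hf]; ring
    rw [e, this, mul_add, mul_add]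
    congr 1
    · congr 1
      · split_ifs with h
        · subst h; linear_combination (c a * (z a - z b)⁻¹ ^ 2) * hc b
        · simp
      · split_ifs with h
        · subst h; linear_combination (c b * (z b - z d)⁻¹ ^ 2) * hc d
        · simp
    · split_ifs with h
      · subst h; linear_combination (c d * (z d - z a)⁻¹ ^ 2) * hc a
      · simp
  set g : α → α → α → K := fun a b d => if b = d then c a * (z a - z b)⁻¹ ^ 2 else 0 with hg
  have h4 := h1' g
  have h5 := h1' (fun a b d => g b d a)
  have h6 : ∑ a ∈ Z, ∑ b ∈ Z, ∑ d ∈ Z, g a b d = ∑ a ∈ Z, ∑ b ∈ Z, c a * (z a - z b)⁻¹ ^ 2 := by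
    refine Finset.sum_congr rfl fun a _ => Finset.sum_congr rfl fun b hb => ?_
    simp [hg, hb]
  rw [h0, ← h6]
  simp only [Finset.sum_add_distrib] at h3
  have h7 : (3 : K) * ∑ a ∈ Z, ∑ b ∈ Z, ∑ d ∈ Z, f a b d =
      3 * ∑ a ∈ Z, ∑ b ∈ Z, ∑ d ∈ Z, g a b d := by
    simp only [hg] at h4 h5 ⊢
    linear_combination h3 + h1 + (h1 + h2) - h4 - (h4 + h5)
  exact mul_left_cancel₀ (by norm_num) h7

/-- The kernel function identity for two families of points. -/
theorem kernel_identity {K : Type*} [Field K] [CharZero K] {ι : Type*} [DecidableEq ι]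
    {A B : Finset ι} (X Y : ι → K)
    (hX : Set.InjOn X A) (hY : Set.InjOn Y B) (hXY : ∀ i ∈ A, ∀ l ∈ B, X i ≠ Y l) :
    ∑ i ∈ A, (∑ l ∈ A, (X i - X l)⁻¹ - ∑ l ∈ B, (X i - Y l)⁻¹) ^ 2 -
        ∑ i ∈ B, (∑ l ∈ A, (Y i - X l)⁻¹ - ∑ l ∈ B, (Y i - Y l)⁻¹) ^ 2 =
      ∑ i ∈ A, ∑ l ∈ A, (X i - X l)⁻¹ ^ 2 - ∑ i ∈ B, ∑ l ∈ B, (Y i - Y l)⁻¹ ^ 2 := by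
  have hinj : Set.InjOn (Sum.elim X Y) (A.disjSum B : Finset (ι ⊕ ι)) := by
    rintro (a | a) ha (b | b) hb h <;>
      simp only [Finset.mem_coe, Finset.inl_mem_disjSum, Finset.inr_mem_disjSum, Sum.elim_inl,
        Sum.elim_inr] at ha hb h
    · rw [hX ha hb h]
    · exact absurd h (hXY a ha b hb)
    · exact absurd h.symm (hXY b hb a ha)
    · rw [hY ha hb h]
  have := sum_charge_mul_sq (Z := A.disjSum B) (Sum.elim X Y)
    (Sum.elim (fun _ => 1) (fun _ => -1)) hinj (by rintro (a | a) <;> simp)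
  simp only [Finset.sum_disjSum, Sum.elim_inl, Sum.elim_inr, one_mul, neg_mul,
    Finset.sum_neg_distrib, Finset.sum_add_distrib] at this
  have hsym : ∑ i ∈ B, ∑ l ∈ A, (Y i - X l)⁻¹ ^ 2 = ∑ i ∈ A, ∑ l ∈ B, (X i - Y l)⁻¹ ^ 2 := by
    rw [Finset.sum_comm]
    refine Finset.sum_congr rfl fun i _ => Finset.sum_congr rfl fun l _ => ?_
    rw [← neg_sub, inv_neg, neg_sq]
  simp only [sub_eq_add_neg (∑ l ∈ A, _) (∑ l ∈ B, _)]
  linear_combination this - hsym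

end KernelIdentity

section Levels

variable {N : ℕ}

/-- The columns `i ≤ s` which are present at level `s`. -/
def level (N s : ℕ) : Finset (Fin (N + 1)) := Finset.univ.filter fun i => i.val ≤ s

theorem mem_level {s : ℕ} {i : Fin (N + 1)} : i ∈ level N s ↔ i.val ≤ s := by simp [level]

theorem level_succ {s : ℕ} (hs : s < N) :
    level N (s + 1) = insert (Fin.ofNat (N + 1) (s + 1)) (level N s) := by
  ext i
  simp only [mem_level, Finset.mem_insert, Fin.ext_iff, Fin.val_ofNat,
    Nat.mod_eq_of_lt (Nat.succ_lt_succ hs)]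
  omega

theorem top_notMem_level {s : ℕ} (hs : s < N) : Fin.ofNat (N + 1) (s + 1) ∉ level N s := by
  simp only [mem_level, Fin.val_ofNat, Nat.mod_eq_of_lt (Nat.succ_lt_succ hs)]
  omega

theorem level_subset (s : ℕ) : level N s ⊆ level N (s + 1) := fun _ hi =>
  mem_level.mpr ((mem_level.mp hi).trans (Nat.le_succ s))

theorem level_zero : level N 0 = {0} := by
  ext i; rw [mem_level, Finset.mem_singleton, Fin.ext_iff, Fin.val_zero, Nat.le_zero]

theorem level_self : level N N = Finset.univ := by
  ext i; simp [mem_level, Nat.lt_succ_iff.mp i.isLt]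

variable {S : Type*} [CommRing S]

/-- The signed sum over the particles of levels `s + 1` and `s`. -/
def signedSum (s : ℕ) (f : Fin (N + 1) → ℕ → S) : S :=
  ∑ l ∈ level N (s + 1), f l (s + 1) - ∑ l ∈ level N s, f l s

/-- The sum of `SY - SX` over the lower levels. -/
def driftSum (w : Fin (N + 1) → ℕ → Fin (N + 1) → ℕ → S) (j : ℕ) (a : Fin (N + 1)) : S :=
  ∑ s ∈ Finset.range j, ((if a ∈ level N s then signedSum s (w a s) else 0) -
    if a ∈ level N (s + 1) then signedSum s (w a (s + 1)) else 0)

/-- The same sum for the squares. -/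
def driftSqSum (w : Fin (N + 1) → ℕ → Fin (N + 1) → ℕ → S) (j : ℕ) (a : Fin (N + 1)) : S :=
  ∑ s ∈ Finset.range j,
    ((if a ∈ level N (s + 1) then signedSum s (fun l k => w a (s + 1) l k ^ 2) else 0) -
      if a ∈ level N s then signedSum s (fun l k => w a s l k ^ 2) else 0)

theorem driftSum_succ (w : Fin (N + 1) → ℕ → Fin (N + 1) → ℕ → S) (j : ℕ) (a : Fin (N + 1)) :
    driftSum w (j + 1) a = driftSum w j a + ((if a ∈ level N j then signedSum j (w a j) else 0) -
      if a ∈ level N (j + 1) then signedSum j (w a (j + 1)) else 0) :=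
  Finset.sum_range_succ _ _

theorem driftSqSum_succ (w : Fin (N + 1) → ℕ → Fin (N + 1) → ℕ → S) (j : ℕ) (a : Fin (N + 1)) :
    driftSqSum w (j + 1) a = driftSqSum w j a +
      ((if a ∈ level N (j + 1) then signedSum j (fun l k => w a (j + 1) l k ^ 2) else 0) -
        if a ∈ level N j then signedSum j (fun l k => w a j l k ^ 2) else 0) :=
  Finset.sum_range_succ _ _

theorem driftSum_eq_zero (w : Fin (N + 1) → ℕ → Fin (N + 1) → ℕ → S) {j : ℕ} {a : Fin (N + 1)}
    (ha : a ∉ level N j) : driftSum w j a = 0 := by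
  refine Finset.sum_eq_zero fun s hs => ?_
  rw [Finset.mem_range] at hs
  rw [mem_level] at ha
  rw [if_neg, if_neg, sub_zero] <;> rw [mem_level] <;> omega

theorem sum_sum_antisymm_eq_zero {ι : Type*} {A : Finset ι} {f : ι → ι → S}
    (hf : ∀ i l, f i l = -f l i) (h0 : ∀ i, f i i = 0) : ∑ i ∈ A, ∑ l ∈ A, f i l = 0 := by
  classical
  induction A using Finset.induction_on with
  | empty => simp
  | insert a A ha ih =>
    rw [Finset.sum_insert ha, Finset.sum_insert ha, h0]
    simp only [Finset.sum_insert ha, Finset.sum_add_distrib, ih]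
    rw [Finset.sum_congr rfl fun l _ => hf a l, Finset.sum_neg_distrib]
    ring

theorem sum_signedSum_eq {w : Fin (N + 1) → ℕ → Fin (N + 1) → ℕ → S}
    (hanti : ∀ i j l k, w i j l k = -w l k i j) (h0 : ∀ i j k, w i j i k = 0) (s : ℕ) :
    ∑ i ∈ level N (s + 1), signedSum s (w i (s + 1)) = ∑ i ∈ level N s, signedSum s (w i s) := by
  simp only [signedSum, Finset.sum_sub_distrib]
  rw [sum_sum_antisymm_eq_zero (fun i l => hanti i _ l _) fun i => h0 i _ _,
    sum_sum_antisymm_eq_zero (fun i l => hanti i _ l _) fun i => h0 i _ _,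
    Finset.sum_comm (s := level N s), Finset.sum_congr rfl fun i _ => Finset.sum_congr rfl
      fun l _ => hanti i (s + 1) l s]
  simp only [Finset.sum_neg_distrib]
  ring

theorem sum_signedSum_sq_eq {w : Fin (N + 1) → ℕ → Fin (N + 1) → ℕ → S}
    (hanti : ∀ i j l k, w i j l k = -w l k i j) (s : ℕ) :
    ∑ i ∈ level N (s + 1), signedSum s (fun l k => w i (s + 1) l k ^ 2) +
        ∑ i ∈ level N s, signedSum s (fun l k => w i s l k ^ 2) =
      ∑ i ∈ level N (s + 1), ∑ l ∈ level N (s + 1), w i (s + 1) l (s + 1) ^ 2 -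
        ∑ i ∈ level N s, ∑ l ∈ level N s, w i s l s ^ 2 := by
  simp only [signedSum, Finset.sum_sub_distrib]
  have : ∑ i ∈ level N (s + 1), ∑ l ∈ level N s, w i (s + 1) l s ^ 2 =
      ∑ i ∈ level N s, ∑ l ∈ level N (s + 1), w i s l (s + 1) ^ 2 := by
    rw [Finset.sum_comm]
    refine Finset.sum_congr rfl fun i _ => Finset.sum_congr rfl fun l _ => ?_
    rw [hanti, neg_sq]
  rw [this]; ring

/-- A weighted sum of the drifts, rearranged into a sum over the integration variables. -/
theorem sum_mul_driftSum {w : Fin (N + 1) → ℕ → Fin (N + 1) → ℕ → S}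
    (hanti : ∀ i j l k, w i j l k = -w l k i j) (h0 : ∀ i j k, w i j i k = 0)
    (lam : Fin (N + 1) → S) :
    ∑ a, lam a * driftSum w N a = ∑ s ∈ Finset.range N, ∑ i ∈ level N s,
      (lam i - lam (Fin.ofNat (N + 1) (s + 1))) *
        (signedSum s (w i s) - signedSum s (w i (s + 1))) := by
  simp only [driftSum, Finset.mul_sum]
  rw [Finset.sum_comm]
  refine Finset.sum_congr rfl fun s hs => ?_
  rw [Finset.mem_range] at hs
  have e := sum_signedSum_eq hanti h0 s
  simp only [mul_sub, mul_ite, mul_zero, Finset.sum_sub_distrib, Finset.sum_ite_mem,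
    Finset.univ_inter, sub_mul]
  rw [level_succ hs, Finset.sum_insert (top_notMem_level hs)] at e ⊢
  rw [← Finset.mul_sum, ← Finset.mul_sum]
  linear_combination (-lam (Fin.ofNat (N + 1) (s + 1))) * e

theorem sum_driftSum_sq {w : Fin (N + 1) → ℕ → Fin (N + 1) → ℕ → S}
    (hanti : ∀ i j l k, w i j l k = -w l k i j) (h0 : ∀ i j k, w i j i k = 0)
    (hker : ∀ s < N, ∑ i ∈ level N (s + 1), signedSum s (w i (s + 1)) ^ 2 -
        ∑ i ∈ level N s, signedSum s (w i s) ^ 2 +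
        2 * ∑ i ∈ level N s, signedSum s (fun l k => w i (s + 1) l k * w i s l k) =
      ∑ i ∈ level N (s + 1), ∑ l ∈ level N (s + 1), w i (s + 1) l (s + 1) ^ 2 -
        ∑ i ∈ level N s, ∑ l ∈ level N s, w i s l s ^ 2) (ν : S) {j : ℕ} (hj : j ≤ N) :
    ∑ a ∈ level N j, (ν ^ 2 * driftSum w j a ^ 2 + ν * driftSqSum w j a) -
        ν * (ν + 1) * ∑ i ∈ level N j, ∑ l ∈ level N j, w i j l j ^ 2 =
      2 * ∑ s ∈ Finset.range j, ∑ i ∈ level N s,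
        (-ν ^ 2 * signedSum s (fun l k => w i (s + 1) l k * w i s l k) -
          ν * signedSum s (fun l k => w i s l k ^ 2) +
          ν ^ 2 * (signedSum s (w i s) - signedSum s (w i (s + 1))) *
            (driftSum w s i + signedSum s (w i s))) := by
  induction j with
  | zero => simp [level_zero, driftSum, driftSqSum, h0]
  | succ j ih =>
    have hj' : j < N := hj
    specialize ih hj'.le
    have hk := hker j hj'
    have hq := sum_signedSum_sq_eq hanti j
    rw [Finset.sum_range_succ, mul_add 2, ← ih]
    have htop : driftSum w j (Fin.ofNat (N + 1) (j + 1)) = 0 :=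
      driftSum_eq_zero w (top_notMem_level hj')
    have htop2 : driftSqSum w j (Fin.ofNat (N + 1) (j + 1)) = 0 := by
      refine Finset.sum_eq_zero fun s hs => ?_
      rw [Finset.mem_range] at hs
      have ha := top_notMem_level hj'
      rw [mem_level] at ha
      rw [if_neg, if_neg, sub_zero] <;> rw [mem_level] <;> omega
    set W1 := ∑ i ∈ level N (j + 1), ∑ l ∈ level N (j + 1), w i (j + 1) l (j + 1) ^ 2
    set W0 := ∑ i ∈ level N j, ∑ l ∈ level N j, w i j l j ^ 2
    rw [level_succ hj', Finset.sum_insert (top_notMem_level hj')] at hk hq ⊢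
    rw [driftSum_succ, driftSqSum_succ, htop, htop2, if_neg (top_notMem_level hj'),
      if_neg (top_notMem_level hj'),
      if_pos (by rw [level_succ hj']; exact Finset.mem_insert_self _ _),
      if_pos (by rw [level_succ hj']; exact Finset.mem_insert_self _ _)]
    have e : ∀ i ∈ level N j, ν ^ 2 * driftSum w (j + 1) i ^ 2 + ν * driftSqSum w (j + 1) i =
        (ν ^ 2 * driftSum w j i ^ 2 + ν * driftSqSum w j i) +
        2 * (-ν ^ 2 * signedSum j (fun l k => w i (j + 1) l k * w i j l k) -
          ν * signedSum j (fun l k => w i j l k ^ 2) +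
          ν ^ 2 * (signedSum j (w i j) - signedSum j (w i (j + 1))) *
            (driftSum w j i + signedSum j (w i j))) +
        (ν ^ 2 * signedSum j (w i (j + 1)) ^ 2 - ν ^ 2 * signedSum j (w i j) ^ 2 +
          ν ^ 2 * 2 * signedSum j (fun l k => w i (j + 1) l k * w i j l k) +
          ν * signedSum j (fun l k => w i (j + 1) l k ^ 2) +
          ν * signedSum j (fun l k => w i j l k ^ 2)) := by
      intro i hi
      rw [driftSum_succ, driftSqSum_succ, if_pos hi, if_pos (level_subset j hi), if_pos hi,
        if_pos (level_subset j hi)]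
      ring
    rw [Finset.sum_congr rfl e, Finset.sum_add_distrib, Finset.sum_add_distrib, ← Finset.mul_sum]
    simp only [Finset.sum_add_distrib, Finset.sum_sub_distrib, ← Finset.mul_sum] at hk hq ⊢
    linear_combination ν ^ 2 * hk + ν * hq

/-- The kernel identity in a domain, for the truncated inverse differences `w`, which vanish for two
particles of one column. -/
theorem kernel_identity_truncated [IsDomain S] [CharZero S]
    {w : Fin (N + 1) → ℕ → Fin (N + 1) → ℕ → S} {t : Fin (N + 1) → ℕ → S}
    (hw : ∀ i j l k, i ≠ l → w i j l k * (t i j - t l k) = 1) (h0 : ∀ i j k, w i j i k = 0)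
    {s : ℕ} (hs : ∀ i ∈ level N s, t i (s + 1) ≠ t i s) :
    ∑ i ∈ level N (s + 1), signedSum s (w i (s + 1)) ^ 2 -
        ∑ i ∈ level N s, signedSum s (w i s) ^ 2 +
        2 * ∑ i ∈ level N s, signedSum s (fun l k => w i (s + 1) l k * w i s l k) =
      ∑ i ∈ level N (s + 1), ∑ l ∈ level N (s + 1), w i (s + 1) l (s + 1) ^ 2 -
        ∑ i ∈ level N s, ∑ l ∈ level N s, w i s l s ^ 2 := by
  have hne : ∀ {i j l k}, i ≠ l → t i j ≠ t l k := by
    intro i j l k h h'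
    have := hw i j l k h
    rw [h', sub_self, mul_zero] at this
    exact zero_ne_one this
  have hΓ : ∀ i, signedSum s (w i (s + 1)) - signedSum s (w i s) =
      (t i s - t i (s + 1)) * signedSum s (fun l k => w i (s + 1) l k * w i s l k) := by
    intro i
    have e : ∀ l k, w i (s + 1) l k - w i s l k =
        (t i s - t i (s + 1)) * (w i (s + 1) l k * w i s l k) := by
      intro l k
      by_cases h : i = l
      · subst h; simp [h0]
      · linear_combination (-w i (s + 1) l k) * hw i s l k h + w i s l k * hw i (s + 1) l k h
    simp only [signedSum, mul_sub, Finset.mul_sum, ← e, Finset.sum_sub_distrib]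
    ring
  have hinj := IsFractionRing.injective S (FractionRing S)
  have : CharZero (FractionRing S) := charZero_of_injective_algebraMap hinj
  apply hinj
  set φ := algebraMap S (FractionRing S)
  have hφw : ∀ i j l k, φ (w i j l k) = if i = l then 0 else (φ (t i j) - φ (t l k))⁻¹ := by
    intro i j l k
    split_ifs with h
    · subst h; rw [h0, map_zero]
    · refine eq_inv_of_mul_eq_one_left ?_
      rw [← map_sub, ← map_mul, hw i j l k h, map_one]
  have hφw' : ∀ i j l, φ (w i j l j) = (φ (t i j) - φ (t l j))⁻¹ := by
    intro i j l
    rw [hφw]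
    split_ifs with h
    · subst h; simp
    · rfl
  have hX : Set.InjOn (fun i => φ (t i (s + 1))) (level N (s + 1)) := fun a _ b _ h =>
    by_contra fun hab => hne hab (hinj h)
  have hY : Set.InjOn (fun i => φ (t i s)) (level N s) := fun a _ b _ h =>
    by_contra fun hab => hne hab (hinj h)
  have hXY : ∀ i ∈ level N (s + 1), ∀ l ∈ level N s, φ (t i (s + 1)) ≠ φ (t l s) := by
    intro i _ l hl h
    by_cases hil : i = l
    · subst hil; exact hs i hl (hinj h)
    · exact hne hil (hinj h)
  have main := kernel_identity _ _ hX hY hXY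
  set ρ : Fin (N + 1) → FractionRing S := fun i => (φ (t i (s + 1)) - φ (t i s))⁻¹ with hρ
  have eX : ∀ i, ∑ l ∈ level N (s + 1), (φ (t i (s + 1)) - φ (t l (s + 1)))⁻¹ -
      ∑ l ∈ level N s, (φ (t i (s + 1)) - φ (t l s))⁻¹ =
      φ (signedSum s (w i (s + 1))) - if i ∈ level N s then ρ i else 0 := by
    intro i
    have : ∀ l, (φ (t i (s + 1)) - φ (t l s))⁻¹ =
        φ (w i (s + 1) l s) + if i = l then ρ i else 0 := by
      intro l
      rw [hφw]
      split_ifs with h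
      · subst h; simp [hρ]
      · simp
    simp only [signedSum, map_sub, map_sum, hφw', this, Finset.sum_add_distrib, Finset.sum_ite_eq]
    ring
  have eY : ∀ i ∈ level N s, ∑ l ∈ level N (s + 1), (φ (t i s) - φ (t l (s + 1)))⁻¹ -
      ∑ l ∈ level N s, (φ (t i s) - φ (t l s))⁻¹ = φ (signedSum s (w i s)) - ρ i := by
    intro i hi
    have : ∀ l, (φ (t i s) - φ (t l (s + 1)))⁻¹ =
        φ (w i s l (s + 1)) - if i = l then ρ i else 0 := by
      intro l
      rw [hφw]
      split_ifs with h
      · subst h; simp only [hρ]; rw [← neg_sub, inv_neg]; ring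
      · simp
    simp only [signedSum, map_sub, map_sum, hφw', this, Finset.sum_sub_distrib, Finset.sum_ite_eq,
      if_pos (level_subset s hi)]
    ring
  have eΓ : ∀ i ∈ level N s, φ (signedSum s (fun l k => w i (s + 1) l k * w i s l k)) =
      -(ρ i * (φ (signedSum s (w i (s + 1))) - φ (signedSum s (w i s)))) := by
    intro i hi
    rw [← map_sub, hΓ, map_mul, map_sub]
    have : φ (t i (s + 1)) - φ (t i s) ≠ 0 := sub_ne_zero.mpr fun h => hs i hi (hinj h)
    simp only [hρ]
    field_simp
    ring
  have eY2 := Finset.sum_congr (rfl : level N s = level N s) fun i hi =>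
    congrArg (· ^ 2) (eY i hi)
  simp only [eX, eY2] at main
  simp only [map_add, map_sub, map_mul, map_sum, map_pow, map_ofNat, hφw']
  rw [← main, Finset.sum_congr rfl eΓ]
  have e1 : ∀ i, (φ (signedSum s (w i (s + 1))) - if i ∈ level N s then ρ i else 0) ^ 2 =
      φ (signedSum s (w i (s + 1))) ^ 2 + if i ∈ level N s then
        ρ i ^ 2 - 2 * ρ i * φ (signedSum s (w i (s + 1))) else 0 := by
    intro i; split_ifs <;> ring
  rw [Finset.sum_congr rfl fun i _ => e1 i, Finset.sum_add_distrib, Finset.sum_ite_mem,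
    Finset.inter_eq_right.mpr (level_subset s), add_sub_assoc, ← Finset.sum_sub_distrib,
    sub_add, Finset.mul_sum, ← Finset.sum_sub_distrib, sub_eq_add_neg, ← Finset.sum_neg_distrib]
  congr 1
  refine Finset.sum_congr rfl fun i _ => ?_
  ring

end Levels

section Derivations

variable {σ R A : Type*} [CommRing R] [CommRing A] [Algebra R A]

/-- The derivation of a power series ring which acts on the coefficients. -/
def coeffDerivation (σ : Type*) (D : Derivation R A A) :
    Derivation R (MvPowerSeries σ A) (MvPowerSeries σ A) where
  toFun F := fun d => D (MvPowerSeries.coeff d F)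
  map_add' F G := by ext d; exact map_add D _ _
  map_smul' r F := by ext d; exact D.map_smul r _
  map_one_eq_zero' := by
    classical
    ext d
    change D (MvPowerSeries.coeff d 1) = 0
    rw [MvPowerSeries.coeff_one]
    split_ifs <;> simp
  leibniz' F G := by
    classical
    ext d
    change D (MvPowerSeries.coeff d (F * G)) = _
    rw [map_add, smul_eq_mul, smul_eq_mul, MvPowerSeries.coeff_mul, MvPowerSeries.coeff_mul,
      mul_comm G, MvPowerSeries.coeff_mul, map_sum, ← Finset.sum_add_distrib]
    refine Finset.sum_congr rfl fun p _ => ?_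
    rw [D.leibniz, smul_eq_mul, smul_eq_mul, mul_comm (MvPowerSeries.coeff p.2 G)]
    rfl

theorem coeff_coeffDerivation (D : Derivation R A A) (F : MvPowerSeries σ A) (d : σ →₀ ℕ) :
    MvPowerSeries.coeff d (coeffDerivation σ D F) = D (MvPowerSeries.coeff d F) := rfl

theorem coeffDerivation_C (D : Derivation R A A) (a : A) :
    coeffDerivation σ D (MvPowerSeries.C a) = MvPowerSeries.C (D a) := by
  classical
  ext d
  rw [coeff_coeffDerivation, MvPowerSeries.coeff_C, MvPowerSeries.coeff_C]
  split_ifs <;> simp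

theorem coeffDerivation_X (D : Derivation R A A) (p : σ) :
    coeffDerivation σ D (MvPowerSeries.X p) = 0 := by
  classical
  ext d
  rw [coeff_coeffDerivation, MvPowerSeries.coeff_X]
  split_ifs <;> simp

/-- The Euler operator of one variable of a power series ring. -/
def eulerDerivation (R A : Type*) [CommRing R] [CommRing A] [Algebra R A] (p : σ) :
    Derivation R (MvPowerSeries σ A) (MvPowerSeries σ A) where
  toFun F := fun d => d p • MvPowerSeries.coeff d F
  map_add' F G := by ext d; exact smul_add _ _ _
  map_smul' r F := by ext d; exact smul_comm _ r _
  map_one_eq_zero' := by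
    classical
    ext d
    change d p • MvPowerSeries.coeff d (1 : MvPowerSeries σ A) = 0
    rw [MvPowerSeries.coeff_one]
    split_ifs with h
    · simp [h]
    · simp
  leibniz' F G := by
    classical
    ext d
    change d p • MvPowerSeries.coeff d (F * G) = _
    rw [map_add, smul_eq_mul, smul_eq_mul, MvPowerSeries.coeff_mul, MvPowerSeries.coeff_mul,
      mul_comm G, MvPowerSeries.coeff_mul, Finset.smul_sum, ← Finset.sum_add_distrib]
    refine Finset.sum_congr rfl fun q hq => ?_
    rw [Finset.HasAntidiagonal.mem_antidiagonal] at hq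
    change _ = MvPowerSeries.coeff q.1 F * (q.2 p • MvPowerSeries.coeff q.2 G) +
      (q.1 p • MvPowerSeries.coeff q.1 F) * MvPowerSeries.coeff q.2 G
    rw [← hq, Finsupp.add_apply, add_smul, mul_smul_comm, smul_mul_assoc, add_comm]

theorem coeff_eulerDerivation (p : σ) (F : MvPowerSeries σ A) (d : σ →₀ ℕ) :
    MvPowerSeries.coeff d (eulerDerivation R A p F) = d p • MvPowerSeries.coeff d F := rfl

theorem eulerDerivation_C (p : σ) (a : A) :
    eulerDerivation R A p (MvPowerSeries.C a) = 0 := by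
  classical
  ext d
  rw [coeff_eulerDerivation, MvPowerSeries.coeff_C]
  split_ifs with h
  · simp [h]
  · simp

theorem eulerDerivation_X [DecidableEq σ] (p r : σ) :
    eulerDerivation R A p (MvPowerSeries.X r) = if r = p then MvPowerSeries.X p else 0 := by
  ext d
  rw [coeff_eulerDerivation]
  split_ifs with h
  · subst h
    rw [MvPowerSeries.coeff_X]
    split_ifs with h2
    · simp [h2]
    · simp
  · rw [MvPowerSeries.coeff_X]
    split_ifs with h2
    · simp [h2, h]
    · simp

variable {S : Type*} [CommRing S] [Algebra R S]

/-- The logarithmic derivative of units. -/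
def unitLog (D : Derivation R S S) : Additive Sˣ →+ S where
  toFun u := ↑(u.toMul)⁻¹ * D u.toMul
  map_zero' := by simp
  map_add' u v := by
    simp only [toMul_add, Units.val_mul, D.leibniz, smul_eq_mul, mul_inv]
    linear_combination (↑u.toMul⁻¹ * D u.toMul) * (v.toMul).inv_mul +
      (↑v.toMul⁻¹ * D v.toMul) * (u.toMul).inv_mul

theorem derivation_unit (D : Derivation R S S) (u : Sˣ) :
    D u = u * unitLog D (Additive.ofMul u) := by
  change D u = u * (↑u⁻¹ * D u)
  rw [← mul_assoc, Units.mul_inv, one_mul]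

theorem derivation_unit_inv (D : Derivation R S S) (u : Sˣ) :
    D ↑u⁻¹ = -(↑u⁻¹ * unitLog D (Additive.ofMul u)) := by
  rw [derivation_unit, ofMul_inv, map_neg, mul_neg]

end Derivations

section LevelProducts

variable {N : ℕ} {R S : Type*} [CommRing R] [CommRing S] [Algebra R S]

/-- The kernel linking the levels `s + 1` and `s`, as a product of units. -/
def levelUnit (Y : Fin (N + 1) → ℕ → Fin (N + 1) → ℕ → Sˣ) (ν : ℤ) (s : ℕ) : Sˣ :=
  (∏ i ∈ level N (s + 1), ∏ l ∈ level N (s + 1) with i < l, Y i (s + 1) l (s + 1)) ^ (-ν) *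
    (∏ i ∈ level N s, ∏ l ∈ level N s with i < l, Y i s l s) ^ (-ν) *
    (∏ i ∈ level N s, ∏ l ∈ level N (s + 1), Y i s l (s + 1)) ^ ν

theorem sum_lt_sub_mul {ι : Type*} [LinearOrder ι] {A : Finset ι} (e : ι → S) {f : ι → ι → S}
    (hf : ∀ i l, f i l = -f l i) (h0 : ∀ i, f i i = 0) :
    ∑ i ∈ A, ∑ l ∈ A with i < l, (e i - e l) * f i l = ∑ i ∈ A, e i * ∑ l ∈ A, f i l := by
  have h1 : ∑ i ∈ A, ∑ l ∈ A with i < l, e l * f i l =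
      -∑ i ∈ A, ∑ l ∈ A with l < i, e i * f i l := by
    simp only [Finset.sum_filter, ← Finset.sum_neg_distrib]
    rw [Finset.sum_comm]
    refine Finset.sum_congr rfl fun l _ => Finset.sum_congr rfl fun i _ => ?_
    split_ifs
    · rw [hf]; ring
    · ring
  simp only [sub_mul, Finset.sum_sub_distrib]
  rw [h1, sub_neg_eq_add, ← Finset.sum_add_distrib]
  refine Finset.sum_congr rfl fun i _ => ?_
  simp only [Finset.sum_filter, ← Finset.sum_add_distrib, Finset.mul_sum]
  refine Finset.sum_congr rfl fun l _ => ?_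
  rcases lt_trichotomy i l with h | h | h
  · simp [h, h.not_gt]
  · subst h; simp [h0]
  · simp [h, h.not_gt]

theorem unitLog_levelUnit (D : Derivation R S S) {Y : Fin (N + 1) → ℕ → Fin (N + 1) → ℕ → Sˣ}
    {w : Fin (N + 1) → ℕ → Fin (N + 1) → ℕ → S} (hanti : ∀ i j l k, w i j l k = -w l k i j)
    (h0 : ∀ i j k, w i j i k = 0) {q : Fin (N + 1) → Fin (N + 1) → S}
    (qanti : ∀ i l, q i l = -q l i) (q0 : ∀ i, q i i = 0) (d : Fin (N + 1) → ℕ → S)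
    (e : Fin (N + 1) → S) (hY : ∀ i j l k, unitLog D (Additive.ofMul (Y i j l k)) =
      (d i j - d l k) * w i j l k - (e i - e l) * q i l) (ν : ℤ) {s : ℕ} (hs : s < N) :
    unitLog D (Additive.ofMul (levelUnit Y ν s)) =
      ν * (∑ i ∈ level N s, d i s * signedSum s (w i s) -
        ∑ i ∈ level N (s + 1), d i (s + 1) * signedSum s (w i (s + 1))) := by
  simp only [levelUnit, ofMul_mul, ofMul_zpow, ofMul_prod, map_add, map_zsmul, map_sum, hY,
    Finset.sum_sub_distrib]
  rw [sum_lt_sub_mul _ (fun i l => hanti i _ l _) fun i => h0 i _ _,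
    sum_lt_sub_mul _ (fun i l => hanti i _ l _) fun i => h0 i _ _, sum_lt_sub_mul e qanti q0,
    sum_lt_sub_mul e qanti q0]
  have e1 : ∑ i ∈ level N s, ∑ l ∈ level N (s + 1), (d i s - d l (s + 1)) * w i s l (s + 1) =
      ∑ i ∈ level N s, d i s * ∑ l ∈ level N (s + 1), w i s l (s + 1) +
        ∑ i ∈ level N (s + 1), d i (s + 1) * ∑ l ∈ level N s, w i (s + 1) l s := by
    simp only [sub_mul, Finset.sum_sub_distrib, Finset.mul_sum]
    rw [sub_eq_add_neg, Finset.sum_comm (s := level N (s + 1)) (t := level N s),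
      ← Finset.sum_neg_distrib]
    congr 1
    refine Finset.sum_congr rfl fun i _ => ?_
    rw [← Finset.sum_neg_distrib]
    refine Finset.sum_congr rfl fun l _ => ?_
    rw [hanti i]; ring
  have e2 : ∑ i ∈ level N s, ∑ l ∈ level N (s + 1), (e i - e l) * q i l =
      ∑ i ∈ level N s, e i * ∑ l ∈ level N (s + 1), q i l +
        ∑ i ∈ level N (s + 1), e i * ∑ l ∈ level N s, q i l := by
    simp only [sub_mul, Finset.sum_sub_distrib, Finset.mul_sum]
    rw [sub_eq_add_neg, Finset.sum_comm (s := level N (s + 1)) (t := level N s),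
      ← Finset.sum_neg_distrib]
    congr 1
    refine Finset.sum_congr rfl fun i _ => ?_
    rw [← Finset.sum_neg_distrib]
    refine Finset.sum_congr rfl fun l _ => ?_
    rw [qanti i]; ring
  have e3 : ∑ i ∈ level N (s + 1), e i * ∑ l ∈ level N (s + 1), q i l +
      ∑ i ∈ level N s, e i * ∑ l ∈ level N s, q i l =
      ∑ i ∈ level N s, e i * ∑ l ∈ level N (s + 1), q i l +
        ∑ i ∈ level N (s + 1), e i * ∑ l ∈ level N s, q i l := by
    rw [level_succ hs, Finset.sum_insert (top_notMem_level hs),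
      Finset.sum_insert (top_notMem_level hs)]
    simp only [Finset.sum_insert (top_notMem_level hs), q0, mul_add, Finset.sum_add_distrib]
    ring
  rw [e1, e2]
  simp only [signedSum, mul_sub, Finset.sum_sub_distrib, zsmul_eq_mul, Int.cast_neg]
  linear_combination (ν : S) * e3

/-- The product of the kernels of all levels. -/
def kernelUnit (Y : Fin (N + 1) → ℕ → Fin (N + 1) → ℕ → Sˣ) (ν : ℤ) : Sˣ :=
  ∏ s ∈ Finset.range N, levelUnit Y ν s

theorem unitLog_kernelUnit_of_column (D : Derivation R S S)
    {Y : Fin (N + 1) → ℕ → Fin (N + 1) → ℕ → Sˣ}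
    {w : Fin (N + 1) → ℕ → Fin (N + 1) → ℕ → S} (hanti : ∀ i j l k, w i j l k = -w l k i j)
    (h0 : ∀ i j k, w i j i k = 0) {q : Fin (N + 1) → Fin (N + 1) → S}
    (qanti : ∀ i l, q i l = -q l i) (q0 : ∀ i, q i i = 0) (a : Fin (N + 1))
    (hY : ∀ i j l k, unitLog D (Additive.ofMul (Y i j l k)) =
      ((if i = a then 1 else 0) - if l = a then 1 else 0) * (w i j l k - q i l)) (ν : ℤ) :
    unitLog D (Additive.ofMul (kernelUnit Y ν)) = ν * driftSum w N a := by
  rw [kernelUnit, ofMul_prod, map_sum, driftSum, Finset.mul_sum]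
  refine Finset.sum_congr rfl fun s hs => ?_
  rw [unitLog_levelUnit D hanti h0 qanti q0 (fun i _ => if i = a then 1 else 0)
    (fun i => if i = a then 1 else 0) (fun i j l k => by rw [hY]; ring) ν (Finset.mem_range.mp hs)]
  simp [Finset.sum_ite_eq']

theorem unitLog_kernelUnit_of_particle (D : Derivation R S S)
    {Y : Fin (N + 1) → ℕ → Fin (N + 1) → ℕ → Sˣ}
    {w : Fin (N + 1) → ℕ → Fin (N + 1) → ℕ → S} (hanti : ∀ i j l k, w i j l k = -w l k i j)
    (h0 : ∀ i j k, w i j i k = 0) {a : Fin (N + 1)} {r : ℕ} (ha : a ∈ level N r) (hr : r < N)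
    (c : S) (hY : ∀ i j l k, unitLog D (Additive.ofMul (Y i j l k)) =
      ((if i = a ∧ j ≤ r then c else 0) - if l = a ∧ k ≤ r then c else 0) * w i j l k) (ν : ℤ) :
    unitLog D (Additive.ofMul (kernelUnit Y ν)) =
      ν * (c * (driftSum w r a + signedSum r (w a r))) := by
  rw [kernelUnit, ofMul_prod, map_sum]
  have e : ∀ s ∈ Finset.range N, unitLog D (Additive.ofMul (levelUnit Y ν s)) =
      ν * ((if s < r then c * ((if a ∈ level N s then signedSum s (w a s) else 0) -
          if a ∈ level N (s + 1) then signedSum s (w a (s + 1)) else 0) else 0) +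
        if s = r then c * signedSum r (w a r) else 0) := by
    intro s hs
    rw [unitLog_levelUnit D hanti h0 (q := fun _ _ => 0) (by simp) (by simp)
      (fun i j => if i = a ∧ j ≤ r then c else 0) (fun _ => 0)
      (fun i j l k => by rw [hY]; ring) ν (Finset.mem_range.mp hs)]
    congr 1
    simp only [ite_mul, zero_mul, ite_and, Finset.sum_ite_eq']
    rcases lt_trichotomy s r with h | h | h
    · simp only [h, h.le, h.ne, Nat.succ_le_of_lt h, if_true, if_false, add_zero, mul_sub, mul_ite,
        mul_zero]
    · subst h
      simp [ha]
    · simp [h.not_gt, h.not_ge, h.ne', (Nat.lt_succ_of_lt h).not_ge]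
  rw [Finset.sum_congr rfl e, ← Finset.mul_sum, Finset.sum_add_distrib, ← Finset.sum_filter,
    Finset.sum_ite_eq', if_pos (Finset.mem_range.mpr hr), ← Finset.mul_sum, mul_add, driftSum]
  have : (Finset.range N).filter (· < r) = Finset.range r := by
    ext s; simp only [Finset.mem_filter, Finset.mem_range]; omega
  rw [this, mul_add, mul_add]

end LevelProducts

section Coefficients

variable {N : ℕ}

/-- Polynomials in the coordinates `x_i` and in further variables, antisymmetrised differences of
which stand for the inverse differences `1 / (x_i - x_l)`. -/
abbrev Coef (N : ℕ) : Type := MvPolynomial (Fin (N + 1) ⊕ (Fin (N + 1) × Fin (N + 1))) ℂ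

/-- The element of `Coef N` which stands for `1 / (x_i - x_l)`. -/
def invDiff (i l : Fin (N + 1)) : Coef N :=
  MvPolynomial.X (Sum.inr (i, l)) - MvPolynomial.X (Sum.inr (l, i))

theorem invDiff_antisymm (i l : Fin (N + 1)) : invDiff i l = -invDiff l i := by
  simp [invDiff]

theorem invDiff_self (i : Fin (N + 1)) : invDiff i i = 0 := sub_self _

/-- The partial derivative with respect to `x_a`. -/
def coefDeriv (a : Fin (N + 1)) : Derivation ℂ (Coef N) (Coef N) :=
  MvPolynomial.mkDerivation ℂ (Sum.elim (fun i => if i = a then 1 else 0) fun p =>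
    -(MvPolynomial.C (1 / 2) *
      (((if p.1 = a then 1 else 0) - if p.2 = a then 1 else 0) * invDiff p.1 p.2 ^ 2)))

theorem coefDeriv_X (a i : Fin (N + 1)) :
    coefDeriv a (MvPolynomial.X (Sum.inl i)) = if i = a then 1 else 0 :=
  MvPolynomial.mkDerivation_X _ _ _

theorem coefDeriv_invDiff (a i l : Fin (N + 1)) : coefDeriv a (invDiff i l) =
    -(((if i = a then 1 else 0) - if l = a then 1 else 0) * invDiff i l ^ 2) := by
  have h2 : (MvPolynomial.C (1 / 2) : Coef N) * 2 = 1 := by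
    rw [← map_ofNat (MvPolynomial.C : ℂ →+* Coef N) 2, ← MvPolynomial.C_mul]
    norm_num
  have h : coefDeriv a (invDiff i l) = -(MvPolynomial.C (1 / 2) *
        (((if i = a then 1 else 0) - if l = a then 1 else 0) * invDiff i l ^ 2)) -
      -(MvPolynomial.C (1 / 2) *
        (((if l = a then 1 else 0) - if i = a then 1 else 0) * invDiff l i ^ 2)) := by
    conv_lhs => rw [invDiff, map_sub]
    rw [coefDeriv, MvPolynomial.mkDerivation_X, MvPolynomial.mkDerivation_X]
    rfl
  rw [h, invDiff_antisymm l i]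
  linear_combination (-((if i = a then 1 else 0) - if l = a then 1 else 0) *
    invDiff i l ^ 2) * h2

/-- The value at a point `x`. -/
def coefEval (x : Fin (N + 1) → ℂ) : Coef N →+* ℂ :=
  MvPolynomial.eval (Sum.elim x fun p => (x p.1 - x p.2)⁻¹ / 2)

theorem coefEval_C (x : Fin (N + 1) → ℂ) (c : ℂ) : coefEval x (MvPolynomial.C c) = c :=
  MvPolynomial.eval_C _

theorem coefEval_X (x : Fin (N + 1) → ℂ) (i : Fin (N + 1)) :
    coefEval x (MvPolynomial.X (Sum.inl i)) = x i := MvPolynomial.eval_X _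

theorem coefEval_invDiff (x : Fin (N + 1) → ℂ) (i l : Fin (N + 1)) :
    coefEval x (invDiff i l) = (x i - x l)⁻¹ := by
  simp only [coefEval, invDiff, map_sub, MvPolynomial.eval_X, Sum.elim_inr]
  rw [← neg_sub (x i) (x l), inv_neg]
  ring

theorem coefEval_smul (x : Fin (N + 1) → ℂ) (c : ℂ) (F : Coef N) :
    coefEval x (c • F) = c * coefEval x F := MvPolynomial.smul_eval _ _ _

theorem hasDerivAt_coefEval_comp {γ : ℂ → Fin (N + 1) → ℂ} {v : Fin (N + 1) → ℂ} {t : ℂ}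
    (hγ : ∀ i, HasDerivAt (fun s => γ s i) (v i) t) (hx : Function.Injective (γ t)) (F : Coef N) :
    HasDerivAt (fun s => coefEval (γ s) F) (∑ a, v a * coefEval (γ t) (coefDeriv a F)) t := by
  induction F using MvPolynomial.induction_on with
  | C c =>
    simp only [coefEval_C]
    simp only [← MvPolynomial.algebraMap_eq, Derivation.map_algebraMap, map_zero, mul_zero,
      Finset.sum_const_zero]
    exact hasDerivAt_const _ _
  | add F G hF hG =>
    simp only [map_add, mul_add, Finset.sum_add_distrib]
    exact hF.fun_add hG
  | mul_X F w hF =>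
    have hw : HasDerivAt (fun s => coefEval (γ s) (MvPolynomial.X w))
        (∑ a, v a * coefEval (γ t) (coefDeriv a (MvPolynomial.X w))) t := by
      rcases w with i | ⟨i, l⟩
      · simp only [coefEval_X, coefDeriv_X, apply_ite (coefEval (γ t)), map_one, map_zero,
          mul_ite, mul_one, mul_zero, Finset.sum_ite_eq, Finset.mem_univ, if_true]
        exact hγ i
      · have e : ∀ a, v a * coefEval (γ t) (coefDeriv a (MvPolynomial.X (Sum.inr (i, l)))) =
            (if i = a then -v a * ((γ t i - γ t l)⁻¹ ^ 2) / 2 else 0) -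
              if l = a then -v a * ((γ t i - γ t l)⁻¹ ^ 2) / 2 else 0 := by
          intro a
          rw [coefDeriv, MvPolynomial.mkDerivation_X, Sum.elim_inr]
          simp only [map_neg, map_mul, map_sub, map_pow, coefEval_C, coefEval_invDiff,
            apply_ite (coefEval (γ t)), map_one, map_zero]
          split_ifs <;> ring
        simp only [e, Finset.sum_sub_distrib, Finset.sum_ite_eq, Finset.mem_univ, if_true]
        simp only [coefEval, MvPolynomial.eval_X, Sum.elim_inr]
        by_cases hil : i = l
        · subst hil
          simpa using hasDerivAt_const t (0 : ℂ)
        · have hne : γ t i - γ t l ≠ 0 := sub_ne_zero.mpr fun h => hil (hx h)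
          refine ((((hγ i).fun_sub (hγ l)).fun_inv hne).div_const 2).congr_deriv ?_
          field_simp
          ring
    simp only [map_mul, Derivation.leibniz, smul_eq_mul, map_add]
    refine (hF.fun_mul hw).congr_deriv ?_
    rw [Finset.sum_mul, Finset.mul_sum, ← Finset.sum_add_distrib]
    refine Finset.sum_congr rfl fun a _ => ?_
    ring

theorem hasDerivAt_coefEval {x : Fin (N + 1) → ℂ} (hx : Function.Injective x) (a : Fin (N + 1))
    (F : Coef N) :
    HasDerivAt (fun s => coefEval (Function.update x a s) F) (coefEval x (coefDeriv a F))
      (x a) := by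
  have hu : ∀ i, HasDerivAt (fun s => Function.update x a s i) (if i = a then 1 else 0) (x a) := by
    intro i
    by_cases h : i = a
    · subst h; simpa using hasDerivAt_id' (x i)
    · simpa [h] using hasDerivAt_const (x a) (x i)
  have := hasDerivAt_coefEval_comp hu (by rwa [Function.update_eq_self]) F
  simpa [Function.update_eq_self] using this

theorem isOpen_injective : IsOpen {x : Fin (N + 1) → ℂ | Function.Injective x} := by
  have : {x : Fin (N + 1) → ℂ | Function.Injective x} =
      ⋂ i, ⋂ l, {x | i ≠ l → x i ≠ x l} := by
    ext x
    simp only [Set.mem_ofPred_eq, Set.mem_iInter, ne_eq, Function.Injective]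
    exact forall₂_congr fun i l => not_imp_not.symm
  rw [this]
  refine isOpen_iInter_of_finite fun i => isOpen_iInter_of_finite fun l => ?_
  by_cases h : i = l
  · simp [h]
  · simp only [ne_eq, h, not_false_eq_true, forall_const]
    exact isOpen_ne_fun (continuous_apply i) (continuous_apply l)

theorem continuousAt_coefEval {x : Fin (N + 1) → ℂ} (hx : Function.Injective x) (F : Coef N) :
    ContinuousAt (fun y => coefEval y F) x := by
  induction F using MvPolynomial.induction_on with
  | C c => simpa only [coefEval_C] using continuousAt_const
  | add F G hF hG => simpa only [map_add] using hF.fun_add hG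
  | mul_X F v hF =>
    simp only [map_mul]
    refine hF.mul ?_
    rcases v with i | ⟨i, l⟩
    · simpa only [coefEval_X] using (continuous_apply i).continuousAt
    · simp only [coefEval, MvPolynomial.eval_X, Sum.elim_inr]
      by_cases hil : i = l
      · subst hil
        simpa using continuousAt_const
      · exact ((((continuous_apply i).sub (continuous_apply l)).continuousAt).inv₀
          (sub_ne_zero.mpr fun h => hil (hx h))).div_const 2

end Coefficients

section Series

variable {N : ℕ}

/-- Power series in the integration variables. -/
abbrev Ser (N : ℕ) : Type := MvPowerSeries (Fin (N + 1) × ℕ) (Coef N)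

/-- The displacement `t_{i,j} - x_i`. -/
def ell (i : Fin (N + 1)) (j : ℕ) : Ser N := ∑ s ∈ Finset.Ico j N, MvPowerSeries.X (i, s)

/-- The ratio `(t_{i,j} - t_{l,k}) / (x_i - x_l)`. -/
def ratioSer (i : Fin (N + 1)) (j : ℕ) (l : Fin (N + 1)) (k : ℕ) : Ser N :=
  1 + MvPowerSeries.C (invDiff i l) * (ell i j - ell l k)

theorem constantCoeff_ell (i : Fin (N + 1)) (j : ℕ) :
    MvPowerSeries.constantCoeff (ell i j) = 0 := by
  simp [ell]

theorem constantCoeff_ratioSer (i : Fin (N + 1)) (j : ℕ) (l : Fin (N + 1)) (k : ℕ) :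
    MvPowerSeries.constantCoeff (ratioSer i j l k) = ((1 : (Coef N)ˣ) : Coef N) := by
  simp [ratioSer, constantCoeff_ell]

/-- The ratio `(t_{i,j} - t_{l,k}) / (x_i - x_l)` as a unit. -/
def ratioUnit (i : Fin (N + 1)) (j : ℕ) (l : Fin (N + 1)) (k : ℕ) : (Ser N)ˣ where
  val := ratioSer i j l k
  inv := MvPowerSeries.invOfUnit (ratioSer i j l k) 1
  val_inv := MvPowerSeries.mul_invOfUnit _ _ (constantCoeff_ratioSer i j l k)
  inv_val := MvPowerSeries.invOfUnit_mul _ _ (constantCoeff_ratioSer i j l k)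

theorem val_ratioUnit (i : Fin (N + 1)) (j : ℕ) (l : Fin (N + 1)) (k : ℕ) :
    (ratioUnit i j l k : Ser N) = 1 + MvPowerSeries.C (invDiff i l) * (ell i j - ell l k) := rfl

theorem ratioUnit_symm (i : Fin (N + 1)) (j : ℕ) (l : Fin (N + 1)) (k : ℕ) :
    ratioUnit i j l k = ratioUnit l k i j := by
  ext1
  rw [val_ratioUnit, val_ratioUnit, invDiff_antisymm, map_neg]
  ring

/-- The inverse difference `1 / (t_{i,j} - t_{l,k})`. -/
def invSer (i : Fin (N + 1)) (j : ℕ) (l : Fin (N + 1)) (k : ℕ) : Ser N :=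
  (MvPowerSeries.C (invDiff i l) : Ser N) * (↑(ratioUnit i j l k)⁻¹ : Ser N)

theorem invSer_antisymm (i : Fin (N + 1)) (j : ℕ) (l : Fin (N + 1)) (k : ℕ) :
    invSer i j l k = -invSer l k i j := by
  rw [invSer, invSer, ratioUnit_symm, invDiff_antisymm, map_neg, neg_mul]

theorem invSer_self (i : Fin (N + 1)) (j k : ℕ) : invSer i j i k = 0 := by
  rw [invSer, invDiff_self, map_zero, zero_mul]

theorem invSer_top (i l : Fin (N + 1)) : invSer i N l N = MvPowerSeries.C (invDiff i l) := by
  have : ratioUnit i N l N = 1 := by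
    ext1
    simp [val_ratioUnit, ell]
  rw [invSer, this, inv_one, Units.val_one, mul_one]

theorem invSer_sub_invSer (i : Fin (N + 1)) (j j' : ℕ) (l : Fin (N + 1)) (k : ℕ) :
    invSer i j l k - invSer i j' l k =
      (ell i j' - ell i j) * (invSer i j l k * invSer i j' l k) := by
  have h1 := (ratioUnit i j l k).inv_mul
  have h2 := (ratioUnit i j' l k).inv_mul
  rw [val_ratioUnit] at h1 h2
  simp only [invSer]
  set u := (↑(ratioUnit i j l k)⁻¹ : Ser N)
  set v := (↑(ratioUnit i j' l k)⁻¹ : Ser N)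
  set c := (MvPowerSeries.C (invDiff i l) : Ser N)
  linear_combination c * v * h1 - c * u * h2

/-- The partial derivative of a power series with respect to `x_a`. -/
abbrev serDeriv (a : Fin (N + 1)) : Derivation ℂ (Ser N) (Ser N) :=
  coeffDerivation _ (coefDeriv a)

/-- The Euler operator of an integration variable. -/
abbrev serEuler (p : Fin (N + 1) × ℕ) : Derivation ℂ (Ser N) (Ser N) :=
  eulerDerivation ℂ (Coef N) p

theorem serDeriv_ell (a i : Fin (N + 1)) (j : ℕ) : serDeriv a (ell i j) = 0 := by
  simp [ell, coeffDerivation_X]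

theorem serEuler_ell {p : Fin (N + 1) × ℕ} (hp : p.2 < N) (i : Fin (N + 1)) (j : ℕ) :
    serEuler p (ell i j) = if i = p.1 ∧ j ≤ p.2 then MvPowerSeries.X p else 0 := by
  simp only [ell, map_sum, eulerDerivation_X]
  split_ifs with h
  · obtain ⟨rfl, h⟩ := h
    rw [Finset.sum_eq_single p.2]
    · simp
    · intro s _ hs
      exact if_neg fun h' => hs (congrArg Prod.snd h')
    · intro hn
      exact absurd (Finset.mem_Ico.mpr ⟨h, hp⟩) hn
  · refine Finset.sum_eq_zero fun s hs => if_neg fun h' => h ⟨congrArg Prod.fst h', ?_⟩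
    rw [← congrArg Prod.snd h']
    exact (Finset.mem_Ico.mp hs).1

theorem unitLog_serDeriv_ratioUnit (a i : Fin (N + 1)) (j : ℕ) (l : Fin (N + 1)) (k : ℕ) :
    unitLog (serDeriv a) (Additive.ofMul (ratioUnit i j l k)) =
      ((if i = a then 1 else 0) - if l = a then 1 else 0) *
        (invSer i j l k - MvPowerSeries.C (invDiff i l)) := by
  change ↑(ratioUnit i j l k)⁻¹ * serDeriv a (ratioUnit i j l k : Ser N) = _
  have h1 := (ratioUnit i j l k).inv_mul
  rw [val_ratioUnit] at h1 ⊢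
  rw [map_add, Derivation.leibniz, map_sub, serDeriv_ell, serDeriv_ell, coeffDerivation_C,
    coefDeriv_invDiff, Derivation.map_one_eq_zero, invSer]
  simp only [map_neg, map_mul, map_pow, smul_eq_mul, map_sub, apply_ite MvPowerSeries.C, map_one,
    map_zero]
  linear_combination (-((if i = a then 1 else 0) - if l = a then 1 else 0) *
    MvPowerSeries.C (invDiff i l)) * h1

theorem unitLog_serEuler_ratioUnit (p : Fin (N + 1) × ℕ) (i : Fin (N + 1)) (j : ℕ)
    (l : Fin (N + 1)) (k : ℕ) :
    unitLog (serEuler p) (Additive.ofMul (ratioUnit i j l k)) =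
      (serEuler p (ell i j) - serEuler p (ell l k)) * invSer i j l k := by
  change ↑(ratioUnit i j l k)⁻¹ * serEuler p (ratioUnit i j l k : Ser N) = _
  rw [val_ratioUnit, map_add, Derivation.leibniz, map_sub, eulerDerivation_C,
    Derivation.map_one_eq_zero, invSer]
  simp only [smul_eq_mul]
  ring

theorem serDeriv_invSer (a i : Fin (N + 1)) (j : ℕ) (l : Fin (N + 1)) (k : ℕ) :
    serDeriv a (invSer i j l k) =
      -(((if i = a then 1 else 0) - if l = a then 1 else 0) * invSer i j l k ^ 2) := by
  have h := derivation_unit_inv (serDeriv a) (ratioUnit i j l k)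
  rw [unitLog_serDeriv_ratioUnit] at h
  rw [invSer, Derivation.leibniz, h, coeffDerivation_C, coefDeriv_invDiff]
  simp only [map_neg, map_mul, map_pow, smul_eq_mul, map_sub, apply_ite MvPowerSeries.C, map_one,
    map_zero, invSer]
  ring

theorem serEuler_invSer (p : Fin (N + 1) × ℕ) (i : Fin (N + 1)) (j : ℕ) (l : Fin (N + 1))
    (k : ℕ) : serEuler p (invSer i j l k) =
      -((serEuler p (ell i j) - serEuler p (ell l k)) * invSer i j l k ^ 2) := by
  have h := derivation_unit_inv (serEuler p) (ratioUnit i j l k)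
  rw [unitLog_serEuler_ratioUnit] at h
  rw [invSer, Derivation.leibniz, h, eulerDerivation_C]
  simp only [smul_eq_mul, invSer]
  ring

/-- The normalised integrand without its exponential factor, as a power series. -/
def kernelSer (N : ℕ) (ν : ℤ) : Ser N := (kernelUnit ratioUnit ν : (Ser N)ˣ)

theorem serDeriv_kernelSer (ν : ℤ) (a : Fin (N + 1)) :
    serDeriv a (kernelSer N ν) = kernelSer N ν * (ν * driftSum invSer N a) := by
  rw [kernelSer, derivation_unit, unitLog_kernelUnit_of_column _ invSer_antisymm invSer_self
    (q := fun i l => MvPowerSeries.C (invDiff i l)) (fun i l => by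
      rw [invDiff_antisymm, map_neg]) (fun i => by rw [invDiff_self, map_zero]) a
    (unitLog_serDeriv_ratioUnit a) ν]

theorem serDeriv_driftSum (a : Fin (N + 1)) :
    serDeriv a (driftSum invSer N a) = driftSqSum invSer N a := by
  have e : ∀ s j, serDeriv a (signedSum s (invSer a j)) =
      -signedSum s (fun l k => invSer a j l k ^ 2) := by
    intro s j
    have : ∀ l k, serDeriv a (invSer a j l k) = -invSer a j l k ^ 2 := by
      intro l k
      rw [serDeriv_invSer]
      by_cases h : l = a
      · subst h; simp [invSer_self]
      · simp [h]
    simp only [signedSum, map_sub, map_sum, this, Finset.sum_neg_distrib]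
    ring
  simp only [driftSum, driftSqSum, map_sum, map_sub]
  refine Finset.sum_congr rfl fun s _ => ?_
  rw [apply_ite (serDeriv a), apply_ite (serDeriv a), e, e, map_zero]
  split_ifs <;> ring

theorem serDeriv_serDeriv_kernelSer (ν : ℤ) (a : Fin (N + 1)) :
    serDeriv a (serDeriv a (kernelSer N ν)) = kernelSer N ν *
      ((ν : Ser N) ^ 2 * driftSum invSer N a ^ 2 + ν * driftSqSum invSer N a) := by
  rw [serDeriv_kernelSer, Derivation.leibniz, Derivation.leibniz, serDeriv_kernelSer,
    serDeriv_driftSum, Derivation.map_intCast]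
  simp only [smul_eq_mul]
  ring

/-- The series whose multiples are the components of the flux. -/
def fluxSer (p : Fin (N + 1) × ℕ) : Ser N :=
  signedSum p.2 fun l k => invSer p.1 (p.2 + 1) l k * invSer p.1 p.2 l k

theorem ell_eq_add {i : Fin (N + 1)} {s : ℕ} (hs : s < N) :
    ell i s = MvPowerSeries.X (i, s) + ell i (s + 1) := by
  rw [ell, Finset.sum_eq_sum_Ico_succ_bot hs]
  rfl

theorem signedSum_sub_eq (i : Fin (N + 1)) {s : ℕ} (hs : s < N) :
    signedSum s (invSer i (s + 1)) - signedSum s (invSer i s) =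
      MvPowerSeries.X (i, s) * fluxSer (i, s) := by
  have e : ∀ l k, MvPowerSeries.X (i, s) * (invSer i (s + 1) l k * invSer i s l k) =
      invSer i (s + 1) l k - invSer i s l k := by
    intro l k
    rw [invSer_sub_invSer, ell_eq_add hs]
    ring
  simp only [fluxSer, signedSum, mul_sub, Finset.mul_sum, e, Finset.sum_sub_distrib]
  ring

theorem serEuler_kernelSer (ν : ℤ) {p : Fin (N + 1) × ℕ} (h1 : p.1.val ≤ p.2) (h2 : p.2 < N) :
    serEuler p (kernelSer N ν) = kernelSer N ν *
      ((ν : Ser N) * (MvPowerSeries.X p *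
        (driftSum invSer p.2 p.1 + signedSum p.2 (invSer p.1 p.2)))) := by
  rw [kernelSer, derivation_unit, unitLog_kernelUnit_of_particle _ invSer_antisymm invSer_self
    (mem_level.mpr h1) h2 (MvPowerSeries.X p) (fun i j l k => by
      rw [unitLog_serEuler_ratioUnit, serEuler_ell h2, serEuler_ell h2])]

theorem fluxSer_add_serEuler {p : Fin (N + 1) × ℕ} (h2 : p.2 < N) :
    fluxSer p + serEuler p (fluxSer p) = signedSum p.2 fun l k => invSer p.1 p.2 l k ^ 2 := by
  have e : ∀ l k, serEuler p (invSer p.1 (p.2 + 1) l k * invSer p.1 p.2 l k) =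
      invSer p.1 p.2 l k ^ 2 - invSer p.1 (p.2 + 1) l k * invSer p.1 p.2 l k := by
    intro l k
    by_cases hl : l = p.1
    · subst hl; simp [invSer_self]
    · have h3 := invSer_sub_invSer p.1 (p.2 + 1) p.2 l k
      rw [ell_eq_add h2] at h3
      rw [Derivation.leibniz, serEuler_invSer, serEuler_invSer]
      simp only [serEuler_ell h2, hl, false_and, if_false, true_and, le_refl, if_true,
        Nat.not_succ_le_self, smul_eq_mul, sub_zero]
      linear_combination invSer p.1 p.2 l k * h3
  simp only [fluxSer, signedSum, map_sub, map_sum, e, Finset.sum_sub_distrib]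
  ring

end Series

section Laplace

variable {σ : Type*} [DecidableEq σ] {A : Type*} [CommRing A] [Algebra ℂ A]

/-- The weight of a monomial under the normalised Laplace functional with exponent `ν`. -/
def laplaceWeight (T : Finset σ) (ν : ℂ) (μ : σ → ℂ) (d : σ →₀ ℕ) : ℂ :=
  ∏ p ∈ T, (∏ r ∈ Finset.range (d p), (ν + 1 + r)) * (-μ p)⁻¹ ^ d p

/-- The normalised Laplace functional on the homogeneous component of degree `k`. -/
def laplaceCoeff (T : Finset σ) (ν : ℂ) (μ : σ → ℂ) (k : ℕ) : MvPowerSeries σ A →ₗ[ℂ] A where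
  toFun F := ∑ d ∈ T.finsuppAntidiag k, laplaceWeight T ν μ d • MvPowerSeries.coeff d F
  map_add' F G := by simp [smul_add, Finset.sum_add_distrib]
  map_smul' c F := by
    simp only [Finset.smul_sum, RingHom.id_apply]
    refine Finset.sum_congr rfl fun d _ => ?_
    rw [smul_comm c]
    rfl

theorem laplaceCoeff_apply (T : Finset σ) (ν : ℂ) (μ : σ → ℂ) (k : ℕ) (F : MvPowerSeries σ A) :
    laplaceCoeff T ν μ k F =
      ∑ d ∈ T.finsuppAntidiag k, laplaceWeight T ν μ d • MvPowerSeries.coeff d F := rfl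

theorem laplaceCoeff_zero (T : Finset σ) (ν : ℂ) (μ : σ → ℂ) (F : MvPowerSeries σ A) :
    laplaceCoeff T ν μ 0 F = MvPowerSeries.constantCoeff F := by
  rw [laplaceCoeff_apply, Finset.finsuppAntidiag_zero, Finset.sum_singleton]
  simp [laplaceWeight]

theorem laplaceWeight_add_single {T : Finset σ} (ν : ℂ) (μ : σ → ℂ) {p : σ} (hp : p ∈ T)
    (d : σ →₀ ℕ) : laplaceWeight T ν μ (d + Finsupp.single p 1) =
      laplaceWeight T ν μ d * ((ν + 1 + d p) * (-μ p)⁻¹) := by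
  rw [laplaceWeight, laplaceWeight, ← Finset.mul_prod_erase T _ hp, ← Finset.mul_prod_erase T _ hp]
  have : ∀ q ∈ T.erase p, (d + Finsupp.single p 1 : σ →₀ ℕ) q = d q := by
    intro q hq
    rw [Finsupp.add_apply, Finsupp.single_eq_of_ne (Finset.ne_of_mem_erase hq), add_zero]
  have h2 : ∏ q ∈ T.erase p, (∏ r ∈ Finset.range ((d + Finsupp.single p 1 : σ →₀ ℕ) q),
        (ν + 1 + r)) * (-μ q)⁻¹ ^ (d + Finsupp.single p 1 : σ →₀ ℕ) q =
      ∏ q ∈ T.erase p, (∏ r ∈ Finset.range (d q), (ν + 1 + r)) * (-μ q)⁻¹ ^ d q :=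
    Finset.prod_congr rfl fun q hq => by rw [this q hq]
  rw [h2, Finsupp.add_apply, Finsupp.single_eq_same, Finset.prod_range_succ, pow_succ]
  ring

theorem laplaceCoeff_shift {T : Finset σ} (ν : ℂ) {μ : σ → ℂ} {p : σ} (hp : p ∈ T)
    (hμ : μ p ≠ 0) (k : ℕ) (F : MvPowerSeries σ A) :
    laplaceCoeff T ν μ k ((ν + 1) • F + eulerDerivation ℂ A p F) =
      -(μ p • laplaceCoeff T ν μ (k + 1) (MvPowerSeries.X p * F)) := by
  have key : ∑ e ∈ T.finsuppAntidiag k, laplaceWeight T ν μ (e + Finsupp.single p 1) •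
        MvPowerSeries.coeff e F = laplaceCoeff T ν μ (k + 1) (MvPowerSeries.X p * F) := by
    rw [laplaceCoeff_apply]
    refine Finset.sum_of_injOn (fun e => e + Finsupp.single p 1)
      (fun a _ b _ h => add_right_cancel h) ?_ ?_ ?_
    · intro e he
      rw [Finset.mem_coe, Finset.mem_finsuppAntidiag] at he ⊢
      refine ⟨?_, ?_⟩
      · rw [← he.1]
        simp only [Finsupp.coe_add, Pi.add_apply, Finset.sum_add_distrib, Finsupp.single_apply,
          Finset.sum_ite_eq, if_pos hp]
      · refine Finsupp.support_add.trans (Finset.union_subset he.2 ?_)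
        exact (Finsupp.support_single_subset).trans (Finset.singleton_subset_iff.mpr hp)
    · intro d hd hn
      have h0 : ¬ Finsupp.single p 1 ≤ d := by
        intro hle
        refine hn ⟨d - Finsupp.single p 1, ?_, tsub_add_cancel_of_le hle⟩
        rw [Finset.mem_finsuppAntidiag] at hd
        rw [Finset.mem_coe, Finset.mem_finsuppAntidiag]
        constructor
        · have h1 : T.sum ⇑(d - Finsupp.single p 1 : σ →₀ ℕ) + 1 = T.sum d := by
            conv_rhs => rw [← tsub_add_cancel_of_le hle]
            simp only [Finsupp.coe_add, Pi.add_apply, Finset.sum_add_distrib, Finsupp.single_apply,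
              Finset.sum_ite_eq, if_pos hp]
          rw [hd.1] at h1
          exact Nat.succ_injective h1
        · exact (Finsupp.support_mono tsub_le_self).trans hd.2
      rw [MvPowerSeries.X, MvPowerSeries.coeff_monomial_mul, if_neg h0, smul_zero]
    · intro e _
      rw [add_comm e, MvPowerSeries.X, MvPowerSeries.coeff_add_monomial_mul, one_mul]
  rw [← key, laplaceCoeff_apply, Finset.smul_sum, ← Finset.sum_neg_distrib]
  refine Finset.sum_congr rfl fun e _ => ?_
  have h1 : MvPowerSeries.coeff e ((ν + 1) • F) = (ν + 1) • MvPowerSeries.coeff e F := rfl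
  rw [laplaceWeight_add_single ν μ hp, map_add, coeff_eulerDerivation, smul_smul, ← neg_smul, h1,
    ← Nat.cast_smul_eq_nsmul ℂ (e p), ← add_smul, smul_smul]
  congr 1
  rw [inv_neg]
  field_simp

theorem derivation_laplaceCoeff (D : Derivation ℂ A A) (T : Finset σ) (ν : ℂ) (μ : σ → ℂ) (k : ℕ)
    (F : MvPowerSeries σ A) :
    D (laplaceCoeff T ν μ k F) = laplaceCoeff T ν μ k (coeffDerivation σ D F) := by
  simp only [laplaceCoeff_apply, map_sum, Derivation.map_smul, coeff_coeffDerivation]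

theorem map_laplaceCoeff {B : Type*} [CommRing B] [Algebra ℂ B] (φ : A →+* B)
    (hφ : ∀ (c : ℂ) a, φ (c • a) = c • φ a) (T : Finset σ) (ν : ℂ) (μ : σ → ℂ) (k : ℕ)
    (F : MvPowerSeries σ A) :
    φ (laplaceCoeff T ν μ k F) = laplaceCoeff T ν μ k (MvPowerSeries.map φ F) := by
  simp only [laplaceCoeff_apply, map_sum, hφ, MvPowerSeries.coeff_map]

end Laplace

section Recursion

variable {N : ℕ}

/-- The labels `(i, s)`, `i ≤ s < N`, of the integration variables. -/
def tri (N : ℕ) : Finset (Fin (N + 1) × ℕ) :=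
  (Finset.univ ×ˢ Finset.range N).filter fun p => p.1.val ≤ p.2

theorem mem_tri {p : Fin (N + 1) × ℕ} : p ∈ tri N ↔ p.2 < N ∧ p.1.val ≤ p.2 := by
  simp [tri]

@[to_additive]
theorem prod_tri {M : Type*} [CommMonoid M] (f : Fin (N + 1) × ℕ → M) :
    ∏ p ∈ tri N, f p = ∏ s ∈ Finset.range N, ∏ i ∈ level N s, f (i, s) := by
  rw [tri, Finset.prod_filter, Finset.prod_product_right]
  refine Finset.prod_congr rfl fun s _ => ?_
  rw [level, Finset.prod_filter]

/-- The difference `lam_i - lam_{s + 1}`. -/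
def mu (lam : Fin (N + 1) → ℂ) (p : Fin (N + 1) × ℕ) : ℂ :=
  lam p.1 - lam (Fin.ofNat (N + 1) (p.2 + 1))

theorem mu_ne_zero {lam : Fin (N + 1) → ℂ} (hlam : Function.Injective lam)
    {p : Fin (N + 1) × ℕ} (hp : p ∈ tri N) : mu lam p ≠ 0 := by
  rw [mem_tri] at hp
  refine sub_ne_zero.mpr fun h => ?_
  have := congrArg Fin.val (hlam h)
  rw [Fin.val_ofNat, Nat.mod_eq_of_lt (Nat.succ_lt_succ hp.1)] at this
  omega

/-- The homogeneous components of the formal solution with exponent `ν`. -/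
def baCoef (ν : ℤ) (lam : Fin (N + 1) → ℂ) (k : ℕ) : Coef N :=
  laplaceCoeff (tri N) ν (mu lam) k (kernelSer N ν)

theorem map_kernelSer {B : Type*} [CommRing B] (φ : Ser N →+* B) (ν : ℤ) :
    φ (kernelSer N ν) =
      (kernelUnit (fun i j l k => Units.map (φ : Ser N →* B) (ratioUnit i j l k)) ν : Bˣ) := by
  change ((Units.map (φ : Ser N →* B) (kernelUnit ratioUnit ν) : Bˣ) : B) = _
  simp only [kernelUnit, levelUnit, map_prod, map_mul, map_zpow]

theorem map_kernelSer_congr {B : Type*} [CommRing B] (φ ψ : Ser N →+* B)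
    (h : ∀ i j l k, φ (ratioSer i j l k) = ψ (ratioSer i j l k)) (ν : ℤ) :
    φ (kernelSer N ν) = ψ (kernelSer N ν) := by
  rw [map_kernelSer, map_kernelSer]
  congr 2
  ext i j l k
  exact h i j l k

theorem constantCoeff_kernelSer (ν : ℤ) :
    MvPowerSeries.constantCoeff (kernelSer N ν) = (1 : Coef N) := by
  rw [map_kernelSer, kernelUnit]
  have : ∀ i j l k, Units.map ((MvPowerSeries.constantCoeff : Ser N →+* Coef N) :
      Ser N →* Coef N) (ratioUnit i j l k) = 1 := by
    intro i j l k
    ext1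
    exact constantCoeff_ratioSer i j l k
  simp [levelUnit, this]

theorem baCoef_zero (ν : ℤ) (lam : Fin (N + 1) → ℂ) : baCoef ν lam 0 = 1 := by
  rw [baCoef, laplaceCoeff_zero, constantCoeff_kernelSer]

theorem sum_smul_serDeriv_kernelSer (ν : ℤ) (lam : Fin (N + 1) → ℂ) :
    ∑ a, lam a • serDeriv a (kernelSer N ν) = -((ν : ℂ) • ∑ p ∈ tri N,
      mu lam p • (MvPowerSeries.X p * (kernelSer N ν * fluxSer p))) := by
  have h := sum_mul_driftSum invSer_antisymm invSer_self
    (fun a => algebraMap ℂ (Ser N) (lam a))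
  have e : ∀ a, lam a • serDeriv a (kernelSer N ν) = kernelSer N ν * ν *
      (algebraMap ℂ (Ser N) (lam a) * driftSum invSer N a) := by
    intro a
    rw [serDeriv_kernelSer, Algebra.smul_def]
    ring
  rw [Finset.sum_congr rfl fun a _ => e a, ← Finset.mul_sum, h, sum_tri, Finset.mul_sum,
    Finset.smul_sum, ← Finset.sum_neg_distrib]
  refine Finset.sum_congr rfl fun s hs => ?_
  rw [Finset.mul_sum, Finset.smul_sum, ← Finset.sum_neg_distrib]
  refine Finset.sum_congr rfl fun i _ => ?_
  rw [Algebra.smul_def, Algebra.smul_def, map_intCast, mu, map_sub]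
  linear_combination (-kernelSer N ν * ν * (algebraMap ℂ (Ser N) (lam i) -
    algebraMap ℂ (Ser N) (lam (Fin.ofNat (N + 1) (s + 1))))) *
      signedSum_sub_eq i (Finset.mem_range.mp hs)

/-- The evaluation of the coefficients of a power series at a point `x`. -/
def serEval (x : Fin (N + 1) → ℂ) : Ser N →+* MvPowerSeries (Fin (N + 1) × ℕ) ℂ :=
  MvPowerSeries.map (coefEval x)

theorem serEval_ell (x : Fin (N + 1) → ℂ) (i : Fin (N + 1)) (j : ℕ) :
    serEval x (ell i j) = ∑ s ∈ Finset.Ico j N, MvPowerSeries.X (i, s) := by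
  simp [serEval, ell]

theorem serEval_ratioSer (x : Fin (N + 1) → ℂ) (i : Fin (N + 1)) (j : ℕ) (l : Fin (N + 1))
    (k : ℕ) : serEval x (ratioSer i j l k) =
      1 + MvPowerSeries.C (x i - x l)⁻¹ * (serEval x (ell i j) - serEval x (ell l k)) := by
  rw [ratioSer, map_add, map_one, map_mul, map_sub]
  congr 2
  rw [serEval, MvPowerSeries.map_C, coefEval_invDiff]

theorem serEval_eulerDerivation (x : Fin (N + 1) → ℂ) (p : Fin (N + 1) × ℕ) (F : Ser N) :
    serEval x (serEuler p F) = eulerDerivation ℂ ℂ p (serEval x F) := by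
  ext d
  simp only [serEval, MvPowerSeries.coeff_map, coeff_eulerDerivation, map_nsmul]

theorem serEval_smul (x : Fin (N + 1) → ℂ) (c : ℂ) (F : Ser N) :
    serEval x (c • F) = c • serEval x F := by
  ext d
  exact coefEval_smul x c _

theorem serEval_kernelIdentity {x : Fin (N + 1) → ℂ} (hx : Function.Injective x) {s : ℕ}
    (hs : s < N) :
    ∑ i ∈ level N (s + 1), signedSum s (fun l k => serEval x (invSer i (s + 1) l k)) ^ 2 -
        ∑ i ∈ level N s, signedSum s (fun l k => serEval x (invSer i s l k)) ^ 2 +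
        2 * ∑ i ∈ level N s, signedSum s (fun l k => serEval x (invSer i (s + 1) l k) *
          serEval x (invSer i s l k)) =
      ∑ i ∈ level N (s + 1), ∑ l ∈ level N (s + 1), serEval x (invSer i (s + 1) l (s + 1)) ^ 2 -
        ∑ i ∈ level N s, ∑ l ∈ level N s, serEval x (invSer i s l s) ^ 2 := by
  have : CharZero (MvPowerSeries (Fin (N + 1) × ℕ) ℂ) :=
    charZero_of_injective_algebraMap (FaithfulSMul.algebraMap_injective ℂ _)
  have : IsDomain (MvPowerSeries (Fin (N + 1) × ℕ) ℂ) := NoZeroDivisors.to_isDomain _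
  refine kernel_identity_truncated (w := fun i j l k => serEval x (invSer i j l k))
    (t := fun i j => MvPowerSeries.C (x i) + serEval x (ell i j)) ?_ ?_ ?_
  · intro i j l k hil
    have hne : x i - x l ≠ 0 := sub_ne_zero.mpr fun h => hil (hx h)
    have h1 : serEval x (↑(ratioUnit i j l k)⁻¹ : Ser N) * serEval x (ratioSer i j l k) = 1 := by
      rw [← map_mul]
      exact (congrArg (serEval x) (ratioUnit i j l k).inv_mul).trans (map_one _)
    have h2 : serEval x (MvPowerSeries.C (invDiff i l)) = MvPowerSeries.C (x i - x l)⁻¹ := by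
      rw [serEval, MvPowerSeries.map_C, coefEval_invDiff]
    have h3 : (MvPowerSeries.C (x i - x l)⁻¹ : MvPowerSeries (Fin (N + 1) × ℕ) ℂ) *
        (MvPowerSeries.C (x i) - MvPowerSeries.C (x l)) = 1 := by
      rw [← map_sub, ← map_mul, inv_mul_cancel₀ hne, map_one]
    rw [serEval_ratioSer] at h1
    rw [invSer, map_mul, h2]
    linear_combination h1 + serEval x (↑(ratioUnit i j l k)⁻¹ : Ser N) * h3
  · intro i j k
    simp only [invSer_self, map_zero]
  · intro i _ h
    have h1 := add_left_cancel h
    rw [ell_eq_add hs, map_add] at h1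
    have h2 : serEval x (MvPowerSeries.X (i, s)) = 0 := by linear_combination -h1
    rw [serEval, MvPowerSeries.map_X] at h2
    have h3 := congrArg (MvPowerSeries.coeff (Finsupp.single (i, s) 1)) h2
    simp [MvPowerSeries.coeff_X] at h3

theorem serEval_schrodinger_kernelSer (ν : ℤ) {x : Fin (N + 1) → ℂ} (hx : Function.Injective x) :
    ∑ a, serEval x (serDeriv a (serDeriv a (kernelSer N ν))) -
        ((ν : ℂ) * (ν + 1) * ∑ a, ∑ l, (x a - x l)⁻¹ ^ 2) • serEval x (kernelSer N ν) =
      -((2 * ν : ℂ) • ∑ p ∈ tri N, (((ν : ℂ) + 1) • serEval x (kernelSer N ν * fluxSer p) +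
        eulerDerivation ℂ ℂ p (serEval x (kernelSer N ν * fluxSer p)))) := by
  have main := sum_driftSum_sq (w := fun i j l k => serEval x (invSer i j l k))
    (fun i j l k => by rw [invSer_antisymm, map_neg]) (fun i j k => by rw [invSer_self, map_zero])
    (fun s hs => serEval_kernelIdentity hx hs) (ν : MvPowerSeries (Fin (N + 1) × ℕ) ℂ) le_rfl
  have m1 : ∀ (s : ℕ) (f : Fin (N + 1) → ℕ → Ser N),
      serEval x (signedSum s f) = signedSum s fun l k => serEval x (f l k) := by
    intro s f
    simp only [signedSum, map_sub, map_sum]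
  have m2 : ∀ j a, serEval x (driftSum invSer j a) =
      driftSum (fun i j l k => serEval x (invSer i j l k)) j a := by
    intro j a
    simp only [driftSum, map_sum, map_sub, apply_ite (serEval x), map_zero, m1]
  have m3 : ∀ j a, serEval x (driftSqSum invSer j a) =
      driftSqSum (fun i j l k => serEval x (invSer i j l k)) j a := by
    intro j a
    simp only [driftSqSum, map_sum, map_sub, apply_ite (serEval x), map_zero, m1, map_pow]
  have e1 : ∀ a, serEval x (serDeriv a (serDeriv a (kernelSer N ν))) =
      serEval x (kernelSer N ν) * ((ν : MvPowerSeries (Fin (N + 1) × ℕ) ℂ) ^ 2 *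
        driftSum (fun i j l k => serEval x (invSer i j l k)) N a ^ 2 +
        ν * driftSqSum (fun i j l k => serEval x (invSer i j l k)) N a) := by
    intro a
    rw [serDeriv_serDeriv_kernelSer, map_mul, map_add, map_mul, map_mul, map_pow, map_pow,
      map_intCast, m2, m3]
  have e2 : ∀ p ∈ tri N, ((ν : ℂ) + 1) • serEval x (kernelSer N ν * fluxSer p) +
        eulerDerivation ℂ ℂ p (serEval x (kernelSer N ν * fluxSer p)) =
      serEval x (kernelSer N ν) *
        (ν * signedSum p.2 (fun l k => serEval x (invSer p.1 (p.2 + 1) l k) *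
            serEval x (invSer p.1 p.2 l k)) +
          signedSum p.2 (fun l k => serEval x (invSer p.1 p.2 l k) ^ 2) -
          ν * (signedSum p.2 (fun l k => serEval x (invSer p.1 p.2 l k)) -
            signedSum p.2 (fun l k => serEval x (invSer p.1 (p.2 + 1) l k))) *
          (driftSum (fun i j l k => serEval x (invSer i j l k)) p.2 p.1 +
            signedSum p.2 (fun l k => serEval x (invSer p.1 p.2 l k)))) := by
    rintro ⟨i, s⟩ hp
    rw [mem_tri] at hp
    have f1 := fluxSer_add_serEuler (p := (i, s)) hp.1
    have f2 := signedSum_sub_eq i hp.1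
    rw [← serEval_eulerDerivation, ← serEval_smul, ← map_add, Derivation.leibniz,
      serEuler_kernelSer ν hp.2 hp.1]
    have f3 : ((ν : ℂ) + 1) • (kernelSer N ν * fluxSer (i, s)) +
        (kernelSer N ν • serEuler (i, s) (fluxSer (i, s)) + fluxSer (i, s) • (kernelSer N ν *
          ((ν : Ser N) * (MvPowerSeries.X (i, s) *
            (driftSum invSer s i + signedSum s (invSer i s)))))) =
        kernelSer N ν * ((ν : Ser N) * fluxSer (i, s) +
          signedSum s (fun l k => invSer i s l k ^ 2) -
          (ν : Ser N) * (signedSum s (invSer i s) - signedSum s (invSer i (s + 1))) *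
            (driftSum invSer s i + signedSum s (invSer i s))) := by
      rw [Algebra.smul_def, map_add, map_one, map_intCast, smul_eq_mul, smul_eq_mul]
      simp only at f1
      linear_combination kernelSer N ν * f1 - kernelSer N ν * (ν : Ser N) *
            (driftSum invSer s i + signedSum s (invSer i s)) * f2
    rw [f3]
    simp only [map_mul, map_sub, map_add, map_intCast, m1, m2, fluxSer, map_pow]
  rw [Finset.sum_congr rfl fun a _ => e1 a, Finset.sum_congr rfl e2, sum_tri, ← Finset.mul_sum,
    Algebra.smul_def, Algebra.smul_def]
  simp only [← Finset.mul_sum]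
  have e3 : algebraMap ℂ (MvPowerSeries (Fin (N + 1) × ℕ) ℂ)
      ((ν : ℂ) * (ν + 1) * ∑ a, ∑ l, (x a - x l)⁻¹ ^ 2) =
      ν * (ν + 1) * ∑ i ∈ level N N, ∑ l ∈ level N N, serEval x (invSer i N l N) ^ 2 := by
    have h2 : ∀ i l, serEval x (invSer i N l N) =
        algebraMap ℂ (MvPowerSeries (Fin (N + 1) × ℕ) ℂ) (x i - x l)⁻¹ := by
      intro i l
      rw [invSer_top, serEval, MvPowerSeries.map_C, coefEval_invDiff]
      rfl
    simp only [map_mul, map_add, map_one, map_intCast, map_sum, map_pow, h2, level_self]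
  rw [e3, map_mul, map_ofNat, map_intCast]
  rw [level_self] at main ⊢
  rw [mul_comm _ (serEval x (kernelSer N ν)), ← mul_sub, main]
  have e4 : ∀ a b c : MvPowerSeries (Fin (N + 1) × ℕ) ℂ,
      2 * ν * c = -b → a * b = -(2 * ν * (a * c)) := by
    intro a b c h
    linear_combination a * h
  apply e4
  rw [mul_assoc, ← mul_neg]
  congr 1
  rw [Finset.mul_sum, ← Finset.sum_neg_distrib]
  refine Finset.sum_congr rfl fun s _ => ?_
  rw [Finset.mul_sum, ← Finset.sum_neg_distrib]
  refine Finset.sum_congr rfl fun i _ => ?_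
  ring

/-- The recursion satisfied by the homogeneous components. -/
theorem baCoef_recursion (ν : ℤ) {x lam : Fin (N + 1) → ℂ} (hx : Function.Injective x)
    (hlam : Function.Injective lam) (k : ℕ) :
    ∑ a, coefEval x (coefDeriv a (coefDeriv a (baCoef ν lam k))) -
        ((ν : ℂ) * (ν + 1) * ∑ a, ∑ l, (x a - x l)⁻¹ ^ 2) * coefEval x (baCoef ν lam k) +
        2 * ∑ a, lam a * coefEval x (coefDeriv a (baCoef ν lam (k + 1))) = 0 := by
  have hm : ∀ (j : ℕ) (F : Ser N), coefEval x (laplaceCoeff (tri N) ν (mu lam) j F) =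
      laplaceCoeff (tri N) ν (mu lam) j (serEval x F) := fun j F =>
    map_laplaceCoeff (coefEval x) (coefEval_smul x) _ _ _ _ _
  have h1 : ∀ a, coefEval x (coefDeriv a (coefDeriv a (baCoef ν lam k))) =
      laplaceCoeff (tri N) ν (mu lam) k (serEval x (serDeriv a (serDeriv a (kernelSer N ν)))) := by
    intro a
    rw [baCoef, derivation_laplaceCoeff, derivation_laplaceCoeff, hm]
  have h2 : ∑ a, lam a * coefEval x (coefDeriv a (baCoef ν lam (k + 1))) =
      laplaceCoeff (tri N) ν (mu lam) (k + 1)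
        (serEval x (∑ a, lam a • serDeriv a (kernelSer N ν))) := by
    rw [map_sum, map_sum]
    refine Finset.sum_congr rfl fun a _ => ?_
    rw [serEval_smul, map_smul, smul_eq_mul, baCoef, derivation_laplaceCoeff, hm]
  have h3 := congrArg (laplaceCoeff (tri N) (ν : ℂ) (mu lam) k)
    (serEval_schrodinger_kernelSer ν hx)
  rw [map_sub, map_sum, map_smul, map_neg, map_smul, map_sum,
    Finset.sum_congr rfl fun p hp => laplaceCoeff_shift (ν : ℂ) hp (mu_ne_zero hlam hp) k _] at h3
  rw [Finset.sum_congr rfl fun a _ => h1 a, h2, sum_smul_serDeriv_kernelSer, map_neg, map_neg,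
    serEval_smul, map_smul, map_sum, map_sum]
  have h4 : ∀ p, laplaceCoeff (tri N) (ν : ℂ) (mu lam) (k + 1)
      (serEval x (mu lam p • (MvPowerSeries.X p * (kernelSer N ν * fluxSer p)))) =
      mu lam p • laplaceCoeff (tri N) (ν : ℂ) (mu lam) (k + 1)
        (MvPowerSeries.X p * serEval x (kernelSer N ν * fluxSer p)) := by
    intro p
    rw [serEval_smul, map_smul, map_mul]
    congr 3
    rw [serEval, MvPowerSeries.map_X]
  rw [Finset.sum_congr rfl fun p _ => h4 p]
  rw [baCoef, hm]
  simp only [smul_eq_mul, Finset.sum_neg_distrib] at h3 ⊢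
  linear_combination h3

end Recursion

section Homogeneity

variable {N : ℕ}

theorem serEval_smul_point {c : ℂ} (x : Fin (N + 1) → ℂ) (ν : ℤ) :
    serEval (c • x) (kernelSer N ν) =
      MvPowerSeries.rescale (fun _ => c⁻¹) (serEval x (kernelSer N ν)) := by
  refine map_kernelSer_congr (serEval (c • x)) ((MvPowerSeries.rescale fun _ => c⁻¹).comp
    (serEval x)) (fun i j l k => ?_) ν
  have hX : ∀ p : Fin (N + 1) × ℕ, MvPowerSeries.rescale (fun _ => c⁻¹)
      (MvPowerSeries.X p : MvPowerSeries _ ℂ) = MvPowerSeries.C c⁻¹ * MvPowerSeries.X p := by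
    intro p
    ext d
    rw [MvPowerSeries.coeff_rescale, MvPowerSeries.coeff_C_mul, MvPowerSeries.coeff_X]
    split_ifs with h
    · subst h; simp
    · simp
  have hC : ∀ a : ℂ, MvPowerSeries.rescale (fun _ : Fin (N + 1) × ℕ => c⁻¹)
      (MvPowerSeries.C a) = MvPowerSeries.C a := by
    intro a
    ext d
    rw [MvPowerSeries.coeff_rescale, MvPowerSeries.coeff_C]
    split_ifs with h
    · subst h; simp
    · simp
  have hl : ∀ i j, MvPowerSeries.rescale (fun _ => c⁻¹) (serEval x (ell i j)) =
      MvPowerSeries.C c⁻¹ * serEval (c • x) (ell i j) := by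
    intro i j
    simp only [serEval_ell, map_sum, hX, Finset.mul_sum]
  rw [RingHom.comp_apply, serEval_ratioSer, serEval_ratioSer, map_add, map_one, map_mul, map_sub,
    hl, hl, hC, ← mul_sub, ← mul_assoc, ← map_mul]
  congr 4
  simp only [Pi.smul_apply, smul_eq_mul]
  rw [← mul_sub, mul_inv, mul_comm]

theorem finsuppAntidiag_prod_const {σ : Type*} [DecidableEq σ] {T : Finset σ} {k : ℕ} {d : σ →₀ ℕ}
    (hd : d ∈ T.finsuppAntidiag k) (c : ℂ) : (d.prod fun _ n => c ^ n) = c ^ k := by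
  rw [Finset.mem_finsuppAntidiag] at hd
  rw [Finsupp.prod_of_support_subset d hd.2 _ (fun _ _ => pow_zero _), Finset.prod_pow_eq_pow_sum,
    hd.1]

theorem coefEval_baCoef (ν : ℤ) (lam x : Fin (N + 1) → ℂ) (k : ℕ) :
    coefEval x (baCoef ν lam k) = laplaceCoeff (tri N) ν (mu lam) k (serEval x (kernelSer N ν)) :=
  map_laplaceCoeff (coefEval x) (coefEval_smul x) _ _ _ _ _

theorem coefEval_smul_baCoef (ν : ℤ) (lam : Fin (N + 1) → ℂ) (k : ℕ) (x : Fin (N + 1) → ℂ)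
    (c : ℂ) : coefEval (c • x) (baCoef ν lam k) = c⁻¹ ^ k * coefEval x (baCoef ν lam k) := by
  rw [coefEval_baCoef, coefEval_baCoef, serEval_smul_point, laplaceCoeff_apply, laplaceCoeff_apply,
    Finset.mul_sum]
  refine Finset.sum_congr rfl fun d hd => ?_
  rw [MvPowerSeries.coeff_rescale, finsuppAntidiag_prod_const hd, smul_eq_mul, smul_eq_mul]
  ring

/-- Homogeneity of degree `-k` on the points with distinct coordinates. -/
def IsHomog (k : ℕ) (F : Coef N) : Prop :=
  ∀ x : Fin (N + 1) → ℂ, Function.Injective x → ∀ c : ℂ, c ≠ 0 →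
    coefEval (c • x) F = c⁻¹ ^ k * coefEval x F

theorem isHomog_baCoef (ν : ℤ) (lam : Fin (N + 1) → ℂ) (k : ℕ) : IsHomog k (baCoef ν lam k) :=
  fun x _ c _ => coefEval_smul_baCoef ν lam k x c

theorem laplaceWeight_smul {σ : Type*} [DecidableEq σ] {T : Finset σ} (ν : ℂ) (μ : σ → ℂ) (c : ℂ)
    {k : ℕ} {d : σ →₀ ℕ} (hd : d ∈ T.finsuppAntidiag k) :
    laplaceWeight T ν (fun p => c * μ p) d = c⁻¹ ^ k * laplaceWeight T ν μ d := by
  rw [Finset.mem_finsuppAntidiag] at hd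
  rw [laplaceWeight, laplaceWeight, ← hd.1, ← Finset.prod_pow_eq_pow_sum, ← Finset.prod_mul_distrib]
  refine Finset.prod_congr rfl fun p _ => ?_
  rw [neg_mul_eq_mul_neg, mul_inv, mul_pow]
  ring

theorem coefEval_baCoef_smul (ν : ℤ) (lam : Fin (N + 1) → ℂ) (k : ℕ) (x : Fin (N + 1) → ℂ)
    (c : ℂ) : coefEval x (baCoef ν (c • lam) k) = c⁻¹ ^ k * coefEval x (baCoef ν lam k) := by
  rw [coefEval_baCoef, coefEval_baCoef, laplaceCoeff_apply, laplaceCoeff_apply, Finset.mul_sum]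
  refine Finset.sum_congr rfl fun d hd => ?_
  have : mu (c • lam) = fun p => c * mu lam p := by
    ext p
    simp only [mu, Pi.smul_apply, smul_eq_mul, mul_sub]
  rw [this, laplaceWeight_smul _ _ _ hd, smul_eq_mul, smul_eq_mul, mul_assoc]

theorem laplaceWeight_eq_zero {σ : Type*} [DecidableEq σ] {T : Finset σ} (μ : σ → ℂ) {m : ℕ}
    {d : σ →₀ ℕ} {p : σ} (hp : p ∈ T) (hd : m < d p) :
    laplaceWeight T ((-(m : ℤ) - 1 : ℤ) : ℂ) μ d = 0 := by
  refine Finset.prod_eq_zero hp (mul_eq_zero_of_left (Finset.prod_eq_zero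
    (Finset.mem_range.mpr hd) ?_) _)
  push_cast
  ring

theorem baCoef_eq_zero (lam : Fin (N + 1) → ℂ) {m k : ℕ} (hk : m * (tri N).card < k) :
    baCoef (-(m : ℤ) - 1) lam k = 0 := by
  rw [baCoef, laplaceCoeff_apply]
  refine Finset.sum_eq_zero fun d hd => ?_
  rw [Finset.mem_finsuppAntidiag] at hd
  have : ∃ p ∈ tri N, m < d p := by
    by_contra! h
    have := Finset.sum_le_card_nsmul (tri N) d m h
    rw [hd.1, smul_eq_mul, mul_comm] at this
    omega
  obtain ⟨p, hp, hm⟩ := this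
  rw [laplaceWeight_eq_zero _ hp hm, zero_smul]

end Homogeneity

section Uniqueness

variable {N : ℕ}

/-- The sum of the second partial derivatives. -/
def coefLaplacian (x : Fin (N + 1) → ℂ) (F : Coef N) : ℂ :=
  ∑ a, coefEval x (coefDeriv a (coefDeriv a F))

/-- The derivative in the direction `lam`. -/
def coefDirDeriv (lam x : Fin (N + 1) → ℂ) (F : Coef N) : ℂ :=
  ∑ a, lam a * coefEval x (coefDeriv a F)

/-- The sum of the squared inverse differences. -/
def invSqSum (x : Fin (N + 1) → ℂ) : ℂ := ∑ a, ∑ l, (x a - x l)⁻¹ ^ 2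

/-- The recursion for the homogeneous components of an eigenfunction. -/
def SatisfiesRecursion (κ : ℂ) (lam : Fin (N + 1) → ℂ) (F : ℕ → Coef N) : Prop :=
  ∀ x : Fin (N + 1) → ℂ, Function.Injective x → ∀ k,
    coefLaplacian x (F k) - κ * invSqSum x * coefEval x (F k) +
      2 * coefDirDeriv lam x (F (k + 1)) = 0

theorem satisfiesRecursion_baCoef (ν : ℤ) {lam : Fin (N + 1) → ℂ}
    (hlam : Function.Injective lam) :
    SatisfiesRecursion ((ν : ℂ) * (ν + 1)) lam (baCoef ν lam) :=
  fun _ hx k => baCoef_recursion ν hx hlam k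

/-- Points the coordinates of which have distinct imaginary parts. -/
def ImInjective (x : Fin (N + 1) → ℂ) : Prop := Function.Injective fun i => (x i).im

theorem ImInjective.injective {x : Fin (N + 1) → ℂ} (hx : ImInjective x) :
    Function.Injective x := fun _ _ h => hx (congrArg Complex.im h)

theorem isOpen_imInjective : IsOpen {x : Fin (N + 1) → ℂ | ImInjective x} := by
  have h : Continuous fun x : Fin (N + 1) → ℂ => fun i => (((x i).im : ℝ) : ℂ) := by fun_prop
  have : {x : Fin (N + 1) → ℂ | ImInjective x} =
      (fun x : Fin (N + 1) → ℂ => fun i => (((x i).im : ℝ) : ℂ)) ⁻¹'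
        {x | Function.Injective x} := by
    ext x
    simp only [Set.mem_ofPred_eq, Set.mem_preimage, ImInjective, Function.Injective,
      Complex.ofReal_inj]
  rw [this]
  exact isOpen_injective.preimage h

theorem coefEval_coefDeriv_eq_zero {F : Coef N} (hF : ∀ x, ImInjective x → coefEval x F = 0)
    (a : Fin (N + 1)) {x : Fin (N + 1) → ℂ} (hx : ImInjective x) :
    coefEval x (coefDeriv a F) = 0 := by
  have h1 := hasDerivAt_coefEval hx.injective a F
  have h2 : ∀ᶠ s in nhds (x a), ImInjective (Function.update x a s) := by
    have hc : ContinuousAt (fun s => Function.update x a s) (x a) :=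
      (continuous_const.update a continuous_id).continuousAt
    refine hc.eventually (isOpen_imInjective.mem_nhds ?_)
    change ImInjective (Function.update x a (x a))
    rwa [Function.update_eq_self]
  have h3 : (fun s => coefEval (Function.update x a s) F) =ᶠ[nhds (x a)] fun _ => 0 :=
    h2.mono fun s hs => hF _ hs
  exact h1.unique ((hasDerivAt_const (x a) (0 : ℂ)).congr_of_eventuallyEq h3)

theorem imInjective_add_smul {x : Fin (N + 1) → ℂ} (hx : ImInjective x) (r : Fin (N + 1) → ℝ)
    (t : ℝ) : ImInjective (fun i => x i + (t : ℂ) * (r i : ℂ)) := by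
  intro i j h
  apply hx
  simpa using h

/-- A function homogeneous of negative degree which is constant in the direction of an injective
real vector vanishes. -/
theorem coefEval_eq_zero_of_coefDirDeriv {r : Fin (N + 1) → ℝ} (hr : Function.Injective r)
    {F : Coef N} {k : ℕ} (hk : k ≠ 0)
    (hhom : IsHomog k F)
    (hF : ∀ x, ImInjective x → coefDirDeriv (fun i => (r i : ℂ)) x F = 0)
    {x : Fin (N + 1) → ℂ} (hx : ImInjective x) : coefEval x F = 0 := by
  have hd : ∀ t : ℝ, HasDerivAt (fun t : ℝ => coefEval (fun i => x i + (t : ℂ) * (r i : ℂ)) F)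
      0 t := by
    intro t
    have h1 := hasDerivAt_coefEval_comp (γ := fun s i => x i + s * (r i : ℂ))
      (v := fun i => (r i : ℂ)) (t := (t : ℂ)) (fun i => by
        simpa using ((hasDerivAt_id' (t : ℂ)).mul_const (r i : ℂ)).const_add (x i))
      (imInjective_add_smul hx r t).injective F
    exact (h1.congr_deriv (hF _ (imInjective_add_smul hx r t))).comp_ofReal
  have hconst : ∀ t : ℝ, coefEval (fun i => x i + (t : ℂ) * (r i : ℂ)) F = coefEval x F := by
    intro t
    refine (is_const_of_deriv_eq_zero (fun t => (hd t).differentiableAt) (fun t => (hd t).deriv)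
      t 0).trans ?_
    simp
  have hr' : Function.Injective fun i => (r i : ℂ) := Complex.ofReal_injective.comp hr
  have h1 : Filter.Tendsto (fun t : ℝ => ((t : ℂ)⁻¹)) Filter.atTop (nhds 0) := by
    have := (Complex.continuous_ofReal.tendsto 0).comp tendsto_inv_atTop_zero
    simpa [Function.comp_def] using this
  have h2 : Filter.Tendsto (fun t : ℝ => fun i => (t : ℂ)⁻¹ * x i + (r i : ℂ)) Filter.atTop
      (nhds fun i => (r i : ℂ)) := by
    rw [tendsto_pi_nhds]
    intro i
    simpa using (h1.mul_const (x i)).add_const (r i : ℂ)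
  have h3 := (h1.pow k).mul ((continuousAt_coefEval hr' F).tendsto.comp h2)
  rw [zero_pow hk, zero_mul] at h3
  refine tendsto_nhds_unique (tendsto_const_nhds.congr' ?_) h3
  filter_upwards [Filter.eventually_gt_atTop 0] with t ht
  have ht' : (t : ℂ) ≠ 0 := by exact_mod_cast ht.ne'
  have hp : (fun i => x i + (t : ℂ) * (r i : ℂ)) =
      (t : ℂ) • fun i => (t : ℂ)⁻¹ * x i + (r i : ℂ) := by
    ext i
    rw [Pi.smul_apply, smul_eq_mul, mul_add, mul_inv_cancel_left₀ ht']
  have h4 := hconst t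
  have hinj : Function.Injective fun i => (t : ℂ)⁻¹ * x i + (r i : ℂ) := by
    intro i j hij
    exact (imInjective_add_smul hx r t).injective ((congrFun hp i).trans
      ((congrArg ((t : ℂ) * ·) hij).trans (congrFun hp j).symm))
  rw [hp, hhom _ hinj _ ht'] at h4
  exact h4.symm

/-- The recursion and homogeneity determine the components up to the first one. -/
theorem SatisfiesRecursion.eq {κ : ℂ} {r : Fin (N + 1) → ℝ} (hr : Function.Injective r)
    {F G : ℕ → Coef N} (hF : SatisfiesRecursion κ (fun i => (r i : ℂ)) F)
    (hG : SatisfiesRecursion κ (fun i => (r i : ℂ)) G)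
    (homF : ∀ k, IsHomog k (F k)) (homG : ∀ k, IsHomog k (G k))
    (h0 : ∀ x, ImInjective x → coefEval x (F 0) = coefEval x (G 0)) (k : ℕ) :
    ∀ x, ImInjective x → coefEval x (F k) = coefEval x (G k) := by
  have key : ∀ x, ImInjective x → coefEval x (F k - G k) = 0 := by
    induction k with
    | zero => intro x hx; rw [map_sub, h0 x hx, sub_self]
    | succ k ih =>
      intro x hx
      refine coefEval_eq_zero_of_coefDirDeriv hr (Nat.succ_ne_zero k) (fun y hy c hc => ?_) ?_ hx
      · rw [map_sub, map_sub, homF _ y hy c hc, homG _ y hy c hc, mul_sub]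
      · intro y hy
        have h1 := hF y hy.injective k
        have h2 := hG y hy.injective k
        have h3 : coefLaplacian y (F k - G k) = 0 :=
          Finset.sum_eq_zero fun a _ => coefEval_coefDeriv_eq_zero
            (fun z hz => coefEval_coefDeriv_eq_zero ih a hz) a hy
        have h4 := ih y hy
        simp only [coefLaplacian, coefDirDeriv, map_sub, mul_sub, Finset.sum_sub_distrib]
          at h1 h2 h3 h4 ⊢
        linear_combination (1 / 2) * h1 - (1 / 2) * h2 - (1 / 2) * h3 +
          (1 / 2) * κ * invSqSum y * h4
  intro x hx
  have := key x hx
  rwa [map_sub, sub_eq_zero] at this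

/-- The components with exponents `m` and `-m-1` agree. -/
theorem coefEval_baCoef_eq (m : ℕ) {r : Fin (N + 1) → ℝ} (hr : Function.Injective r) (k : ℕ)
    {x : Fin (N + 1) → ℂ} (hx : ImInjective x) :
    coefEval x (baCoef m (fun i => (r i : ℂ)) k) =
      coefEval x (baCoef (-(m : ℤ) - 1) (fun i => (r i : ℂ)) k) := by
  have hr' : Function.Injective fun i => (r i : ℂ) := Complex.ofReal_injective.comp hr
  have h2 := satisfiesRecursion_baCoef (-(m : ℤ) - 1) hr'
  have e : ((-(m : ℤ) - 1 : ℤ) : ℂ) * (((-(m : ℤ) - 1 : ℤ) : ℂ) + 1) =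
      ((m : ℤ) : ℂ) * (((m : ℤ) : ℂ) + 1) := by
    push_cast
    ring
  rw [e] at h2
  exact (satisfiesRecursion_baCoef m hr').eq hr h2 (isHomog_baCoef _ _)
    (isHomog_baCoef _ _) (fun y _ => by simp only [baCoef_zero]) k x hx

end Uniqueness

section WaveFunctions

variable {N : ℕ}

/-- The function `F(y) exp (lam, y)`. -/
def wave (lam : Fin (N + 1) → ℂ) (F : Coef N) (y : Fin (N + 1) → ℂ) : ℂ :=
  coefEval y F * Complex.exp (∑ i, lam i * y i)

theorem hasDerivAt_wave (lam : Fin (N + 1) → ℂ) (F : Coef N) {x : Fin (N + 1) → ℂ}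
    (hx : Function.Injective x) (a : Fin (N + 1)) :
    HasDerivAt (fun s => wave lam F (Function.update x a s))
      (wave lam (coefDeriv a F + MvPolynomial.C (lam a) * F) x) (x a) := by
  have h1 := hasDerivAt_coefEval hx a F
  have h2 : HasDerivAt (fun s => ∑ i, lam i * Function.update x a s i) (lam a) (x a) := by
    have h3 : ∀ i ∈ Finset.univ, HasDerivAt (fun s => lam i * Function.update x a s i)
        (if i = a then lam a else 0) (x a) := by
      intro i _
      by_cases h : i = a
      · subst h; simpa using (hasDerivAt_id' (x i)).const_mul (lam i)
      · simpa [h] using hasDerivAt_const (x a) (lam i * x i)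
    simpa using HasDerivAt.fun_sum h3
  refine (h1.fun_mul h2.cexp).congr_deriv ?_
  simp only [Function.update_eq_self, wave, map_add, map_mul, coefEval_C]
  ring

theorem eventually_injective_update {x : Fin (N + 1) → ℂ} (hx : Function.Injective x)
    (a : Fin (N + 1)) : ∀ᶠ s in nhds (x a), Function.Injective (Function.update x a s) := by
  have hc : ContinuousAt (fun s => Function.update x a s) (x a) :=
    (continuous_const.update a continuous_id).continuousAt
  refine hc.eventually (isOpen_injective.mem_nhds ?_)
  change Function.Injective (Function.update x a (x a))
  rwa [Function.update_eq_self]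

theorem iteratedDeriv_wave (lam : Fin (N + 1) → ℂ) (F : Coef N) {x : Fin (N + 1) → ℂ}
    (hx : Function.Injective x) (a : Fin (N + 1)) :
    iteratedDeriv 2 (fun s => wave lam F (Function.update x a s)) (x a) =
      (coefEval x (coefDeriv a (coefDeriv a F)) + 2 * (lam a * coefEval x (coefDeriv a F)) +
        lam a ^ 2 * coefEval x F) * Complex.exp (∑ i, lam i * x i) := by
  have h1 : deriv (fun s => wave lam F (Function.update x a s)) =ᶠ[nhds (x a)]
      fun s => wave lam (coefDeriv a F + MvPolynomial.C (lam a) * F) (Function.update x a s) := by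
    filter_upwards [eventually_injective_update hx a] with s hs
    simpa using (hasDerivAt_wave lam F hs a).deriv
  rw [iteratedDeriv_succ, iteratedDeriv_one, h1.deriv_eq, (hasDerivAt_wave lam _ hx a).deriv, wave]
  simp only [map_add, Derivation.leibniz, smul_eq_mul, map_mul, coefEval_C]
  rw [← MvPolynomial.algebraMap_eq, Derivation.map_algebraMap, map_zero]
  ring

theorem sum_sum_Ioi_inv_sq (x : Fin (N + 1) → ℂ) (κ : ℂ) :
    ∑ i : Fin (N + 1), ∑ j ∈ Finset.Ioi i, 2 * κ / (x i - x j) ^ 2 = κ * invSqSum x := by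
  have h := Finset.sum_sum_Ioi_add_eq_sum_sum_off_diag
    fun i j : Fin (N + 1) => κ * (x j - x i)⁻¹ ^ 2
  have h1 : ∀ i, ∑ j ∈ ({i} : Finset (Fin (N + 1)))ᶜ, κ * (x i - x j)⁻¹ ^ 2 =
      κ * ∑ j, (x i - x j)⁻¹ ^ 2 := by
    intro i
    rw [Finset.mul_sum, ← Finset.sum_compl_add_sum {i}]
    simp
  rw [Finset.sum_congr rfl fun i _ => h1 i, ← Finset.mul_sum] at h
  rw [invSqSum, ← h]
  refine Finset.sum_congr rfl fun i _ => Finset.sum_congr rfl fun j _ => ?_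
  have e : (x j - x i)⁻¹ ^ 2 = (x i - x j)⁻¹ ^ 2 := by
    rw [← neg_sub (x i) (x j), inv_neg, neg_sq]
  rw [e, inv_pow, div_eq_mul_inv]
  ring

theorem calogeroMoser_wave (m : ℕ) (lam : Fin (N + 1) → ℂ) (F : Coef N) {x : Fin (N + 1) → ℂ}
    (hx : Function.Injective x) :
    calogeroMoser m (wave lam F) x + (∑ i, lam i ^ 2) * wave lam F x =
      -((coefLaplacian x F - (m * (m + 1)) * invSqSum x * coefEval x F +
        2 * coefDirDeriv lam x F) * Complex.exp (∑ i, lam i * x i)) := by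
  rw [calogeroMoser, Finset.sum_congr rfl fun a _ => iteratedDeriv_wave lam F hx a,
    ← Finset.sum_mul, wave, coefLaplacian, coefDirDeriv, Finset.sum_add_distrib,
    Finset.sum_add_distrib, ← Finset.mul_sum, ← Finset.sum_mul]
  have := sum_sum_Ioi_inv_sq x (m * (m + 1))
  simp only [← mul_assoc] at this
  rw [this]
  ring

theorem schrodinger_wave_iff (m : ℕ) (lam : Fin (N + 1) → ℂ) (F : Coef N) {x : Fin (N + 1) → ℂ}
    (hx : Function.Injective x) :
    calogeroMoser m (wave lam F) x = -(∑ i, lam i ^ 2) * wave lam F x ↔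
      coefLaplacian x F - (m * (m + 1)) * invSqSum x * coefEval x F +
        2 * coefDirDeriv lam x F = 0 := by
  have h := calogeroMoser_wave m lam F hx
  rw [neg_mul, eq_neg_iff_add_eq_zero, h, neg_eq_zero, mul_eq_zero,
    or_iff_left (Complex.exp_ne_zero _)]

end WaveFunctions

section WeightedScaling

theorem MvPolynomial.IsWeightedHomogeneous.eval_pow_mul {σ : Type*} {w : σ → ℕ}
    {φ : MvPolynomial σ ℂ} {j : ℕ} (h : φ.IsWeightedHomogeneous w j) (c : ℂ) (v : σ → ℂ) :
    MvPolynomial.eval (fun i => c ^ w i * v i) φ = c ^ j * MvPolynomial.eval v φ := by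
  rw [MvPolynomial.eval_eq, MvPolynomial.eval_eq, Finset.mul_sum]
  refine Finset.sum_congr rfl fun d hd => ?_
  rw [← h (MvPolynomial.mem_support_iff.mp hd), Finsupp.weight_apply, Finsupp.sum,
    ← Finset.prod_pow_eq_pow_sum]
  simp only [mul_pow, Finset.prod_mul_distrib, smul_eq_mul]
  have : ∀ i, (c ^ w i) ^ d i = c ^ (d i * w i) := fun i => by rw [← pow_mul, mul_comm]
  simp only [this]
  ring

theorem eq_sum_weightedHomogeneousComponent {σ : Type*} {w : σ → ℕ} {φ : MvPolynomial σ ℂ} {B : ℕ}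
    (hB : ∀ d ∈ φ.support, Finsupp.weight w d < B) :
    φ = ∑ j ∈ Finset.range B, MvPolynomial.weightedHomogeneousComponent w j φ := by
  classical
  ext d
  rw [MvPolynomial.coeff_sum]
  simp only [MvPolynomial.coeff_weightedHomogeneousComponent, Finset.sum_ite_eq, Finset.mem_range]
  by_cases hd : d ∈ φ.support
  · rw [if_pos (hB d hd)]
  · rw [MvPolynomial.notMem_support_iff.mp hd, ite_self]

theorem MvPolynomial.eval_pow_mul_eq_sum {σ : Type*} {w : σ → ℕ} {φ : MvPolynomial σ ℂ} {B : ℕ}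
    (hB : ∀ d ∈ φ.support, Finsupp.weight w d < B) (c : ℂ) (v : σ → ℂ) :
    MvPolynomial.eval (fun i => c ^ w i * v i) φ = ∑ j ∈ Finset.range B,
      c ^ j * MvPolynomial.eval v (MvPolynomial.weightedHomogeneousComponent w j φ) := by
  conv_lhs => rw [eq_sum_weightedHomogeneousComponent hB]
  rw [map_sum]
  exact Finset.sum_congr rfl fun j _ =>
    (MvPolynomial.weightedHomogeneousComponent_isWeightedHomogeneous j φ).eval_pow_mul c v

/-- A polynomial function which vanishes for nonzero arguments has zero coefficients. -/
theorem eq_zero_of_sum_pow_mul_eq_zero {B : ℕ} {a : ℕ → ℂ}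
    (h : ∀ c : ℂ, c ≠ 0 → ∑ j ∈ Finset.range B, c ^ j * a j = 0) {j : ℕ} (hj : j < B) :
    a j = 0 := by
  have hp : (∑ j ∈ Finset.range B, Polynomial.C (a j) * Polynomial.X ^ j : Polynomial ℂ) = 0 := by
    refine Polynomial.eq_zero_of_infinite_isRoot _
      ((Set.finite_singleton (0 : ℂ)).infinite_compl.mono fun c hc => ?_)
    have := h c hc
    simp only [Set.mem_ofPred_eq, Polynomial.IsRoot, Polynomial.eval_finsetSum,
      Polynomial.eval_mul, Polynomial.eval_C, Polynomial.eval_pow, Polynomial.eval_X]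
    simpa only [mul_comm] using this
  have := congrArg (fun p => Polynomial.coeff p j) hp
  simpa [Polynomial.finsetSum_coeff, Polynomial.coeff_C_mul, Polynomial.coeff_X_pow, hj] using this

end WeightedScaling

section Numerators

variable {N : ℕ}

theorem sum_card_Ioi (N : ℕ) :
    ∑ i : Fin (N + 1), (Finset.Ioi i).card = (N + 1) * N / 2 := by
  simp only [Fin.card_Ioi]
  rw [Fin.sum_univ_eq_sum_range (fun i => N + 1 - 1 - i), Finset.sum_range_reflect (fun i => i),
    Finset.sum_range_id, Nat.add_sub_cancel]

theorem card_tri (N : ℕ) : (tri N).card = (N + 1) * N / 2 := by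
  have h := Finset.sum_range_id (N + 1)
  rw [Nat.add_sub_cancel, Finset.sum_range_succ', Nat.add_zero] at h
  rw [Finset.card_eq_sum_ones, sum_tri, ← h]
  refine Finset.sum_congr rfl fun s hs => ?_
  rw [Finset.mem_range] at hs
  rw [← Finset.card_eq_sum_ones, level]
  have : (Finset.univ.filter fun i : Fin (N + 1) => i.val ≤ s) = Finset.Iic ⟨s, by omega⟩ := by
    ext i
    simp [Fin.le_def]
  rw [this, Fin.card_Iic]

theorem diffProd_ne_zero {x : Fin (N + 1) → ℂ} (hx : Function.Injective x) : diffProd x ≠ 0 :=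
  Finset.prod_ne_zero_iff.mpr fun _ _ => Finset.prod_ne_zero_iff.mpr fun _ hj =>
    sub_ne_zero.mpr fun h => (Finset.mem_Ioi.mp hj).ne (hx h)

theorem diffProd_smul (c : ℂ) (x : Fin (N + 1) → ℂ) :
    diffProd (c • x) = c ^ ((N + 1) * N / 2) * diffProd x := by
  rw [← sum_card_Ioi, ← Finset.prod_pow_eq_pow_sum, diffProd, diffProd, ← Finset.prod_mul_distrib]
  refine Finset.prod_congr rfl fun i _ => ?_
  rw [← Finset.prod_const, ← Finset.prod_mul_distrib]
  exact Finset.prod_congr rfl fun j _ => (mul_sub c (x i) (x j)).symm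

/-- The substitution of numbers for the variables `lam`. -/
def coefLift (lam : Fin (N + 1) → ℂ) :
    MvPolynomial (Fin (N + 1) ⊕ Fin (N + 1)) ℂ →ₐ[ℂ] Coef N :=
  MvPolynomial.aeval (Sum.elim (fun i => MvPolynomial.X (Sum.inl i)) fun i =>
    MvPolynomial.C (lam i))

theorem coefEval_coefLift (x lam : Fin (N + 1) → ℂ)
    (P : MvPolynomial (Fin (N + 1) ⊕ Fin (N + 1)) ℂ) :
    coefEval x (coefLift lam P) = MvPolynomial.eval (Sum.elim x lam) P := by
  induction P using MvPolynomial.induction_on with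
  | C c => rw [← MvPolynomial.algebraMap_eq, AlgHom.commutes, MvPolynomial.algebraMap_eq,
      MvPolynomial.algebraMap_eq, coefEval_C, MvPolynomial.eval_C]
  | add F G hF hG => rw [map_add, map_add, map_add, hF, hG]
  | mul_X F v hF =>
    rw [map_mul, map_mul, map_mul, hF, coefLift, MvPolynomial.aeval_X, MvPolynomial.eval_X]
    rcases v with i | i
    · rw [Sum.elim_inl, Sum.elim_inl, coefEval_X]
    · rw [Sum.elim_inr, Sum.elim_inr, coefEval_C]

/-- The element of `Coef N` which stands for `1 / A(x)`. -/
def invProd (N : ℕ) : Coef N := ∏ i : Fin (N + 1), ∏ j ∈ Finset.Ioi i, invDiff i j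

theorem coefEval_invProd (x : Fin (N + 1) → ℂ) :
    coefEval x (invProd N) = (diffProd x)⁻¹ := by
  simp only [invProd, diffProd, map_prod, coefEval_invDiff, Finset.prod_inv_distrib]

/-- The function `P(x, lam) / (A(x)^m A(lam)^m)`. -/
def baElt (m : ℕ) (lam : Fin (N + 1) → ℂ) :
    MvPolynomial (Fin (N + 1) ⊕ Fin (N + 1)) ℂ →ₗ[ℂ] Coef N :=
  (diffProd lam ^ m)⁻¹ • (LinearMap.mulRight ℂ (invProd N ^ m)) ∘ₗ (coefLift lam).toLinearMap

theorem coefEval_baElt (m : ℕ) (x lam : Fin (N + 1) → ℂ)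
    (P : MvPolynomial (Fin (N + 1) ⊕ Fin (N + 1)) ℂ) :
    coefEval x (baElt m lam P) =
      MvPolynomial.eval (Sum.elim x lam) P / (diffProd x ^ m * diffProd lam ^ m) := by
  have : baElt m lam P = (diffProd lam ^ m)⁻¹ • (coefLift lam P * invProd N ^ m) := rfl
  rw [this, coefEval_smul, map_mul, map_pow, coefEval_coefLift, coefEval_invProd, div_eq_mul_inv,
    mul_inv, inv_pow]
  ring

theorem baFun_eq_wave (m : ℕ) (lam : Fin (N + 1) → ℂ)
    (P : MvPolynomial (Fin (N + 1) ⊕ Fin (N + 1)) ℂ) :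
    (fun y => baFun m P y lam) = wave lam (baElt m lam P) := by
  ext y
  rw [baFun, wave, coefEval_baElt]

/-- The weight which counts the variables `x`. -/
def leftWeight (n : ℕ) : Fin n ⊕ Fin n → ℕ := Sum.elim (fun _ => 1) fun _ => 0

/-- The weight which counts the variables `lam`. -/
def rightWeight (n : ℕ) : Fin n ⊕ Fin n → ℕ := Sum.elim (fun _ => 0) fun _ => 1

theorem weight_leftWeight {n : ℕ} (d : Fin n ⊕ Fin n →₀ ℕ) :
    Finsupp.weight (leftWeight n) d = ∑ i, d (Sum.inl i) := by
  rw [Finsupp.weight_apply, Finsupp.sum_fintype _ _ (by simp), Fintype.sum_sum_type]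
  simp [leftWeight]

theorem weight_rightWeight {n : ℕ} (d : Fin n ⊕ Fin n →₀ ℕ) :
    Finsupp.weight (rightWeight n) d = ∑ i, d (Sum.inr i) := by
  rw [Finsupp.weight_apply, Finsupp.sum_fintype _ _ (by simp), Fintype.sum_sum_type]
  simp [rightWeight]

theorem leftWeight_scaling (c : ℂ) (x lam : Fin (N + 1) → ℂ) :
    (fun v => c ^ leftWeight (N + 1) v * Sum.elim x lam v) = Sum.elim (c • x) lam := by
  ext (i | i) <;> simp [leftWeight]

theorem rightWeight_scaling (c : ℂ) (x lam : Fin (N + 1) → ℂ) :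
    (fun v => c ^ rightWeight (N + 1) v * Sum.elim x lam v) = Sum.elim x (c • lam) := by
  ext (i | i) <;> simp [rightWeight]

theorem isWeightedHomogeneous_diffProd {σ : Type*} (w : σ → ℕ) (g : Fin (N + 1) → σ) {e : ℕ}
    (he : ∀ i, w (g i) = e) :
    (diffProd fun i => (MvPolynomial.X (g i) : MvPolynomial σ ℂ)).IsWeightedHomogeneous w
      (((N + 1) * N / 2) * e) := by
  rw [← sum_card_Ioi, Finset.sum_mul]
  refine MvPolynomial.IsWeightedHomogeneous.prod _ _ _ fun i _ => ?_
  rw [← smul_eq_mul, ← Finset.sum_const]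
  refine MvPolynomial.IsWeightedHomogeneous.prod _ _ _ fun j _ => ?_
  exact ((he i) ▸ MvPolynomial.isWeightedHomogeneous_X ℂ w (g i)).sub
    ((he j) ▸ MvPolynomial.isWeightedHomogeneous_X ℂ w (g j))

theorem isWeightedHomogeneous_baLeading_left (m : ℕ) :
    (baLeading (N + 1) m).IsWeightedHomogeneous (leftWeight (N + 1)) (m * ((N + 1) * N / 2)) := by
  have h := ((isWeightedHomogeneous_diffProd (leftWeight (N + 1)) (Sum.inl : Fin (N + 1) → _)
    (e := 1) fun _ => rfl).pow m).mul ((isWeightedHomogeneous_diffProd (leftWeight (N + 1))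
      (Sum.inr : Fin (N + 1) → _) (e := 0) fun _ => rfl).pow m)
  simpa [baLeading] using h

theorem eval_baLeading (m : ℕ) (x lam : Fin (N + 1) → ℂ) :
    MvPolynomial.eval (Sum.elim x lam) (baLeading (N + 1) m) =
      diffProd x ^ m * diffProd lam ^ m := by
  simp [baLeading, diffProd]

/-- The homogeneous components of `P(x, lam) / (A(x)^m A(lam)^m)` in `x`. -/
def baComp (m : ℕ) (lam : Fin (N + 1) → ℂ) (P : MvPolynomial (Fin (N + 1) ⊕ Fin (N + 1)) ℂ)
    (k : ℕ) : Coef N :=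
  if k ≤ m * ((N + 1) * N / 2) then baElt m lam (MvPolynomial.weightedHomogeneousComponent
    (leftWeight (N + 1)) (m * ((N + 1) * N / 2) - k) P) else 0

theorem isHomog_baComp (m : ℕ) (lam : Fin (N + 1) → ℂ)
    (P : MvPolynomial (Fin (N + 1) ⊕ Fin (N + 1)) ℂ) (k : ℕ) : IsHomog k (baComp m lam P k) := by
  intro x _ c hc
  rw [baComp]
  split_ifs with h
  · rw [coefEval_baElt, coefEval_baElt, ← leftWeight_scaling,
      (MvPolynomial.weightedHomogeneousComponent_isWeightedHomogeneous _ _).eval_pow_mul,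
      diffProd_smul, mul_pow, ← pow_mul, mul_comm _ m, ← Nat.sub_add_cancel h, pow_add,
      Nat.add_sub_cancel, inv_pow]
    field_simp
  · simp

theorem IsHomog.coefDeriv {k : ℕ} {F : Coef N} (hF : IsHomog k F) (a : Fin (N + 1)) :
    IsHomog (k + 1) (coefDeriv a F) := by
  intro x hx c hc
  have hcx : Function.Injective (c • x) := fun i j h => hx (mul_left_cancel₀ hc h)
  have h1 := hasDerivAt_coefEval_comp (γ := fun s => c • Function.update x a s)
    (v := fun i => if i = a then c else 0) (t := x a) (fun i => by
      by_cases h : i = a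
      · subst h; simpa using (hasDerivAt_id' (x i)).const_mul c
      · simpa [h] using hasDerivAt_const (x a) (c * x i))
    (by rwa [Function.update_eq_self]) F
  have h2 : (fun s => coefEval (c • Function.update x a s) F) =ᶠ[nhds (x a)]
      fun s => c⁻¹ ^ k * coefEval (Function.update x a s) F :=
    (eventually_injective_update hx a).mono fun s hs => hF _ hs c hc
  have h3 := h1.unique (((hasDerivAt_coefEval hx a F).const_mul _).congr_of_eventuallyEq h2)
  simp only [Function.update_eq_self, ite_mul, zero_mul, Finset.sum_ite_eq', Finset.mem_univ,
    if_true] at h3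
  rw [pow_succ, mul_right_comm, ← h3]
  field_simp

end Numerators

section Components

variable {N m : ℕ} {P : MvPolynomial (Fin (N + 1) ⊕ Fin (N + 1)) ℂ}

theorem IsBakerAkhiezer.weight_lt (hP : IsBakerAkhiezer (N + 1) m P)
    {d : Fin (N + 1) ⊕ Fin (N + 1) →₀ ℕ} (hd : d ∈ P.support) :
    Finsupp.weight (leftWeight (N + 1)) d < m * ((N + 1) * N / 2) + 1 := by
  by_cases h : d ∈ (P - baLeading (N + 1) m).support
  · have := hP.leading_left d h
    rw [Nat.add_sub_cancel] at this
    rw [weight_leftWeight]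
    omega
  · rw [MvPolynomial.notMem_support_iff, MvPolynomial.coeff_sub, sub_eq_zero] at h
    rw [MvPolynomial.mem_support_iff, h] at hd
    exact (isWeightedHomogeneous_baLeading_left m hd).trans_lt (Nat.lt_succ_self _)

theorem IsBakerAkhiezer.sum_baComp (hP : IsBakerAkhiezer (N + 1) m P) (lam : Fin (N + 1) → ℂ) :
    ∑ k ∈ Finset.range (m * ((N + 1) * N / 2) + 1), baComp m lam P k = baElt m lam P := by
  conv_rhs => rw [eq_sum_weightedHomogeneousComponent fun d hd => hP.weight_lt hd]
  rw [map_sum, ← Finset.sum_range_reflect]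
  refine Finset.sum_congr rfl fun k hk => ?_
  rw [Finset.mem_range] at hk
  rw [baComp, if_pos (by omega)]
  congr 3
  omega

theorem IsBakerAkhiezer.coefEval_baComp_zero (hP : IsBakerAkhiezer (N + 1) m P)
    {x lam : Fin (N + 1) → ℂ} (hx : Function.Injective x) (hlam : Function.Injective lam) :
    coefEval x (baComp m lam P 0) = 1 := by
  have h1 : MvPolynomial.weightedHomogeneousComponent (leftWeight (N + 1))
      (m * ((N + 1) * N / 2)) P = baLeading (N + 1) m := by
    have h2 := MvPolynomial.weightedHomogeneousComponent_eq_zero' (w := leftWeight (N + 1))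
      (m * ((N + 1) * N / 2)) (P - baLeading (N + 1) m) fun d hd => by
        rw [weight_leftWeight]
        exact (hP.leading_left d hd).ne
    rwa [map_sub, sub_eq_zero, (isWeightedHomogeneous_baLeading_left
      m).weightedHomogeneousComponent_same] at h2
  rw [baComp, if_pos (Nat.zero_le _), Nat.sub_zero, h1, coefEval_baElt, eval_baLeading]
  exact div_self (mul_ne_zero (pow_ne_zero _ (diffProd_ne_zero hx))
    (pow_ne_zero _ (diffProd_ne_zero hlam)))

theorem coefEval_coefDeriv_eq_zero_of_const {F : Coef N} {c : ℂ}
    (hF : ∀ x, Function.Injective x → coefEval x F = c) (a : Fin (N + 1)) {x : Fin (N + 1) → ℂ}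
    (hx : Function.Injective x) : coefEval x (coefDeriv a F) = 0 := by
  have h3 : (fun s => coefEval (Function.update x a s) F) =ᶠ[nhds (x a)] fun _ => c :=
    (eventually_injective_update hx a).mono fun s hs => hF _ hs
  exact (hasDerivAt_coefEval hx a F).unique
    ((hasDerivAt_const (x a) c).congr_of_eventuallyEq h3)

theorem invSqSum_smul (c : ℂ) (x : Fin (N + 1) → ℂ) :
    invSqSum (c • x) = c⁻¹ ^ 2 * invSqSum x := by
  simp only [invSqSum, Finset.mul_sum, Pi.smul_apply, smul_eq_mul, ← mul_sub, mul_inv, mul_pow]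

theorem IsBakerAkhiezer.satisfiesRecursion (hP : IsBakerAkhiezer (N + 1) m P)
    {lam : Fin (N + 1) → ℂ} (hlam : Function.Injective lam) :
    SatisfiesRecursion ((m : ℂ) * (m + 1)) lam (baComp m lam P) := by
  intro x hx k
  set F := baComp m lam P with hF
  set D := m * ((N + 1) * N / 2) with hD
  have hzero : ∀ k, D < k → F k = 0 := fun k hk => by rw [hF, baComp, if_neg (by omega)]
  rcases Nat.lt_or_ge D k with hk | hk
  · simp [hzero k hk, hzero (k + 1) (by omega), coefLaplacian, coefDirDeriv]
  have hd0 : coefDirDeriv lam x (F 0) = 0 := Finset.sum_eq_zero fun a _ => by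
    rw [coefEval_coefDeriv_eq_zero_of_const
      (fun y hy => hP.coefEval_baComp_zero hy hlam) a hx, mul_zero]
  refine eq_zero_of_sum_pow_mul_eq_zero (B := D + 1) (a := fun k => coefLaplacian x (F k) -
    (m : ℂ) * (m + 1) * invSqSum x * coefEval x (F k) + 2 * coefDirDeriv lam x (F (k + 1)))
    (fun t ht => ?_) (by omega)
  have hc : t⁻¹ ≠ 0 := inv_ne_zero ht
  have hcx : Function.Injective (t⁻¹ • x) := fun i j h => hx (mul_left_cancel₀ hc h)
  have h1 := hP.schrodinger (t⁻¹ • x) lam hcx hlam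
  have h2 : baFun m P (t⁻¹ • x) lam = wave lam (baElt m lam P) (t⁻¹ • x) :=
    congrFun (baFun_eq_wave m lam P) (t⁻¹ • x)
  have h0 : ∑ k ∈ Finset.range (D + 1), F k = baElt m lam P := hP.sum_baComp lam
  rw [baFun_eq_wave, h2, schrodinger_wave_iff m lam _ hcx, ← h0] at h1
  have e1 : ∀ k, coefEval (t⁻¹ • x) (F k) = t ^ k * coefEval x (F k) := fun k => by
    rw [isHomog_baComp m lam P k x hx _ hc, inv_inv]
  have e2 : ∀ a k, coefEval (t⁻¹ • x) (coefDeriv a (F k)) =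
      t ^ (k + 1) * coefEval x (coefDeriv a (F k)) := fun a k => by
    rw [(isHomog_baComp m lam P k).coefDeriv a x hx _ hc, inv_inv]
  have e3 : ∀ a k, coefEval (t⁻¹ • x) (coefDeriv a (coefDeriv a (F k))) =
      t ^ (k + 2) * coefEval x (coefDeriv a (coefDeriv a (F k))) := fun a k => by
    rw [((isHomog_baComp m lam P k).coefDeriv a).coefDeriv a x hx _ hc, inv_inv]
  have f1 : coefLaplacian (t⁻¹ • x) (∑ k ∈ Finset.range (D + 1), F k) =
      ∑ k ∈ Finset.range (D + 1), t ^ (k + 2) * coefLaplacian x (F k) := by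
    simp only [coefLaplacian, map_sum, e3, Finset.mul_sum]
    exact Finset.sum_comm
  have f2 : coefDirDeriv lam (t⁻¹ • x) (∑ k ∈ Finset.range (D + 1), F k) =
      ∑ k ∈ Finset.range (D + 1), t ^ (k + 2) * coefDirDeriv lam x (F (k + 1)) := by
    have : coefDirDeriv lam (t⁻¹ • x) (∑ k ∈ Finset.range (D + 1), F k) =
        ∑ k ∈ Finset.range (D + 1), t ^ (k + 1) * coefDirDeriv lam x (F k) := by
      simp only [coefDirDeriv, map_sum, e2, Finset.mul_sum]
      rw [Finset.sum_comm]
      exact Finset.sum_congr rfl fun _ _ => Finset.sum_congr rfl fun _ _ => by ring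
    rw [this, Finset.sum_range_succ', hd0, mul_zero, add_zero, Finset.sum_range_succ,
      hzero (D + 1) (by omega)]
    simp [coefDirDeriv]
  rw [f1, f2, map_sum, invSqSum_smul, inv_inv] at h1
  simp only [e1] at h1
  have h3 : t ^ 2 * ∑ k ∈ Finset.range (D + 1), t ^ k * (coefLaplacian x (F k) -
      (m : ℂ) * (m + 1) * invSqSum x * coefEval x (F k) +
      2 * coefDirDeriv lam x (F (k + 1))) = 0 := by
    rw [← h1, Finset.mul_sum, Finset.mul_sum, Finset.mul_sum, ← Finset.sum_sub_distrib,
      ← Finset.sum_add_distrib]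
    exact Finset.sum_congr rfl fun _ _ => by ring
  exact (mul_eq_zero.mp h3).resolve_left (pow_ne_zero 2 ht)

/-- On points with distinct imaginary parts and for real parameters a Baker--Akhiezer numerator
is given by the homogeneous components. -/
theorem IsBakerAkhiezer.coefEval_baElt (hP : IsBakerAkhiezer (N + 1) m P)
    {r : Fin (N + 1) → ℝ} (hr : Function.Injective r) {x : Fin (N + 1) → ℂ} (hx : ImInjective x) :
    coefEval x (baElt m (fun i => (r i : ℂ)) P) =
      ∑ k ∈ Finset.range (m * ((N + 1) * N / 2) + 1),
        coefEval x (baCoef m (fun i => (r i : ℂ)) k) := by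
  have hr' : Function.Injective fun i => (r i : ℂ) := Complex.ofReal_injective.comp hr
  rw [← hP.sum_baComp, map_sum]
  refine Finset.sum_congr rfl fun k _ => ?_
  refine SatisfiesRecursion.eq hr (κ := (m : ℂ) * (m + 1)) (hP.satisfiesRecursion hr') ?_
    (isHomog_baComp _ _ _) (isHomog_baCoef _ _) (fun y hy => ?_) k x hx
  · simpa using satisfiesRecursion_baCoef (m : ℤ) hr'
  · rw [hP.coefEval_baComp_zero hy.injective hr', baCoef_zero, map_one]

/-- Polynomials are determined by their values at points with distinct imaginary parts and at
real parameters. -/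
theorem mvPolynomial_eq_of_eval_eq {P Q : MvPolynomial (Fin (N + 1) ⊕ Fin (N + 1)) ℂ}
    (h : ∀ (x : Fin (N + 1) → ℂ) (r : Fin (N + 1) → ℝ), ImInjective x → StrictMono r →
      MvPolynomial.eval (Sum.elim x fun i => (r i : ℂ)) P =
        MvPolynomial.eval (Sum.elim x fun i => (r i : ℂ)) Q) : P = Q := by
  refine MvPolynomial.funext_set (Sum.elim (fun i => {z : ℂ | z.im = i}) fun i =>
    Complex.ofReal '' Set.Ioo (i : ℝ) (i + 1)) ?_ fun v hv => ?_
  · rintro (i | i)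
    · refine Set.infinite_of_injective_forall_mem (f := fun t : ℝ => (t : ℂ) + i * Complex.I)
        (fun s t hst => ?_) fun t => ?_
      · simpa using hst
      · simp
    · exact (Set.Ioo_infinite (by linarith)).image Complex.ofReal_injective.injOn
  · have h1 : ∀ i : Fin (N + 1), (v (Sum.inl i)).im = i := fun i => hv (Sum.inl i) trivial
    have h2 : ∀ i : Fin (N + 1), ∃ t : ℝ, t ∈ Set.Ioo (i : ℝ) (i + 1) ∧ (t : ℂ) = v (Sum.inr i) :=
      fun i => hv (Sum.inr i) trivial
    choose r hr hrv using h2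
    have e : v = Sum.elim (fun i => v (Sum.inl i)) fun i => (r i : ℂ) := by
      ext (i | i)
      · rfl
      · exact (hrv i).symm
    rw [e]
    refine h _ _ (fun i j hij => ?_) fun i j hij => ?_
    · simp only [h1, Nat.cast_inj] at hij
      exact Fin.ext hij
    · have : ((i : ℕ) : ℝ) + 1 ≤ (j : ℕ) := by exact_mod_cast hij
      linarith [(hr i).2, (hr j).1]

theorem IsBakerAkhiezer.unique {P' : MvPolynomial (Fin (N + 1) ⊕ Fin (N + 1)) ℂ}
    (hP : IsBakerAkhiezer (N + 1) m P) (hP' : IsBakerAkhiezer (N + 1) m P') : P = P' := by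
  refine mvPolynomial_eq_of_eval_eq fun x r hx hr => ?_
  have h := (hP.coefEval_baElt hr.injective hx).trans (hP'.coefEval_baElt hr.injective hx).symm
  have hr' : Function.Injective fun i => (r i : ℂ) := Complex.ofReal_injective.comp hr.injective
  rw [_root_.coefEval_baElt, _root_.coefEval_baElt] at h
  exact (div_left_inj' (mul_ne_zero (pow_ne_zero _ (diffProd_ne_zero hx.injective))
    (pow_ne_zero _ (diffProd_ne_zero hr')))).mp h

end Components

section Operator

variable {N : ℕ}

/-- The gauged Calogero--Moser operator at a point `x`. -/
def cmOp (κ : ℂ) (lam x : Fin (N + 1) → ℂ) (F : Coef N) : ℂ :=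
  coefLaplacian x F - κ * invSqSum x * coefEval x F + 2 * coefDirDeriv lam x F

theorem cmOp_congr {κ : ℂ} {lam : Fin (N + 1) → ℂ} {F G : Coef N}
    (h : ∀ y, Function.Injective y → coefEval y F = coefEval y G) {x : Fin (N + 1) → ℂ}
    (hx : Function.Injective x) : cmOp κ lam x F = cmOp κ lam x G := by
  have h0 : ∀ y, Function.Injective y → coefEval y (F - G) = 0 := fun y hy => by
    rw [map_sub, h y hy, sub_self]
  have h1 : ∀ a y, Function.Injective y → coefEval y (coefDeriv a (F - G)) = 0 :=
    fun a y hy => coefEval_coefDeriv_eq_zero_of_const h0 a hy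
  have h2 : ∀ a y, Function.Injective y → coefEval y (coefDeriv a (coefDeriv a (F - G))) = 0 :=
    fun a y hy => coefEval_coefDeriv_eq_zero_of_const (h1 a) a hy
  simp only [map_sub, sub_eq_zero] at h1 h2
  simp only [cmOp, coefLaplacian, coefDirDeriv, h x hx, h1 _ x hx, h2 _ x hx]

theorem cmOp_smul (κ : ℂ) (lam x : Fin (N + 1) → ℂ) (c : ℂ) (F : Coef N) :
    cmOp κ lam x (c • F) = c * cmOp κ lam x F := by
  simp only [cmOp, coefLaplacian, coefDirDeriv, Derivation.map_smul, coefEval_smul, mul_sub,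
    mul_add, Finset.mul_sum]
  congr 1
  · congr 1
    ring
  · exact Finset.sum_congr rfl fun _ _ => by ring

theorem cmOp_sum_baCoef (m : ℕ) {lam : Fin (N + 1) → ℂ} (hlam : Function.Injective lam)
    {x : Fin (N + 1) → ℂ} (hx : Function.Injective x) :
    cmOp (m * (m + 1)) lam x (∑ k ∈ Finset.range (m * ((N + 1) * N / 2) + 1),
      baCoef (-(m : ℤ) - 1) lam k) = 0 := by
  set D := m * ((N + 1) * N / 2) with hD
  have hrec := satisfiesRecursion_baCoef (-(m : ℤ) - 1) hlam
  have e : ((-(m : ℤ) - 1 : ℤ) : ℂ) * (((-(m : ℤ) - 1 : ℤ) : ℂ) + 1) = (m : ℂ) * (m + 1) := by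
    push_cast
    ring
  rw [e] at hrec
  set F := baCoef (-(m : ℤ) - 1) lam with hF
  have hD1 : F (D + 1) = 0 := baCoef_eq_zero lam (by rw [card_tri]; omega)
  have h1 : coefLaplacian x (∑ k ∈ Finset.range (D + 1), F k) =
      ∑ k ∈ Finset.range (D + 1), coefLaplacian x (F k) := by
    simp only [coefLaplacian, map_sum]
    exact Finset.sum_comm
  have h2 : coefDirDeriv lam x (∑ k ∈ Finset.range (D + 1), F k) =
      ∑ k ∈ Finset.range (D + 1), coefDirDeriv lam x (F (k + 1)) := by
    have : coefDirDeriv lam x (∑ k ∈ Finset.range (D + 1), F k) =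
        ∑ k ∈ Finset.range (D + 1), coefDirDeriv lam x (F k) := by
      simp only [coefDirDeriv, map_sum, Finset.mul_sum]
      exact Finset.sum_comm
    rw [this, Finset.sum_range_succ', Finset.sum_range_succ, hD1, hF, baCoef_zero]
    simp [coefDirDeriv]
  rw [cmOp, h1, h2, map_sum, Finset.mul_sum, Finset.mul_sum, ← Finset.sum_sub_distrib,
    ← Finset.sum_add_distrib]
  exact Finset.sum_eq_zero fun k _ => hrec x hx k

end Operator

section Regularity

variable {N : ℕ}

/-- The elements of `Coef N` without poles at `y`. -/
def regularSubalgebra (y : Fin (N + 1) → ℂ) : Subalgebra ℂ (Coef N) :=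
  Algebra.adjoin ℂ (Set.range (fun i => MvPolynomial.X (Sum.inl i)) ∪
    {F | ∃ i l, y i ≠ y l ∧ F = invDiff i l})

theorem X_mem_regularSubalgebra (y : Fin (N + 1) → ℂ) (i : Fin (N + 1)) :
    MvPolynomial.X (Sum.inl i) ∈ regularSubalgebra y :=
  Algebra.subset_adjoin (Or.inl ⟨i, rfl⟩)

theorem invDiff_mem_regularSubalgebra {y : Fin (N + 1) → ℂ} {i l : Fin (N + 1)} (h : y i ≠ y l) :
    invDiff i l ∈ regularSubalgebra y :=
  Algebra.subset_adjoin (Or.inr ⟨i, l, h, rfl⟩)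

theorem coefLift_mem_regularSubalgebra (y lam : Fin (N + 1) → ℂ)
    (P : MvPolynomial (Fin (N + 1) ⊕ Fin (N + 1)) ℂ) : coefLift lam P ∈ regularSubalgebra y := by
  induction P using MvPolynomial.induction_on with
  | C c =>
    rw [← MvPolynomial.algebraMap_eq, AlgHom.commutes]
    exact Subalgebra.algebraMap_mem _ c
  | add F G hF hG => rw [map_add]; exact add_mem hF hG
  | mul_X F v hF =>
    rw [map_mul, coefLift, MvPolynomial.aeval_X]
    refine mul_mem hF ?_
    rcases v with i | i
    · exact X_mem_regularSubalgebra y i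
    · exact Subalgebra.algebraMap_mem _ (lam i)

theorem coefDeriv_mem_regularSubalgebra {y : Fin (N + 1) → ℂ} (a : Fin (N + 1)) {F : Coef N}
    (hF : F ∈ regularSubalgebra y) : coefDeriv a F ∈ regularSubalgebra y := by
  have hite : ∀ p : Prop, [Decidable p] → (if p then 1 else 0 : Coef N) ∈ regularSubalgebra y := by
    intro p _
    split_ifs
    exacts [one_mem _, zero_mem _]
  induction hF using Algebra.adjoin_induction with
  | mem F hF =>
    rcases hF with ⟨i, rfl⟩ | ⟨i, l, h, rfl⟩
    · rw [coefDeriv_X]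
      exact hite _
    · rw [coefDeriv_invDiff]
      exact neg_mem (mul_mem (sub_mem (hite _) (hite _))
        (pow_mem (invDiff_mem_regularSubalgebra h) 2))
  | algebraMap c => rw [Derivation.map_algebraMap]; exact zero_mem _
  | add F G _ _ hF hG => rw [map_add]; exact add_mem hF hG
  | mul F G hF' hG' hF hG =>
    rw [Derivation.leibniz]
    exact add_mem (mul_mem hF' hG) (mul_mem hG' hF)

theorem continuousAt_of_mem_regularSubalgebra {y : Fin (N + 1) → ℂ} {F : Coef N}
    (hF : F ∈ regularSubalgebra y) : ContinuousAt (fun x => coefEval x F) y := by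
  induction hF using Algebra.adjoin_induction with
  | mem F hF =>
    rcases hF with ⟨i, rfl⟩ | ⟨i, l, h, rfl⟩
    · simpa only [coefEval_X] using (continuous_apply i).continuousAt
    · simp only [coefEval_invDiff]
      exact (((continuous_apply i).sub (continuous_apply l)).continuousAt).inv₀
        (sub_ne_zero.mpr h)
  | algebraMap c => simpa only [MvPolynomial.algebraMap_eq, coefEval_C] using continuousAt_const
  | add F G _ _ hF hG => simpa only [map_add] using hF.fun_add hG
  | mul F G _ _ hF hG => simpa only [map_mul] using hF.fun_mul hG

theorem derivation_pow_mul {R A : Type*} [CommRing R] [CommRing A] [Algebra R A]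
    (D : Derivation R A A) {q e : A} (hq : D q = -(e * q ^ 2)) (K : ℕ) (G : A) :
    D (q ^ K * G) = q ^ K * D G - K * e * q ^ (K + 1) * G := by
  rw [Derivation.leibniz, Derivation.leibniz_pow, hq]
  simp only [smul_eq_mul, nsmul_eq_mul]
  rcases K with _ | K
  · simp
  · rw [Nat.add_sub_cancel]
    ring

theorem derivation_derivation_pow_mul {R A : Type*} [CommRing R] [CommRing A] [Algebra R A]
    (D : Derivation R A A) {q e : A} (hq : D q = -(e * q ^ 2)) (he : D e = 0) (K : ℕ) (G : A) :
    D (D (q ^ K * G)) = K * (K + 1) * e ^ 2 * q ^ (K + 2) * G -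
      2 * K * e * q ^ (K + 1) * D G + q ^ K * D (D G) := by
  have h : (K : A) * e * q ^ (K + 1) * G = q ^ (K + 1) * (K * e * G) := by ring
  rw [derivation_pow_mul D hq, map_sub, derivation_pow_mul D hq, h, derivation_pow_mul D hq,
    Derivation.leibniz, Derivation.leibniz, he, Derivation.map_natCast]
  simp only [smul_eq_mul]
  push_cast
  ring

theorem injective_update {x : Fin (N + 1) → ℂ} (hx : Function.Injective x) {a : Fin (N + 1)}
    {z : ℂ} (hz : ∀ c, c ≠ a → z ≠ x c) : Function.Injective (Function.update x a z) := by
  intro i l h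
  by_cases hi : i = a <;> by_cases hl : l = a
  · rw [hi, hl]
  · subst hi
    rw [Function.update_self, Function.update_of_ne hl] at h
    exact absurd h (hz l hl)
  · subst hl
    rw [Function.update_self, Function.update_of_ne hi] at h
    exact absurd h.symm (hz i hi)
  · rw [Function.update_of_ne hi, Function.update_of_ne hl] at h
    exact hx h

theorem update_apply_ne {x : Fin (N + 1) → ℂ} (hx : Function.Injective x) {a b i l : Fin (N + 1)}
    (hil : i ≠ l) (h1 : ¬(i = a ∧ l = b)) (h2 : ¬(i = b ∧ l = a)) :
    Function.update x a (x b) i ≠ Function.update x a (x b) l := by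
  intro h
  by_cases hi : i = a <;> by_cases hl : l = a
  · exact hil (hi.trans hl.symm)
  · rw [hi, Function.update_self, Function.update_of_ne hl] at h
    exact h1 ⟨hi, (hx h).symm⟩
  · rw [hl, Function.update_self, Function.update_of_ne hi] at h
    exact h2 ⟨hx h, hl⟩
  · rw [Function.update_of_ne hi, Function.update_of_ne hl] at h
    exact hil (hx h)

/-- The exponent of a pole on a diagonal is determined by the operator. -/
theorem coefEval_eq_zero_of_cmOp {κ : ℂ} {lam : Fin (N + 1) → ℂ} {a b : Fin (N + 1)}
    (hab : a ≠ b) {x : Fin (N + 1) → ℂ} (hx : Function.Injective x) {G : Coef N}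
    (hG : G ∈ regularSubalgebra (Function.update x a (x b))) {K : ℕ} (hK : (K : ℂ) * (K + 1) ≠ κ)
    (h : ∀ z, Function.Injective z → cmOp κ lam z (invDiff a b ^ K * G) = 0) :
    coefEval (Function.update x a (x b)) G = 0 := by
  set y := Function.update x a (x b) with hy
  set z : ℂ → Fin (N + 1) → ℂ := fun s => Function.update x a (x b + s) with hz
  have hz0 : z 0 = y := by simp [hz, hy]
  have hzc : ContinuousAt z 0 :=
    (continuous_const.update a (continuous_const.add continuous_id)).continuousAt
  have hdiff : ∀ s, z s a - z s b = s := fun s => by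
    simp [hz, Function.update_of_ne hab.symm]
  have lim : ∀ F ∈ regularSubalgebra y, Filter.Tendsto (fun s => coefEval (z s) F)
      (nhdsWithin 0 {0}ᶜ) (nhds (coefEval y F)) := by
    intro F hF
    have hc := continuousAt_of_mem_regularSubalgebra hF
    rw [← hz0] at hc ⊢
    exact (hc.comp hzc).tendsto.mono_left nhdsWithin_le_nhds
  have hs : Filter.Tendsto (fun s : ℂ => s) (nhdsWithin 0 {0}ᶜ) (nhds 0) := nhdsWithin_le_nhds
  have hinj : ∀ᶠ s in nhdsWithin (0 : ℂ) {0}ᶜ, Function.Injective (z s) := by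
    have h1 : ∀ c, c ≠ a → ∀ᶠ s in nhdsWithin (0 : ℂ) {0}ᶜ, x b + s ≠ x c := by
      intro c hc
      by_cases hcb : c = b
      · subst hcb
        filter_upwards [self_mem_nhdsWithin] with s hs
        simpa using hs
      · refine Filter.Eventually.filter_mono nhdsWithin_le_nhds
          (ContinuousAt.eventually_ne (by fun_prop) ?_)
        rw [add_zero]
        exact fun h' => hcb (hx h').symm
    have h2 : ∀ᶠ s in nhdsWithin (0 : ℂ) {0}ᶜ, ∀ c, c ≠ a → x b + s ≠ x c :=
      Filter.eventually_all.mpr fun c => by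
        by_cases hc : c = a
        · simp [hc]
        · simpa [hc] using h1 c hc
    exact h2.mono fun s hs => injective_update hx hs
  have hS : Filter.Tendsto (fun s => s ^ 2 * invSqSum (z s)) (nhdsWithin 0 {0}ᶜ) (nhds 2) := by
    have h1 : ∀ i l, Filter.Tendsto (fun s => s ^ 2 * (z s i - z s l)⁻¹ ^ 2)
        (nhdsWithin 0 {0}ᶜ)
        (nhds ((if i = a ∧ l = b then 1 else 0) + if i = b ∧ l = a then 1 else 0)) := by
      intro i l
      by_cases h1 : i = a ∧ l = b
      · obtain ⟨rfl, rfl⟩ := h1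
        rw [if_pos ⟨rfl, rfl⟩, if_neg fun h => hab h.1, add_zero]
        refine tendsto_const_nhds.congr' ?_
        filter_upwards [self_mem_nhdsWithin] with s hs
        rw [hdiff, ← mul_pow, mul_inv_cancel₀ hs, one_pow]
      by_cases h2 : i = b ∧ l = a
      · obtain ⟨rfl, rfl⟩ := h2
        rw [if_neg h1, if_pos ⟨rfl, rfl⟩, zero_add]
        refine tendsto_const_nhds.congr' ?_
        filter_upwards [self_mem_nhdsWithin] with s hs
        rw [← neg_sub, hdiff, ← mul_pow, inv_neg, mul_neg, mul_inv_cancel₀ hs, neg_sq, one_pow]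
      rw [if_neg h1, if_neg h2, add_zero]
      by_cases hil : i = l
      · simp [hil]
      · have h3 := lim _ (pow_mem (invDiff_mem_regularSubalgebra
          (update_apply_ne hx hil h1 h2)) 2)
        simp only [map_pow, coefEval_invDiff] at h3
        simpa using (hs.pow 2).mul h3
    have h2 := tendsto_finsetSum Finset.univ fun i _ =>
      tendsto_finsetSum Finset.univ fun l _ => h1 i l
    have h3 : ∑ i : Fin (N + 1), ∑ l : Fin (N + 1),
        ((if i = a ∧ l = b then 1 else 0) + if i = b ∧ l = a then 1 else 0 : ℂ) = 2 := by
      simp only [Finset.sum_add_distrib, ite_and, Finset.sum_ite_irrel, Finset.sum_ite_eq',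
        Finset.sum_const_zero, Finset.mem_univ, if_true]
      norm_num
    rw [h3] at h2
    simpa only [invSqSum, Finset.mul_sum] using h2
  set ε : Fin (N + 1) → ℂ := fun c => (if a = c then 1 else 0) - if b = c then 1 else 0 with hε
  have hq : ∀ c, coefDeriv c (invDiff a b) =
      -(algebraMap ℂ (Coef N) (ε c) * invDiff a b ^ 2) := by
    intro c
    rw [coefDeriv_invDiff]
    simp only [hε, map_sub, apply_ite (algebraMap ℂ (Coef N)), map_one, map_zero]
  have hεs : ∑ c, ε c ^ 2 = 2 := by
    have : ∀ c, ε c ^ 2 = (if a = c then 1 else 0) + if b = c then 1 else 0 := by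
      intro c
      simp only [hε]
      by_cases h1 : a = c
      · subst h1
        simp [hab.symm]
      · by_cases h2 : b = c <;> simp [h1, h2]
    simp only [this, Finset.sum_add_distrib, Finset.sum_ite_eq, Finset.mem_univ, if_true]
    norm_num
  have key : ∀ s, s ≠ 0 → s ^ (K + 2) * cmOp κ lam (z s) (invDiff a b ^ K * G) =
      2 * (K * (K + 1)) * coefEval (z s) G -
        s * (2 * K * ∑ c, ε c * coefEval (z s) (coefDeriv c G)) +
        s ^ 2 * ∑ c, coefEval (z s) (coefDeriv c (coefDeriv c G)) -
        κ * (s ^ 2 * invSqSum (z s)) * coefEval (z s) G -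
        s * (2 * K * (∑ c, lam c * ε c) * coefEval (z s) G) +
        s ^ 2 * (2 * ∑ c, lam c * coefEval (z s) (coefDeriv c G)) := by
    intro s hs0
    have hqs : coefEval (z s) (invDiff a b) = s⁻¹ := by rw [coefEval_invDiff, hdiff]
    have hp : s ^ K * s⁻¹ ^ K = 1 := by rw [← mul_pow, mul_inv_cancel₀ hs0, one_pow]
    have e1 : ∀ c, coefEval (z s) (coefDeriv c (coefDeriv c (invDiff a b ^ K * G))) =
        s⁻¹ ^ (K + 2) * (K * (K + 1) * ε c ^ 2 * coefEval (z s) G -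
          s * (2 * K * (ε c * coefEval (z s) (coefDeriv c G))) +
          s ^ 2 * coefEval (z s) (coefDeriv c (coefDeriv c G))) := by
      intro c
      rw [derivation_derivation_pow_mul _ (hq c) (Derivation.map_algebraMap _ _)]
      simp only [map_add, map_sub, map_mul, map_pow, map_natCast, map_one, map_ofNat, hqs,
        MvPolynomial.algebraMap_eq, coefEval_C, inv_pow]
      field_simp
      ring
    have e2 : ∀ c, lam c * coefEval (z s) (coefDeriv c (invDiff a b ^ K * G)) =
        s⁻¹ ^ (K + 2) * (s ^ 2 * (lam c * coefEval (z s) (coefDeriv c G)) -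
          s * (K * (lam c * ε c) * coefEval (z s) G)) := by
      intro c
      rw [derivation_pow_mul _ (hq c)]
      simp only [map_sub, map_mul, map_pow, map_natCast, hqs, MvPolynomial.algebraMap_eq,
        coefEval_C, inv_pow]
      field_simp
      ring
    rw [cmOp, coefLaplacian, coefDirDeriv, Finset.sum_congr rfl fun c _ => e1 c,
      Finset.sum_congr rfl fun c _ => e2 c, map_mul, map_pow, hqs]
    simp only [← Finset.mul_sum, Finset.sum_add_distrib, Finset.sum_sub_distrib, ← Finset.sum_mul,
      hεs]
    have hp2 : s ^ (K + 2) * s⁻¹ ^ (K + 2) = 1 := by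
      rw [← mul_pow, mul_inv_cancel₀ hs0, one_pow]
    rw [mul_add, mul_sub, mul_left_comm _ 2, ← mul_assoc, ← mul_assoc (s ^ (K + 2)) (s⁻¹ ^ (K + 2)),
      hp2]
    linear_combination (-κ * s ^ 2 * invSqSum (z s) * coefEval (z s) G) * hp
  have L := lim G hG
  have L1 := tendsto_finsetSum Finset.univ fun c _ =>
    (lim _ (coefDeriv_mem_regularSubalgebra c hG)).const_mul (ε c)
  have L2 := tendsto_finsetSum Finset.univ fun c _ =>
    lim _ (coefDeriv_mem_regularSubalgebra c (coefDeriv_mem_regularSubalgebra c hG))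
  have L3 := tendsto_finsetSum Finset.univ fun c _ =>
    (lim _ (coefDeriv_mem_regularSubalgebra c hG)).const_mul (lam c)
  have main := (((((L.const_mul (2 * ((K : ℂ) * (K + 1)))).sub
    (hs.mul (L1.const_mul (2 * (K : ℂ))))).add ((hs.pow 2).mul L2)).sub
    ((hS.const_mul κ).mul L)).sub (hs.mul (L.const_mul (2 * (K : ℂ) * ∑ c, lam c * ε c)))).add
    ((hs.pow 2).mul (L3.const_mul 2))
  have hzero : Filter.Tendsto (fun _ : ℂ => (0 : ℂ)) (nhdsWithin 0 {0}ᶜ) (nhds 0) :=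
    tendsto_const_nhds
  have := tendsto_nhds_unique (main.congr' ?_) hzero
  · have h2 : ((K : ℂ) * (K + 1) - κ) * coefEval y G = 0 := by
      linear_combination (1 / 2) * this
    exact (mul_eq_zero.mp h2).resolve_left (sub_ne_zero.mpr hK)
  · filter_upwards [self_mem_nhdsWithin, hinj] with s hs0 hsi
    rw [← key s hs0, h _ hsi, mul_zero]

end Regularity

section Polar

variable {N : ℕ}

/-- The pairs of labels. -/
def pairs (N : ℕ) : Finset (Fin (N + 1) × Fin (N + 1)) := Finset.univ.filter fun q => q.1 < q.2

theorem mem_pairs {q : Fin (N + 1) × Fin (N + 1)} : q ∈ pairs N ↔ q.1 < q.2 := by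
  simp [pairs]

theorem prod_pairs {M : Type*} [CommMonoid M] (f : Fin (N + 1) → Fin (N + 1) → M) :
    ∏ q ∈ pairs N, f q.1 q.2 = ∏ i, ∏ j ∈ Finset.Ioi i, f i j := by
  rw [pairs, Finset.prod_filter, ← Finset.univ_product_univ, Finset.prod_product]
  refine Finset.prod_congr rfl fun i _ => ?_
  rw [← Finset.prod_filter]
  exact Finset.prod_congr (by ext; simp) fun _ _ => rfl

theorem prod_mu (lam : Fin (N + 1) → ℂ) : ∏ p ∈ tri N, mu lam p = diffProd lam := by
  have h : diffProd lam = ∏ j, ∏ i ∈ Finset.Iio j, (lam i - lam j) :=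
    Finset.prod_comm' fun i j => by simp
  rw [prod_tri, h, Fin.prod_univ_succ, Finset.prod_range]
  have h0 : Finset.Iio (0 : Fin (N + 1)) = ∅ := by
    ext i
    simp
  rw [h0, Finset.prod_empty, one_mul]
  refine Finset.prod_congr rfl fun s _ => ?_
  have h1 : Fin.ofNat (N + 1) (s.val + 1) = s.succ := by
    ext
    rw [Fin.val_ofNat, Nat.mod_eq_of_lt (by omega), Fin.val_succ]
  have h2 : level N s = Finset.Iio s.succ := by
    ext i
    rw [mem_level, Finset.mem_Iio, Fin.lt_def, Fin.val_succ, Nat.lt_succ_iff]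
  rw [h2]
  exact Finset.prod_congr rfl fun i _ => by rw [mu, h1]

/-- Functions of `x` and `lam` which become polynomials after multiplication by a power of
`A(x)`. -/
def IsPolar (f : (Fin (N + 1) → ℂ) → (Fin (N + 1) → ℂ) → ℂ) : Prop :=
  ∃ (K : ℕ) (p : MvPolynomial (Fin (N + 1) ⊕ Fin (N + 1)) ℂ), ∀ x lam, Function.Injective x →
    Function.Injective lam → diffProd x ^ K * f x lam = MvPolynomial.eval (Sum.elim x lam) p

theorem isPolar_eval (p : MvPolynomial (Fin (N + 1) ⊕ Fin (N + 1)) ℂ) :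
    IsPolar fun x lam => MvPolynomial.eval (Sum.elim x lam) p :=
  ⟨0, p, fun _ _ _ _ => by rw [pow_zero, one_mul]⟩

theorem isPolar_const (c : ℂ) : IsPolar fun _ _ : Fin (N + 1) → ℂ => c := by
  simpa using isPolar_eval (N := N) (MvPolynomial.C c)

theorem eval_diffProd_inl (x lam : Fin (N + 1) → ℂ) :
    MvPolynomial.eval (Sum.elim x lam)
      (diffProd fun i : Fin (N + 1) => MvPolynomial.X (Sum.inl i)) = diffProd x := by
  simp [diffProd]

theorem IsPolar.add {f g : (Fin (N + 1) → ℂ) → (Fin (N + 1) → ℂ) → ℂ} (hf : IsPolar f)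
    (hg : IsPolar g) : IsPolar fun x lam => f x lam + g x lam := by
  obtain ⟨K, p, hp⟩ := hf
  obtain ⟨L, q, hq⟩ := hg
  refine ⟨K + L, (diffProd fun i => MvPolynomial.X (Sum.inl i)) ^ L * p +
    (diffProd fun i => MvPolynomial.X (Sum.inl i)) ^ K * q, fun x lam hx hlam => ?_⟩
  rw [map_add, map_mul, map_mul, map_pow, map_pow, eval_diffProd_inl, ← hp x lam hx hlam,
    ← hq x lam hx hlam]
  ring

theorem IsPolar.mul {f g : (Fin (N + 1) → ℂ) → (Fin (N + 1) → ℂ) → ℂ} (hf : IsPolar f)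
    (hg : IsPolar g) : IsPolar fun x lam => f x lam * g x lam := by
  obtain ⟨K, p, hp⟩ := hf
  obtain ⟨L, q, hq⟩ := hg
  refine ⟨K + L, p * q, fun x lam hx hlam => ?_⟩
  rw [map_mul, ← hp x lam hx hlam, ← hq x lam hx hlam]
  ring

theorem IsPolar.sum {ι : Type*} {s : Finset ι}
    {f : ι → (Fin (N + 1) → ℂ) → (Fin (N + 1) → ℂ) → ℂ} (hf : ∀ i ∈ s, IsPolar (f i)) :
    IsPolar fun x lam => ∑ i ∈ s, f i x lam := by
  classical
  induction s using Finset.induction_on with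
  | empty => simpa using isPolar_const (N := N) 0
  | insert i s hi ih =>
    simp only [Finset.sum_insert hi]
    exact (hf i (Finset.mem_insert_self i s)).add
      (ih fun j hj => hf j (Finset.mem_insert_of_mem hj))

theorem IsPolar.prod {ι : Type*} {s : Finset ι}
    {f : ι → (Fin (N + 1) → ℂ) → (Fin (N + 1) → ℂ) → ℂ} (hf : ∀ i ∈ s, IsPolar (f i)) :
    IsPolar fun x lam => ∏ i ∈ s, f i x lam := by
  classical
  induction s using Finset.induction_on with
  | empty => simpa using isPolar_const (N := N) 1
  | insert i s hi ih =>
    simp only [Finset.prod_insert hi]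
    exact (hf i (Finset.mem_insert_self i s)).mul
      (ih fun j hj => hf j (Finset.mem_insert_of_mem hj))

theorem IsPolar.congr {f g : (Fin (N + 1) → ℂ) → (Fin (N + 1) → ℂ) → ℂ} (hf : IsPolar f)
    (h : ∀ x lam, Function.Injective x → Function.Injective lam → g x lam = f x lam) :
    IsPolar g := by
  obtain ⟨K, p, hp⟩ := hf
  exact ⟨K, p, fun x lam hx hlam => by rw [h x lam hx hlam, hp x lam hx hlam]⟩

theorem sub_dvd_diffProd {R : Type*} [CommRing R] (u : Fin (N + 1) → R) {i l : Fin (N + 1)}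
    (hil : i < l) : u i - u l ∣ diffProd u :=
  (Finset.dvd_prod_of_mem (fun j => u i - u j) (Finset.mem_Ioi.mpr hil)).trans
    (Finset.dvd_prod_of_mem (fun i => ∏ j ∈ Finset.Ioi i, (u i - u j)) (Finset.mem_univ i))

theorem isPolar_inv_sub (i l : Fin (N + 1)) :
    IsPolar fun x _ : Fin (N + 1) → ℂ => (x i - x l)⁻¹ := by
  have main : ∀ i l : Fin (N + 1), i < l →
      IsPolar fun x _ : Fin (N + 1) → ℂ => (x i - x l)⁻¹ := by
    intro i l hil
    have h := sub_dvd_diffProd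
      (fun i => (MvPolynomial.X (Sum.inl i) : MvPolynomial (Fin (N + 1) ⊕ Fin (N + 1)) ℂ)) hil
    obtain ⟨r, hr⟩ := h
    refine ⟨1, r, fun x lam hx _ => ?_⟩
    have h1 := congrArg (MvPolynomial.eval (Sum.elim x lam)) hr
    rw [eval_diffProd_inl, map_mul, map_sub, MvPolynomial.eval_X, MvPolynomial.eval_X,
      Sum.elim_inl, Sum.elim_inl] at h1
    have h2 : x i - x l ≠ 0 := sub_ne_zero.mpr fun h => hil.ne (hx h)
    rw [pow_one, h1]
    field_simp
  rcases lt_trichotomy i l with h | h | h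
  · exact main i l h
  · subst h
    simpa using isPolar_const (N := N) 0
  · refine ((isPolar_const (-1)).mul (main l i h)).congr fun x lam _ _ => ?_
    rw [← neg_sub, inv_neg, neg_one_mul]

theorem isPolar_coefEval (F : Coef N) : IsPolar fun x _ : Fin (N + 1) → ℂ => coefEval x F := by
  induction F using MvPolynomial.induction_on with
  | C c => simpa only [coefEval_C] using isPolar_const c
  | add F G hF hG => simpa only [map_add] using hF.add hG
  | mul_X F v hF =>
    simp only [map_mul]
    refine hF.mul ?_
    rcases v with i | ⟨i, l⟩
    · simpa [coefEval_X] using isPolar_eval (MvPolynomial.X (Sum.inl i))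
    · simp only [coefEval, MvPolynomial.eval_X, Sum.elim_inr, div_eq_mul_inv]
      exact (isPolar_inv_sub i l).mul (isPolar_const _)

theorem isPolar_diffProd_mul_laplaceWeight (m : ℕ) (d : Fin (N + 1) × ℕ →₀ ℕ) :
    IsPolar fun _ lam : Fin (N + 1) → ℂ =>
      diffProd lam ^ m * laplaceWeight (tri N) ((-(m : ℤ) - 1 : ℤ) : ℂ) (mu lam) d := by
  simp only [← prod_mu, laplaceWeight, ← Finset.prod_pow, ← Finset.prod_mul_distrib]
  refine IsPolar.prod fun p hp => ?_
  set c : ℂ := ∏ r ∈ Finset.range (d p), (((-(m : ℤ) - 1 : ℤ) : ℂ) + 1 + r) with hc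
  by_cases hd : d p ≤ m
  · have h1 := (isPolar_const (N := N) (c * (-1) ^ d p)).mul (isPolar_eval
      ((MvPolynomial.X (Sum.inr p.1) - MvPolynomial.X (Sum.inr (Fin.ofNat (N + 1) (p.2 + 1)))) ^
        (m - d p)))
    refine h1.congr fun x lam _ hlam => ?_
    have h2 := mu_ne_zero hlam hp
    rw [map_pow, map_sub, MvPolynomial.eval_X, MvPolynomial.eval_X, Sum.elim_inr, Sum.elim_inr]
    change _ = c * (-1) ^ d p * mu lam p ^ (m - d p)
    rw [← Nat.sub_add_cancel hd, pow_add, Nat.add_sub_cancel, inv_neg, neg_pow, inv_pow]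
    field_simp
  · have : c = 0 := Finset.prod_eq_zero (Finset.mem_range.mpr (not_le.mp hd)) (by push_cast; ring)
    simpa [this] using isPolar_const (N := N) 0

/-- The sum of the homogeneous components. -/
def baSum (m : ℕ) (lam : Fin (N + 1) → ℂ) : Coef N :=
  ∑ k ∈ Finset.range (m * ((N + 1) * N / 2) + 1), baCoef (-(m : ℤ) - 1) lam k

theorem isPolar_baSum (m : ℕ) :
    IsPolar fun x lam : Fin (N + 1) → ℂ => diffProd lam ^ m * coefEval x (baSum m lam) := by
  simp only [baSum, map_sum, Finset.mul_sum]
  refine IsPolar.sum fun k _ => ?_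
  simp only [baCoef, laplaceCoeff_apply, map_sum, coefEval_smul, Finset.mul_sum, ← mul_assoc]
  exact IsPolar.sum fun d _ => (isPolar_diffProd_mul_laplaceWeight m d).mul (isPolar_coefEval _)

end Polar

section PoleReduction

variable {N : ℕ}

theorem eval_aeval {σ τ : Type*} (v : τ → ℂ) (g : σ → MvPolynomial τ ℂ) (p : MvPolynomial σ ℂ) :
    MvPolynomial.eval v (MvPolynomial.aeval g p) =
      MvPolynomial.eval (fun i => MvPolynomial.eval v (g i)) p := by
  induction p using MvPolynomial.induction_on with
  | C c => rw [← MvPolynomial.algebraMap_eq, AlgHom.commutes, MvPolynomial.algebraMap_eq,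
      MvPolynomial.algebraMap_eq, MvPolynomial.eval_C, MvPolynomial.eval_C]
  | add p q hp hq => rw [map_add, map_add, map_add, hp, hq]
  | mul_X p i hp => rw [map_mul, map_mul, map_mul, hp, MvPolynomial.aeval_X, MvPolynomial.eval_X]

theorem X_sub_X_dvd {σ : Type*} [DecidableEq σ] {a b : σ} {p : MvPolynomial σ ℂ}
    (h : MvPolynomial.aeval (fun v => if v = a then MvPolynomial.X b else
      (MvPolynomial.X v : MvPolynomial σ ℂ)) p = 0) :
    MvPolynomial.X a - MvPolynomial.X b ∣ p := by
  set I : Ideal (MvPolynomial σ ℂ) :=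
    Ideal.span {MvPolynomial.X a - MvPolynomial.X b} with hI
  rw [← Ideal.mem_span_singleton, ← hI, ← Ideal.Quotient.eq_zero_iff_mem]
  have h1 : (Ideal.Quotient.mkₐ ℂ I).comp (MvPolynomial.aeval fun v =>
      if v = a then MvPolynomial.X b else (MvPolynomial.X v : MvPolynomial σ ℂ)) =
      Ideal.Quotient.mkₐ ℂ I := by
    refine MvPolynomial.algHom_ext fun v => ?_
    rw [AlgHom.comp_apply, MvPolynomial.aeval_X]
    split_ifs with hv
    · subst hv
      refine Ideal.Quotient.eq.mpr ?_
      rw [← neg_sub]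
      exact neg_mem (Ideal.subset_span rfl)
    · rfl
  have h2 := congrArg (fun f => f p) h1
  simp only [AlgHom.comp_apply, h, map_zero] at h2
  exact h2.symm

/-- `∏_{i < j} (x_i - x_j) ^ e_ij`. -/
def pairPow (e : Fin (N + 1) × Fin (N + 1) → ℕ) (x : Fin (N + 1) → ℂ) : ℂ :=
  ∏ q ∈ pairs N, (x q.1 - x q.2) ^ e q

theorem pairPow_const (m : ℕ) (x : Fin (N + 1) → ℂ) : pairPow (fun _ => m) x = diffProd x ^ m := by
  rw [pairPow, Finset.prod_pow, prod_pairs fun i j => x i - x j]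
  rfl

theorem dvd_of_pole {m : ℕ} {e : Fin (N + 1) × Fin (N + 1) → ℕ}
    {p : MvPolynomial (Fin (N + 1) ⊕ Fin (N + 1)) ℂ}
    (hp : ∀ x lam, Function.Injective x → Function.Injective lam →
      pairPow e x * (diffProd lam ^ m * coefEval x (baSum m lam)) =
        MvPolynomial.eval (Sum.elim x lam) p)
    {q : Fin (N + 1) × Fin (N + 1)} (hq : q ∈ pairs N) (he : m < e q) :
    MvPolynomial.X (Sum.inl q.1) - MvPolynomial.X (Sum.inl q.2) ∣ p := by
  obtain ⟨a, b⟩ := q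
  have hab : a < b := mem_pairs.mp hq
  refine X_sub_X_dvd (mvPolynomial_eq_of_eval_eq fun x r hx hr => ?_)
  have hr' : Function.Injective fun i => (r i : ℂ) := Complex.ofReal_injective.comp hr.injective
  set lam : Fin (N + 1) → ℂ := fun i => (r i : ℂ) with hlam
  set y := Function.update x a (x b) with hy
  have h1 : MvPolynomial.eval (Sum.elim x lam) (MvPolynomial.aeval (fun v =>
      if v = Sum.inl a then MvPolynomial.X (Sum.inl b) else
        (MvPolynomial.X v : MvPolynomial (Fin (N + 1) ⊕ Fin (N + 1)) ℂ)) p) =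
      MvPolynomial.eval (Sum.elim y lam) p := by
    rw [eval_aeval]
    refine congrArg (fun v => MvPolynomial.eval v p) (funext ?_)
    rintro (i | i)
    · by_cases h : i = a
      · subst h
        simp [hy]
      · simp [hy, h]
    · simp
  rw [h1, map_zero]
  set R : Coef N := ∏ q ∈ (pairs N).erase (a, b), invDiff q.1 q.2 ^ e q with hR
  have hreg : ∀ q ∈ (pairs N).erase (a, b), y q.1 ≠ y q.2 := by
    rintro ⟨i, l⟩ hil
    rw [Finset.mem_erase, mem_pairs] at hil
    refine update_apply_ne hx.injective hil.2.ne (fun h => hil.1 (Prod.ext h.1 h.2)) fun h => ?_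
    have h' : i < l := hil.2
    have h1 : i = b := h.1
    have h2 : l = a := h.2
    rw [h1, h2] at h'
    exact lt_asymm hab h'
  have h2 := coefEval_eq_zero_of_cmOp (κ := m * (m + 1)) (lam := lam) hab.ne hx.injective
    (G := coefLift lam p * R) (K := e (a, b))
    (mul_mem (coefLift_mem_regularSubalgebra _ _ _) (prod_mem fun q hq =>
      pow_mem (invDiff_mem_regularSubalgebra (hreg q hq)) _)) ?_ fun z hz => ?_
  · rw [map_mul, coefEval_coefLift, mul_eq_zero] at h2
    refine h2.resolve_right ?_
    rw [hR, map_prod]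
    refine Finset.prod_ne_zero_iff.mpr fun q hq => ?_
    rw [map_pow, coefEval_invDiff]
    exact pow_ne_zero _ (inv_ne_zero (sub_ne_zero.mpr (hreg q hq)))
  · have : m * (m + 1) < e (a, b) * (e (a, b) + 1) := by nlinarith
    exact_mod_cast this.ne'
  · have h3 : ∀ z, Function.Injective z → coefEval z (invDiff a b ^ e (a, b) *
        (coefLift lam p * R)) = coefEval z (diffProd lam ^ m • baSum m lam) := by
      intro z hz
      have h4 : coefEval z R = ∏ q ∈ (pairs N).erase (a, b), (z q.1 - z q.2)⁻¹ ^ e q := by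
        rw [hR, map_prod]
        exact Finset.prod_congr rfl fun q _ => by rw [map_pow, coefEval_invDiff]
      have h5 : coefEval z (invDiff a b) ^ e (a, b) * coefEval z R = (pairPow e z)⁻¹ := by
        rw [coefEval_invDiff, h4, pairPow, ← Finset.prod_inv_distrib]
        simp only [← inv_pow]
        exact Finset.mul_prod_erase (pairs N) (fun q => (z q.1 - z q.2)⁻¹ ^ e q) hq
      have h6 : pairPow e z ≠ 0 := Finset.prod_ne_zero_iff.mpr fun q hq =>
        pow_ne_zero _ (sub_ne_zero.mpr fun h => (mem_pairs.mp hq).ne (hz h))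
      rw [map_mul, map_mul, map_pow, mul_left_comm, h5, coefEval_coefLift, ← hp z lam hz hr',
        coefEval_smul]
      field_simp
    rw [cmOp_congr h3 hz, cmOp_smul, baSum, cmOp_sum_baCoef m hr' hz, mul_zero]

theorem exists_numerator (m : ℕ) : ∃ p : MvPolynomial (Fin (N + 1) ⊕ Fin (N + 1)) ℂ,
    ∀ x lam, Function.Injective x → Function.Injective lam →
      diffProd x ^ m * (diffProd lam ^ m * coefEval x (baSum m lam)) =
        MvPolynomial.eval (Sum.elim x lam) p := by
  have main : ∀ (n : ℕ) (e : Fin (N + 1) × Fin (N + 1) → ℕ), (∀ q, m ≤ e q) →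
      ∑ q ∈ pairs N, (e q - m) = n →
      (∃ p : MvPolynomial (Fin (N + 1) ⊕ Fin (N + 1)) ℂ,
        ∀ x lam, Function.Injective x → Function.Injective lam →
          pairPow e x * (diffProd lam ^ m * coefEval x (baSum m lam)) =
            MvPolynomial.eval (Sum.elim x lam) p) →
      ∃ p : MvPolynomial (Fin (N + 1) ⊕ Fin (N + 1)) ℂ,
        ∀ x lam, Function.Injective x → Function.Injective lam →
          diffProd x ^ m * (diffProd lam ^ m * coefEval x (baSum m lam)) =
            MvPolynomial.eval (Sum.elim x lam) p := by
    intro n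
    induction n with
    | zero =>
      intro e he hn h
      have h1 : ∀ x, pairPow e x = diffProd x ^ m := by
        intro x
        rw [← pairPow_const, pairPow, pairPow]
        refine Finset.prod_congr rfl fun q hq => ?_
        have h2 := Finset.sum_eq_zero_iff.mp hn q hq
        have h3 := he q
        have h4 : e q = m := by omega
        rw [h4]
      simpa only [h1] using h
    | succ n ih =>
      rintro e he hn ⟨p, hp⟩
      have h1 : ∃ q ∈ pairs N, e q - m ≠ 0 := by
        by_contra! h
        rw [Finset.sum_eq_zero h] at hn
        omega
      obtain ⟨q, hq, heq⟩ := h1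
      obtain ⟨p', rfl⟩ := dvd_of_pole hp hq (by omega)
      refine ih (Function.update e q (e q - 1)) (fun q' => ?_) ?_ ⟨p', fun x lam hx hlam => ?_⟩
      · by_cases h : q' = q
        · subst h
          rw [Function.update_self]
          omega
        · rw [Function.update_of_ne h]
          exact he q'
      · rw [← Finset.add_sum_erase _ _ hq] at hn ⊢
        have h2 : ∑ q' ∈ (pairs N).erase q, (Function.update e q (e q - 1) q' - m) =
            ∑ q' ∈ (pairs N).erase q, (e q' - m) :=
          Finset.sum_congr rfl fun q' hq' => by
            rw [Function.update_of_ne (Finset.ne_of_mem_erase hq')]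
        rw [h2, Function.update_self]
        omega
      · have h2 := hp x lam hx hlam
        have h3 : x q.1 - x q.2 ≠ 0 := sub_ne_zero.mpr fun h => (mem_pairs.mp hq).ne (hx h)
        have h4 : pairPow e x = (x q.1 - x q.2) * pairPow (Function.update e q (e q - 1)) x := by
          rw [pairPow, pairPow, ← Finset.mul_prod_erase _ _ hq, ← Finset.mul_prod_erase _ _ hq,
            Function.update_self, ← mul_assoc, ← pow_succ']
          have h5 : e q - 1 + 1 = e q := by omega
          rw [h5]
          congr 1
          exact Finset.prod_congr rfl fun q' hq' => by
            rw [Function.update_of_ne (Finset.ne_of_mem_erase hq')]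
        rw [map_mul, map_sub, MvPolynomial.eval_X, MvPolynomial.eval_X, Sum.elim_inl,
          Sum.elim_inl, h4, mul_assoc] at h2
        exact mul_left_cancel₀ h3 h2
  obtain ⟨K, p, hp⟩ := isPolar_baSum (N := N) m
  refine main _ (fun _ => K + m) (fun _ => Nat.le_add_left _ _) rfl
    ⟨(diffProd fun i => MvPolynomial.X (Sum.inl i)) ^ m * p, fun x lam hx hlam => ?_⟩
  rw [map_mul, map_pow, eval_diffProd_inl, ← hp x lam hx hlam, pairPow_const]
  ring

end PoleReduction

section Existence

variable {N : ℕ}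

theorem weight_lt_of_eval {w : Fin (N + 1) ⊕ Fin (N + 1) → ℕ} {B : ℕ}
    {R : MvPolynomial (Fin (N + 1) ⊕ Fin (N + 1)) ℂ}
    (h : ∀ x lam, Function.Injective x → Function.Injective lam → ∃ b : ℕ → ℂ, ∀ c : ℂ, c ≠ 0 →
      MvPolynomial.eval (fun v => c ^ w v * Sum.elim x lam v) R =
        ∑ j ∈ Finset.range B, c ^ j * b j)
    {d : Fin (N + 1) ⊕ Fin (N + 1) →₀ ℕ} (hd : d ∈ R.support) : Finsupp.weight w d < B := by
  classical
  by_contra hB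
  rw [not_lt] at hB
  have hsup : ∀ e ∈ R.support, Finsupp.weight w e < R.support.sup (Finsupp.weight w) + 1 :=
    fun e he => Nat.lt_succ_of_le (Finset.le_sup (f := Finsupp.weight w) he)
  have h0 : MvPolynomial.weightedHomogeneousComponent w (Finsupp.weight w d) R = 0 := by
    refine mvPolynomial_eq_of_eval_eq fun x r hx hr => ?_
    obtain ⟨b, hb⟩ := h x (fun i => (r i : ℂ)) hx.injective
      (Complex.ofReal_injective.comp hr.injective)
    have h1 := eq_zero_of_sum_pow_mul_eq_zero (B := R.support.sup (Finsupp.weight w) + 1)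
      (a := fun j => MvPolynomial.eval (Sum.elim x fun i => (r i : ℂ))
        (MvPolynomial.weightedHomogeneousComponent w j R) - if j < B then b j else 0)
      (fun c hc => by
        have h2 := hb c hc
        rw [MvPolynomial.eval_pow_mul_eq_sum hsup] at h2
        simp only [mul_sub, Finset.sum_sub_distrib, h2, mul_ite, mul_zero]
        rw [← Finset.sum_filter, sub_eq_zero]
        refine Finset.sum_congr ?_ fun _ _ => rfl
        ext j
        have := hsup d hd
        simp only [Finset.mem_range, Finset.mem_filter]
        omega) (hsup d hd)
    simp only [not_lt.mpr hB, if_false, sub_zero] at h1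
    rw [h1, map_zero]
  have h1 := congrArg (MvPolynomial.coeff d) h0
  rw [MvPolynomial.coeff_weightedHomogeneousComponent, if_pos rfl, MvPolynomial.coeff_zero] at h1
  exact MvPolynomial.mem_support_iff.mp hd h1

theorem pow_mul_sum_sub_one {f : ℕ → ℂ} (hf : f 0 = 1) (D : ℕ) {c : ℂ} (hc : c ≠ 0) :
    c ^ D * (∑ k ∈ Finset.range (D + 1), c⁻¹ ^ k * f k - 1) =
      ∑ j ∈ Finset.range D, c ^ j * f (D - j) := by
  rw [Finset.sum_range_succ', hf, pow_zero, one_mul, add_sub_cancel_right, Finset.mul_sum,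
    ← Finset.sum_range_reflect]
  refine Finset.sum_congr rfl fun j hj => ?_
  rw [Finset.mem_range] at hj
  have h1 : D - 1 - j + 1 = D - j := by omega
  have h2 : c ^ D = c ^ j * c ^ (D - j) := by rw [← pow_add]; congr 1; omega
  rw [h1, h2, inv_pow]
  field_simp

theorem schrodinger_of_eval {m : ℕ} {P : MvPolynomial (Fin (N + 1) ⊕ Fin (N + 1)) ℂ}
    {lam : Fin (N + 1) → ℂ} (hlam : Function.Injective lam)
    (hP : ∀ y, Function.Injective y → coefEval y (baElt m lam P) = coefEval y (baSum m lam))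
    {x : Fin (N + 1) → ℂ} (hx : Function.Injective x) :
    calogeroMoser m (fun y => baFun m P y lam) x = -(∑ i, lam i ^ 2) * baFun m P x lam := by
  have h2 : baFun m P x lam = wave lam (baElt m lam P) x := congrFun (baFun_eq_wave m lam P) x
  rw [h2, baFun_eq_wave, schrodinger_wave_iff m lam _ hx]
  exact (cmOp_congr hP hx).trans (cmOp_sum_baCoef m hlam hx)

/-- The rational Baker--Akhiezer function exists, and its value is the sum of the homogeneous
components. -/
theorem exists_isBakerAkhiezer (N m : ℕ) :
    ∃ P : MvPolynomial (Fin (N + 1) ⊕ Fin (N + 1)) ℂ, IsBakerAkhiezer (N + 1) m P ∧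
      ∀ x lam, Function.Injective x → Function.Injective lam →
        coefEval x (baElt m lam P) = coefEval x (baSum m lam) := by
  obtain ⟨P, hP⟩ := exists_numerator (N := N) m
  have hval : ∀ x lam, Function.Injective x → Function.Injective lam →
      coefEval x (baElt m lam P) = coefEval x (baSum m lam) := by
    intro x lam hx hlam
    have h1 := diffProd_ne_zero hx
    have h2 := diffProd_ne_zero hlam
    rw [coefEval_baElt, ← hP x lam hx hlam]
    field_simp
  have hR : ∀ x lam, Function.Injective x → Function.Injective lam →
      MvPolynomial.eval (Sum.elim x lam) (P - baLeading (N + 1) m) =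
        diffProd x ^ m * diffProd lam ^ m * (coefEval x (baSum m lam) - 1) := by
    intro x lam hx hlam
    rw [map_sub, eval_baLeading, ← hP x lam hx hlam]
    ring
  have hsmul : ∀ (c : ℂ) (x : Fin (N + 1) → ℂ), c ≠ 0 → Function.Injective x →
      Function.Injective (c • x) := fun c x hc hx i j h => hx (mul_left_cancel₀ hc h)
  refine ⟨P, ⟨fun d hd => ?_, fun d hd => ?_, fun x lam hx hlam =>
    schrodinger_of_eval hlam (fun y hy => hval y lam hy hlam) hx⟩, hval⟩
  · rw [← weight_leftWeight, Nat.add_sub_cancel]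
    refine weight_lt_of_eval (fun x lam hx hlam => ⟨fun j => diffProd x ^ m * diffProd lam ^ m *
      coefEval x (baCoef (-(m : ℤ) - 1) lam (m * ((N + 1) * N / 2) - j)), fun c hc => ?_⟩) hd
    rw [leftWeight_scaling, hR _ _ (hsmul c x hc hx) hlam, diffProd_smul, baSum, map_sum,
      Finset.sum_congr rfl fun k _ => coefEval_smul_baCoef _ lam k x c, mul_pow, ← pow_mul,
      mul_comm _ m]
    have h1 := pow_mul_sum_sub_one (f := fun k => coefEval x (baCoef (-(m : ℤ) - 1) lam k))
      (by rw [baCoef_zero, map_one]) (m * ((N + 1) * N / 2)) hc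
    have h2 : ∀ j, c ^ j * (diffProd x ^ m * diffProd lam ^ m *
        coefEval x (baCoef (-(m : ℤ) - 1) lam (m * ((N + 1) * N / 2) - j))) =
        diffProd x ^ m * diffProd lam ^ m *
        (c ^ j * coefEval x (baCoef (-(m : ℤ) - 1) lam (m * ((N + 1) * N / 2) - j))) :=
      fun j => by ring
    rw [Finset.sum_congr rfl fun j _ => h2 j, ← Finset.mul_sum, ← h1]
    ring
  · rw [← weight_rightWeight, Nat.add_sub_cancel]
    refine weight_lt_of_eval (fun x lam hx hlam => ⟨fun j => diffProd x ^ m * diffProd lam ^ m *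
      coefEval x (baCoef (-(m : ℤ) - 1) lam (m * ((N + 1) * N / 2) - j)), fun c hc => ?_⟩) hd
    rw [rightWeight_scaling, hR _ _ hx (hsmul c lam hc hlam), diffProd_smul, baSum, map_sum,
      Finset.sum_congr rfl fun k _ => coefEval_baCoef_smul _ lam k x c, mul_pow, ← pow_mul,
      mul_comm _ m]
    have h1 := pow_mul_sum_sub_one (f := fun k => coefEval x (baCoef (-(m : ℤ) - 1) lam k))
      (by rw [baCoef_zero, map_one]) (m * ((N + 1) * N / 2)) hc
    have h2 : ∀ j, c ^ j * (diffProd x ^ m * diffProd lam ^ m *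
        coefEval x (baCoef (-(m : ℤ) - 1) lam (m * ((N + 1) * N / 2) - j))) =
        diffProd x ^ m * diffProd lam ^ m *
        (c ^ j * coefEval x (baCoef (-(m : ℤ) - 1) lam (m * ((N + 1) * N / 2) - j))) :=
      fun j => by ring
    rw [Finset.sum_congr rfl fun j _ => h2 j, ← Finset.mul_sum, ← h1]
    ring

theorem existsUnique_isBakerAkhiezer (N m : ℕ) :
    ∃! P : MvPolynomial (Fin (N + 1) ⊕ Fin (N + 1)) ℂ, IsBakerAkhiezer (N + 1) m P := by
  obtain ⟨P, hP, -⟩ := exists_isBakerAkhiezer N m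
  exact ⟨P, hP, fun Q hQ => hQ.unique hP⟩

theorem IsBakerAkhiezer.baFun_eq {m : ℕ} {P : MvPolynomial (Fin (N + 1) ⊕ Fin (N + 1)) ℂ}
    (hP : IsBakerAkhiezer (N + 1) m P) {x lam : Fin (N + 1) → ℂ} (hx : Function.Injective x)
    (hlam : Function.Injective lam) :
    baFun m P x lam = coefEval x (baSum m lam) * Complex.exp (∑ i, lam i * x i) := by
  obtain ⟨Q, hQ, h⟩ := exists_isBakerAkhiezer N m
  obtain rfl := hP.unique hQ
  rw [← h x lam hx hlam]
  exact congrFun (baFun_eq_wave m lam P) x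

end Existence

section KernelProduct

variable {N : ℕ}

/-- The kernel with exponent `m`, for families `y` and `z` of mutually inverse elements. -/
def kernelProd {S : Type*} [CommMonoid S] (m : ℕ)
    (y z : Fin (N + 1) → ℕ → Fin (N + 1) → ℕ → S) : S :=
  ∏ s ∈ Finset.range N,
    ((∏ i ∈ level N (s + 1), ∏ l ∈ level N (s + 1) with i < l, z i (s + 1) l (s + 1)) ^ m *
      (∏ i ∈ level N s, ∏ l ∈ level N s with i < l, z i s l s) ^ m *
      (∏ i ∈ level N s, ∏ l ∈ level N (s + 1), y i s l (s + 1)) ^ m)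

theorem map_kernelProd {S S' F : Type*} [CommMonoid S] [CommMonoid S'] [FunLike F S S']
    [MonoidHomClass F S S'] (φ : F) (m : ℕ) (y z : Fin (N + 1) → ℕ → Fin (N + 1) → ℕ → S) :
    φ (kernelProd m y z) =
      kernelProd m (fun i j l k => φ (y i j l k)) fun i j l k => φ (z i j l k) := by
  simp only [kernelProd, map_prod, map_mul, map_pow]

theorem val_kernelUnit {S : Type*} [CommRing S] (Y : Fin (N + 1) → ℕ → Fin (N + 1) → ℕ → Sˣ)
    (m : ℕ) : (kernelUnit Y (m : ℤ) : S) = kernelProd m (fun i j l k => (Y i j l k : S))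
      fun i j l k => (↑(Y i j l k)⁻¹ : S) := by
  have h : kernelUnit Y (m : ℤ) = kernelProd m Y fun i j l k => (Y i j l k)⁻¹ := by
    simp only [kernelUnit, kernelProd, levelUnit, zpow_neg, zpow_natCast, Finset.prod_inv_distrib,
      inv_pow]
  rw [h, ← Units.coeHom_apply, map_kernelProd]
  rfl

end KernelProduct

section Expansion

variable {A : Type*} [NormedCommRing A] [NormedAlgebra ℂ A]

/-- The power series `F` converges absolutely to `f` near zero. -/
def IsExpansion (f : ℂ → A) (F : PowerSeries A) : Prop :=
  ∀ᶠ u in nhds (0 : ℂ), (Summable fun k => ‖u ^ k • PowerSeries.coeff k F‖) ∧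
    f u = ∑' k, u ^ k • PowerSeries.coeff k F

theorem isExpansion_one_add (b : A) :
    IsExpansion (fun u => 1 + u • b) (1 + PowerSeries.X * PowerSeries.C b) := by
  refine Filter.Eventually.of_forall fun u => ?_
  have h : ∀ k ∉ Finset.range 2,
      u ^ k • PowerSeries.coeff k (1 + PowerSeries.X * PowerSeries.C b : PowerSeries A) = 0 := by
    intro k hk
    rw [Finset.mem_range, not_lt] at hk
    obtain ⟨k, rfl⟩ := Nat.exists_eq_add_of_le' hk
    rw [map_add, PowerSeries.coeff_one, if_neg (by omega), PowerSeries.coeff_succ_X_mul,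
      PowerSeries.coeff_C, if_neg (by omega), add_zero, smul_zero]
  refine ⟨summable_of_ne_finset_zero (s := Finset.range 2) fun k hk => by rw [h k hk, norm_zero],
    ?_⟩
  rw [tsum_eq_sum h, Finset.sum_range_succ, Finset.sum_range_one]
  simp [PowerSeries.coeff_one]

theorem IsExpansion.mul [CompleteSpace A] {f g : ℂ → A} {F G : PowerSeries A}
    (hf : IsExpansion f F) (hg : IsExpansion g G) : IsExpansion (fun u => f u * g u) (F * G) := by
  filter_upwards [hf, hg] with u hu hv
  have h : ∀ k, u ^ k • PowerSeries.coeff k (F * G) =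
      ∑ kl ∈ Finset.HasAntidiagonal.antidiagonal k,
        (u ^ kl.1 • PowerSeries.coeff kl.1 F) * (u ^ kl.2 • PowerSeries.coeff kl.2 G) := by
    intro k
    rw [PowerSeries.coeff_mul, Finset.smul_sum]
    refine Finset.sum_congr rfl fun kl hkl => ?_
    rw [← Finset.HasAntidiagonal.mem_antidiagonal.mp hkl, pow_add, Algebra.smul_def,
      Algebra.smul_def, Algebra.smul_def, map_mul]
    ring
  simp only [h]
  refine ⟨summable_norm_sum_mul_antidiagonal_of_summable_norm
    (f := fun k => u ^ k • PowerSeries.coeff k F)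
    (g := fun k => u ^ k • PowerSeries.coeff k G) hu.1 hv.1, ?_⟩
  rw [hu.2, hv.2]
  exact tsum_mul_tsum_eq_tsum_sum_antidiagonal_of_summable_norm
    (f := fun k => u ^ k • PowerSeries.coeff k F)
    (g := fun k => u ^ k • PowerSeries.coeff k G) hu.1 hv.1

theorem isExpansion_one : IsExpansion (fun _ => (1 : A)) 1 := by
  simpa using isExpansion_one_add (0 : A)

theorem IsExpansion.pow [CompleteSpace A] {f : ℂ → A} {F : PowerSeries A} (hf : IsExpansion f F)
    (n : ℕ) : IsExpansion (fun u => f u ^ n) (F ^ n) := by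
  induction n with
  | zero => simpa using isExpansion_one (A := A)
  | succ n ih =>
    simp only [pow_succ]
    exact ih.mul hf

theorem IsExpansion.prod [CompleteSpace A] {ι : Type*} {s : Finset ι} {f : ι → ℂ → A}
    {F : ι → PowerSeries A} (h : ∀ i ∈ s, IsExpansion (f i) (F i)) :
    IsExpansion (fun u => ∏ i ∈ s, f i u) (∏ i ∈ s, F i) := by
  classical
  induction s using Finset.induction_on with
  | empty => simpa using isExpansion_one (A := A)
  | insert i s hi ih =>
    simp only [Finset.prod_insert hi]
    exact (h i (Finset.mem_insert_self i s)).mul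
      (ih fun j hj => h j (Finset.mem_insert_of_mem hj))

theorem isExpansion_inverse [CompleteSpace A] (b : A) {F : PowerSeries A}
    (hF : (1 + PowerSeries.X * PowerSeries.C b) * F = 1) :
    IsExpansion (fun u => Ring.inverse (1 + u • b)) F := by
  have h0 : (1 + PowerSeries.X * PowerSeries.C b) * PowerSeries.mk (fun k => (-b) ^ k) = 1 := by
    ext k
    rw [add_mul, one_mul, map_add, mul_assoc, PowerSeries.coeff_mk, PowerSeries.coeff_one]
    rcases k with _ | k
    · simp
    · rw [PowerSeries.coeff_succ_X_mul, PowerSeries.coeff_C_mul, PowerSeries.coeff_mk,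
        if_neg (Nat.succ_ne_zero k), pow_succ]
      ring
  have h1 : F = PowerSeries.mk fun k => (-b) ^ k := by
    calc F = ((1 + PowerSeries.X * PowerSeries.C b) * PowerSeries.mk (fun k => (-b) ^ k)) * F := by
          rw [h0, one_mul]
      _ = PowerSeries.mk (fun k => (-b) ^ k) * ((1 + PowerSeries.X * PowerSeries.C b) * F) := by
          ring
      _ = _ := by rw [hF, mul_one]
  have h2 : ∀ᶠ u in nhds (0 : ℂ), ‖u • -b‖ < 1 := by
    have hc : Continuous fun u : ℂ => ‖u • -b‖ := by fun_prop
    exact hc.continuousAt.eventually_lt continuousAt_const (by simp)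
  filter_upwards [h2] with u hu
  simp only [h1, PowerSeries.coeff_mk, ← smul_pow]
  refine ⟨summable_norm_geometric_of_norm_lt_one hu, ?_⟩
  rw [geom_series_eq_inverse _ hu, smul_neg, sub_neg_eq_add]

theorem IsExpansion.kernelProd [CompleteSpace A] {N : ℕ} (m : ℕ)
    {y z : Fin (N + 1) → ℕ → Fin (N + 1) → ℕ → ℂ → A}
    {Y Z : Fin (N + 1) → ℕ → Fin (N + 1) → ℕ → PowerSeries A}
    (hy : ∀ i j l k, IsExpansion (y i j l k) (Y i j l k))
    (hz : ∀ i j l k, IsExpansion (z i j l k) (Z i j l k)) :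
    IsExpansion (fun u => _root_.kernelProd m (fun i j l k => y i j l k u)
      fun i j l k => z i j l k u) (_root_.kernelProd m Y Z) := by
  unfold _root_.kernelProd
  refine IsExpansion.prod fun s _ => ((IsExpansion.pow ?_ m).mul (IsExpansion.pow ?_ m)).mul
    (IsExpansion.pow ?_ m)
  · exact IsExpansion.prod fun i _ => IsExpansion.prod fun l _ => hz _ _ _ _
  · exact IsExpansion.prod fun i _ => IsExpansion.prod fun l _ => hz _ _ _ _
  · exact IsExpansion.prod fun i _ => IsExpansion.prod fun l _ => hy _ _ _ _

end Expansion

section RaySeries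

variable {ι : Type*} [DecidableEq ι] {A : Type*} [CommRing A] [Algebra ℂ A]

/-- The restriction of a power series to the line through `σ`; the variables outside of `T` are
put to zero. -/
def raySeries (T : Finset ι) (σ : ι → A) : MvPowerSeries ι ℂ →+* PowerSeries A where
  toFun F := PowerSeries.mk fun k =>
    ∑ d ∈ T.finsuppAntidiag k, MvPowerSeries.coeff d F • d.prod fun p n => σ p ^ n
  map_zero' := by
    ext k
    simp
  map_one' := by
    ext k
    rw [PowerSeries.coeff_mk, PowerSeries.coeff_one]
    simp only [MvPowerSeries.coeff_one, ite_smul, one_smul, zero_smul, Finset.sum_ite_eq',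
      Finset.mem_finsuppAntidiag]
    rcases k with _ | k <;> simp
  map_add' F G := by
    ext k
    simp only [PowerSeries.coeff_mk, map_add, add_smul, Finset.sum_add_distrib]
  map_mul' F G := by
    ext k
    have h1 : ∀ d ∈ T.finsuppAntidiag k,
        MvPowerSeries.coeff d (F * G) • (d.prod fun p n => σ p ^ n) =
        ∑ q ∈ Finset.HasAntidiagonal.antidiagonal d,
          (MvPowerSeries.coeff q.1 F • q.1.prod fun p n => σ p ^ n) *
            (MvPowerSeries.coeff q.2 G • q.2.prod fun p n => σ p ^ n) := by
      intro d _
      rw [MvPowerSeries.coeff_mul, Finset.sum_smul]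
      refine Finset.sum_congr rfl fun q hq => ?_
      rw [← Finset.HasAntidiagonal.mem_antidiagonal.mp hq,
        Finsupp.prod_add_index' (fun _ => pow_zero _) fun _ _ _ => pow_add _ _ _,
        Algebra.smul_def, Algebra.smul_def, Algebra.smul_def, map_mul]
      ring
    have h2 : ∀ kl ∈ Finset.HasAntidiagonal.antidiagonal k,
        PowerSeries.coeff kl.1 (PowerSeries.mk fun k => ∑ d ∈ T.finsuppAntidiag k,
          MvPowerSeries.coeff d F • d.prod fun p n => σ p ^ n) *
        PowerSeries.coeff kl.2 (PowerSeries.mk fun k => ∑ d ∈ T.finsuppAntidiag k,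
          MvPowerSeries.coeff d G • d.prod fun p n => σ p ^ n) =
        ∑ q ∈ T.finsuppAntidiag kl.1 ×ˢ T.finsuppAntidiag kl.2,
          (MvPowerSeries.coeff q.1 F • q.1.prod fun p n => σ p ^ n) *
            (MvPowerSeries.coeff q.2 G • q.2.prod fun p n => σ p ^ n) := by
      intro kl _
      rw [PowerSeries.coeff_mk, PowerSeries.coeff_mk, Finset.sum_mul_sum, Finset.sum_product]
    rw [PowerSeries.coeff_mk, PowerSeries.coeff_mul, Finset.sum_congr rfl h1,
      Finset.sum_congr rfl h2, Finset.sum_sigma', Finset.sum_sigma']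
    refine Finset.sum_bij' (fun x _ => ⟨(T.sum x.2.1, T.sum x.2.2), x.2⟩)
      (fun x _ => ⟨x.2.1 + x.2.2, x.2⟩) ?_ ?_ ?_ ?_ ?_
    · rintro ⟨d, e, e'⟩ hx
      simp only [Finset.mem_sigma, Finset.mem_finsuppAntidiag,
        Finset.HasAntidiagonal.mem_antidiagonal, Finset.mem_product] at hx ⊢
      obtain ⟨⟨h3, h4⟩, rfl⟩ := hx
      simp only [Finsupp.coe_add, Pi.add_apply, Finset.sum_add_distrib] at h3
      rw [Finsupp.support_add_eq_union] at h4
      exact ⟨h3, ⟨trivial, Finset.union_subset_left h4⟩, trivial, Finset.union_subset_right h4⟩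
    · rintro ⟨⟨i, j⟩, e, e'⟩ hx
      simp only [Finset.mem_sigma, Finset.mem_finsuppAntidiag,
        Finset.HasAntidiagonal.mem_antidiagonal, Finset.mem_product] at hx ⊢
      obtain ⟨h3, ⟨h4, h5⟩, h6, h7⟩ := hx
      refine ⟨⟨?_, Finsupp.support_add.trans (Finset.union_subset h5 h7)⟩, trivial⟩
      simp only [Finsupp.coe_add, Pi.add_apply, Finset.sum_add_distrib, h4, h6, h3]
    · rintro ⟨d, e, e'⟩ hx
      simp only [Finset.mem_sigma, Finset.HasAntidiagonal.mem_antidiagonal] at hx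
      simp only [hx.2]
    · rintro ⟨⟨i, j⟩, e, e'⟩ hx
      simp only [Finset.mem_sigma, Finset.mem_finsuppAntidiag, Finset.mem_product] at hx
      simp only [hx.2.1.1, hx.2.2.1]
    · intro _ _
      rfl

theorem coeff_raySeries (T : Finset ι) (σ : ι → A) (F : MvPowerSeries ι ℂ) (k : ℕ) :
    PowerSeries.coeff k (raySeries T σ F) =
      ∑ d ∈ T.finsuppAntidiag k, MvPowerSeries.coeff d F • d.prod fun p n => σ p ^ n :=
  PowerSeries.coeff_mk k fun k =>
    ∑ d ∈ T.finsuppAntidiag k, MvPowerSeries.coeff d F • d.prod fun p n => σ p ^ n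

theorem raySeries_C (T : Finset ι) (σ : ι → A) (c : ℂ) :
    raySeries T σ (MvPowerSeries.C c) = PowerSeries.C (algebraMap ℂ A c) := by
  ext k
  rw [coeff_raySeries, PowerSeries.coeff_C]
  simp only [MvPowerSeries.coeff_C, ite_smul, zero_smul, Finset.sum_ite_eq',
    Finset.mem_finsuppAntidiag]
  rcases k with _ | k <;> simp [Algebra.algebraMap_eq_smul_one]

theorem raySeries_X (T : Finset ι) {σ : ι → A} (hσ : ∀ p ∉ T, σ p = 0) (p : ι) :
    raySeries T σ (MvPowerSeries.X p) = PowerSeries.X * PowerSeries.C (σ p) := by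
  ext k
  rw [coeff_raySeries, PowerSeries.coeff_mul_C, PowerSeries.coeff_X]
  simp only [MvPowerSeries.coeff_X, ite_smul, zero_smul, one_smul, Finset.sum_ite_eq',
    Finset.mem_finsuppAntidiag]
  have h : (Finsupp.single p 1).prod (fun p n => σ p ^ n) = σ p := by simp
  have hs : (Finsupp.single p 1).support = {p} := Finsupp.support_single p one_ne_zero
  simp only [h, hs, Finset.singleton_subset_iff]
  by_cases hp : p ∈ T
  · simp [hp, Finsupp.single_apply, eq_comm]
  · simp [hp, hσ p hp]

end RaySeries

section KernelExpansion

variable {N : ℕ}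

/-- The derivative at zero of the ratio `(t_{i,j} - t_{l,k}) / (x_i - x_l)` on the line through
`σ`. -/
def rayArg {A : Type*} [CommRing A] [Algebra ℂ A] (x : Fin (N + 1) → ℂ) (σ : Fin (N + 1) × ℕ → A)
    (i : Fin (N + 1)) (j : ℕ) (l : Fin (N + 1)) (k : ℕ) : A :=
  algebraMap ℂ A (x i - x l)⁻¹ * (∑ s ∈ Finset.Ico j N, σ (i, s) - ∑ s ∈ Finset.Ico k N, σ (l, s))

/-- The kernel on the line through `σ`. -/
def rayKernel {A : Type*} [CommRing A] [Algebra ℂ A] (m : ℕ) (x : Fin (N + 1) → ℂ)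
    (σ : Fin (N + 1) × ℕ → A) (u : ℂ) : A :=
  kernelProd m (fun i j l k => 1 + u • rayArg x σ i j l k)
    fun i j l k => Ring.inverse (1 + u • rayArg x σ i j l k)

variable {A : Type*} [NormedCommRing A] [NormedAlgebra ℂ A] [CompleteSpace A]

theorem isExpansion_rayKernel (m : ℕ) (x : Fin (N + 1) → ℂ) {σ : Fin (N + 1) × ℕ → A}
    (hσ : ∀ p ∉ tri N, σ p = 0) :
    IsExpansion (rayKernel m x σ) (raySeries (tri N) σ (serEval x (kernelSer N m))) := by
  set φ : Ser N →+* PowerSeries A := (raySeries (tri N) σ).comp (serEval x) with hφ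
  have hell : ∀ i j, φ (ell i j) =
      PowerSeries.X * PowerSeries.C (∑ s ∈ Finset.Ico j N, σ (i, s)) := by
    intro i j
    rw [hφ, RingHom.comp_apply, serEval_ell, map_sum, map_sum, Finset.mul_sum]
    exact Finset.sum_congr rfl fun s _ => raySeries_X _ hσ _
  have hratio : ∀ i j l k, φ (ratioSer i j l k) =
      1 + PowerSeries.X * PowerSeries.C (rayArg x σ i j l k) := by
    intro i j l k
    have h1 : φ (ratioSer i j l k) = 1 + PowerSeries.C (algebraMap ℂ A (x i - x l)⁻¹) *
        (φ (ell i j) - φ (ell l k)) := by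
      rw [hφ, RingHom.comp_apply, serEval_ratioSer, map_add, map_one, map_mul, map_sub,
        raySeries_C]
      rfl
    rw [h1, hell, hell, rayArg, map_mul, map_sub]
    ring
  have h1 : ∀ i j l k, (1 + PowerSeries.X * PowerSeries.C (rayArg x σ i j l k)) *
      φ (↑(ratioUnit i j l k)⁻¹ : Ser N) = 1 := by
    intro i j l k
    have h2 : ratioSer i j l k * (↑(ratioUnit i j l k)⁻¹ : Ser N) = 1 :=
      (ratioUnit i j l k).mul_inv
    rw [← hratio, ← map_mul, h2, map_one]
  have h2 : raySeries (tri N) σ (serEval x (kernelSer N m)) = kernelProd m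
      (fun i j l k => 1 + PowerSeries.X * PowerSeries.C (rayArg x σ i j l k))
      fun i j l k => φ (↑(ratioUnit i j l k)⁻¹ : Ser N) := by
    change φ (kernelSer N m) = _
    rw [kernelSer, val_kernelUnit, map_kernelProd]
    simp only [← hratio]
    rfl
  rw [h2]
  exact IsExpansion.kernelProd m (fun i j l k => isExpansion_one_add _)
    fun i j l k => isExpansion_inverse _ (h1 i j l k)

theorem differentiableAt_rayKernel (m : ℕ) {x : Fin (N + 1) → ℂ} {σ : Fin (N + 1) × ℕ → A} {u : ℂ}
    (hu : ∀ i j l k, IsUnit (1 + u • rayArg x σ i j l k)) :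
    DifferentiableAt ℂ (rayKernel m x σ) u := by
  have h1 : ∀ i j l k, DifferentiableAt ℂ (fun u : ℂ => 1 + u • rayArg x σ i j l k) u :=
    fun i j l k => (differentiableAt_id.smul_const _).const_add _
  have h2 : ∀ i j l k, DifferentiableAt ℂ
      (fun u : ℂ => Ring.inverse (1 + u • rayArg x σ i j l k)) u :=
    fun i j l k => (h1 i j l k).inverse (hu i j l k)
  unfold rayKernel kernelProd
  refine DifferentiableAt.fun_finsetProd fun s _ => ((DifferentiableAt.fun_pow ?_ m).fun_mul
    (DifferentiableAt.fun_pow ?_ m)).fun_mul (DifferentiableAt.fun_pow ?_ m)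
  · exact DifferentiableAt.fun_finsetProd fun i _ => DifferentiableAt.fun_finsetProd
      fun l _ => h2 _ _ _ _
  · exact DifferentiableAt.fun_finsetProd fun i _ => DifferentiableAt.fun_finsetProd
      fun l _ => h2 _ _ _ _
  · exact DifferentiableAt.fun_finsetProd fun i _ => DifferentiableAt.fun_finsetProd
      fun l _ => h1 _ _ _ _

end KernelExpansion

section Labels

variable {N : ℕ}

/-- The label of an integration variable. -/
def label (p : Tri N) : Fin (N + 1) × ℕ := (p.1.1.castSucc, p.1.2.val)

theorem label_injective : Function.Injective (label : Tri N → Fin (N + 1) × ℕ) := by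
  intro p q h
  have h1 := congrArg Prod.fst h
  have h2 := congrArg Prod.snd h
  exact Subtype.ext (Prod.ext (Fin.castSucc_injective N h1) (Fin.ext h2))

theorem image_label : Finset.univ.image (label : Tri N → _) = tri N := by
  ext ⟨i, s⟩
  rw [Finset.mem_image, mem_tri]
  constructor
  · rintro ⟨p, -, hp⟩
    rw [← hp]
    exact ⟨p.1.2.isLt, p.2⟩
  · rintro ⟨h1, h2⟩
    exact ⟨⟨(⟨i.val, lt_of_le_of_lt h2 h1⟩, ⟨s, h1⟩), h2⟩, Finset.mem_univ _, rfl⟩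

theorem label_mem_tri (p : Tri N) : label p ∈ tri N := by
  rw [← image_label]
  exact Finset.mem_image_of_mem _ (Finset.mem_univ p)

@[to_additive]
theorem prod_label {M : Type*} [CommMonoid M] (f : Fin (N + 1) × ℕ → M) :
    ∏ p : Tri N, f (label p) = ∏ q ∈ tri N, f q := by
  rw [← image_label, Finset.prod_image fun _ _ _ _ h => label_injective h]

/-- The extension by zero of a point to all labels. -/
def extendZero (τ : Tri N → ℝ) (q : Fin (N + 1) × ℕ) : ℝ := ∑ p, if label p = q then τ p else 0

theorem extendZero_label (τ : Tri N → ℝ) (p : Tri N) : extendZero τ (label p) = τ p := by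
  simp [extendZero, label_injective.eq_iff]

theorem extendZero_of_notMem (τ : Tri N → ℝ) {q : Fin (N + 1) × ℕ} (hq : q ∉ tri N) :
    extendZero τ q = 0 :=
  Finset.sum_eq_zero fun p _ => if_neg fun h : label p = q => hq (h ▸ label_mem_tri p)

theorem extendZero_smul (u : ℝ) (τ : Tri N → ℝ) (q : Fin (N + 1) × ℕ) :
    extendZero (u • τ) q = u * extendZero τ q := by
  simp [extendZero, Finset.mul_sum]

theorem continuous_extendZero (q : Fin (N + 1) × ℕ) :
    Continuous fun τ : Tri N → ℝ => extendZero τ q := by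
  unfold extendZero
  refine continuous_finsetSum _ fun p _ => ?_
  split_ifs <;> fun_prop

theorem gammaPath_eq (x : Fin (N + 1) → ℂ) (τ : Tri N → ℝ) (i j : Fin (N + 1)) :
    gammaPath x τ i j = x i + ∑ s ∈ Finset.Ico j.val N, (extendZero τ (i, s) : ℂ) := by
  rw [gammaPath]
  congr 1
  simp only [extendZero, Complex.ofReal_sum]
  rw [Finset.sum_comm]
  refine Finset.sum_congr rfl fun p _ => ?_
  have h : ∀ s, ((if label p = (i, s) then τ p else 0 : ℝ) : ℂ) =
      if p.1.2.val = s then (if p.1.1.castSucc = i then (τ p : ℂ) else 0) else 0 := by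
    intro s
    simp only [label, Prod.mk.injEq]
    by_cases h1 : p.1.1.castSucc = i <;> by_cases h2 : p.1.2.val = s <;> simp [h1, h2]
  rw [Finset.sum_congr rfl fun s _ => h s, Finset.sum_ite_eq]
  by_cases h1 : p.1.1.castSucc = i <;> simp [h1, Fin.le_def]

/-- The difference of the displacements of `t_{i,j}` and `t_{l,k}`. -/
def shift (τ : Tri N → ℝ) (i : Fin (N + 1)) (j : ℕ) (l : Fin (N + 1)) (k : ℕ) : ℝ :=
  ∑ s ∈ Finset.Ico j N, extendZero τ (i, s) - ∑ s ∈ Finset.Ico k N, extendZero τ (l, s)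

theorem continuous_shift (i : Fin (N + 1)) (j : ℕ) (l : Fin (N + 1)) (k : ℕ) :
    Continuous fun τ : Tri N → ℝ => shift τ i j l k :=
  (continuous_finsetSum _ fun _ _ => continuous_extendZero _).sub
    (continuous_finsetSum _ fun _ _ => continuous_extendZero _)

theorem rayArg_extendZero (x : Fin (N + 1) → ℂ) (τ : Tri N → ℝ) (i : Fin (N + 1)) (j : ℕ)
    (l : Fin (N + 1)) (k : ℕ) :
    rayArg x (fun q => (extendZero τ q : ℂ)) i j l k = (x i - x l)⁻¹ * (shift τ i j l k : ℂ) := by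
  rw [rayArg, shift]
  push_cast
  rfl

theorem shift_smul (u : ℝ) (τ : Tri N → ℝ) (i : Fin (N + 1)) (j : ℕ) (l : Fin (N + 1)) (k : ℕ) :
    shift (u • τ) i j l k = u * shift τ i j l k := by
  simp only [shift, extendZero_smul, Finset.mul_sum, mul_sub]

theorem one_add_ne_zero {x : Fin (N + 1) → ℂ} (hx : ImInjective x) {i l : Fin (N + 1)} {u : ℂ}
    {a : ℝ} (h : i ≠ l → |u.im| * |a| < |(x i - x l).im|) :
    1 + u * ((x i - x l)⁻¹ * (a : ℂ)) ≠ 0 := by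
  by_cases hil : i = l
  · simp [hil]
  · intro h0
    have hne : x i - x l ≠ 0 := sub_ne_zero.mpr fun h => hil (hx.injective h)
    have h1 : x i - x l + u * a = 0 := by
      have : (x i - x l) * (1 + u * ((x i - x l)⁻¹ * (a : ℂ))) = 0 := by rw [h0, mul_zero]
      rw [← this]
      field_simp
    have h2 := congrArg Complex.im h1
    rw [Complex.add_im, Complex.im_mul_ofReal, Complex.zero_im] at h2
    have h3 := h hil
    rw [← abs_mul, eq_neg_of_add_eq_zero_left h2, abs_neg] at h3
    exact lt_irrefl _ h3

/-- The kernel at a point of the contour. -/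
def numKernel (m : ℕ) (x : Fin (N + 1) → ℂ) (τ : Tri N → ℝ) : ℂ :=
  kernelProd m (fun i j l k => 1 + (x i - x l)⁻¹ * (shift τ i j l k : ℂ))
    fun i j l k => (1 + (x i - x l)⁻¹ * (shift τ i j l k : ℂ))⁻¹

theorem numKernel_smul (m : ℕ) (x : Fin (N + 1) → ℂ) (u : ℝ) (τ : Tri N → ℝ) :
    numKernel m x (u • τ) = rayKernel m x (fun q => (extendZero τ q : ℂ)) (u : ℂ) := by
  simp only [numKernel, rayKernel, Ring.inverse_eq_inv', smul_eq_mul, rayArg_extendZero,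
    shift_smul, Complex.ofReal_mul, mul_left_comm]

end Labels

section Growth

variable {N : ℕ}

/-- Functions of subexponential growth. -/
def SubExp (g : (Tri N → ℝ) → ℂ) : Prop :=
  ∀ ε : ℝ, 0 < ε → ∃ C : ℝ, ∀ τ ∈ gammaDomain N, ‖g τ‖ ≤ C * Real.exp (ε * ∑ p, τ p)

theorem sum_nonneg_of_mem {τ : Tri N → ℝ} (hτ : τ ∈ gammaDomain N) : 0 ≤ ∑ p, τ p :=
  Finset.sum_nonneg fun p _ => (hτ p).le

theorem subExp_of_bounded {g : (Tri N → ℝ) → ℂ} {C : ℝ} (hC : 0 ≤ C)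
    (h : ∀ τ ∈ gammaDomain N, ‖g τ‖ ≤ C) : SubExp g := fun _ hε => ⟨C, fun τ hτ =>
  (h τ hτ).trans (le_mul_of_one_le_right hC
    (Real.one_le_exp (mul_nonneg hε.le (sum_nonneg_of_mem hτ))))⟩

theorem subExp_const (c : ℂ) : SubExp fun _ : Tri N → ℝ => c :=
  subExp_of_bounded (norm_nonneg c) fun _ _ => le_rfl

theorem SubExp.add {f g : (Tri N → ℝ) → ℂ} (hf : SubExp f) (hg : SubExp g) :
    SubExp fun τ => f τ + g τ := by
  intro ε hε
  obtain ⟨C, hC⟩ := hf ε hε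
  obtain ⟨C', hC'⟩ := hg ε hε
  refine ⟨C + C', fun τ hτ => (norm_add_le _ _).trans ?_⟩
  rw [add_mul]
  exact add_le_add (hC τ hτ) (hC' τ hτ)

theorem SubExp.mul {f g : (Tri N → ℝ) → ℂ} (hf : SubExp f) (hg : SubExp g) :
    SubExp fun τ => f τ * g τ := by
  intro ε hε
  obtain ⟨C, hC⟩ := hf (ε / 2) (by positivity)
  obtain ⟨C', hC'⟩ := hg (ε / 2) (by positivity)
  refine ⟨C * C', fun τ hτ => ?_⟩
  have h1 := mul_le_mul (hC τ hτ) (hC' τ hτ) (norm_nonneg _) ((norm_nonneg _).trans (hC τ hτ))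
  rw [norm_mul]
  refine h1.trans_eq ?_
  rw [mul_mul_mul_comm, ← Real.exp_add]
  congr 2
  ring

theorem SubExp.pow {f : (Tri N → ℝ) → ℂ} (hf : SubExp f) (n : ℕ) : SubExp fun τ => f τ ^ n := by
  induction n with
  | zero => simpa using subExp_const (N := N) 1
  | succ n ih =>
    simp only [pow_succ]
    exact ih.mul hf

theorem SubExp.sum {ι : Type*} {s : Finset ι} {f : ι → (Tri N → ℝ) → ℂ}
    (hf : ∀ i ∈ s, SubExp (f i)) : SubExp fun τ => ∑ i ∈ s, f i τ := by
  classical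
  induction s using Finset.induction_on with
  | empty => simpa using subExp_const (N := N) 0
  | insert i s hi ih =>
    simp only [Finset.sum_insert hi]
    exact (hf i (Finset.mem_insert_self i s)).add
      (ih fun j hj => hf j (Finset.mem_insert_of_mem hj))

theorem SubExp.prod {ι : Type*} {s : Finset ι} {f : ι → (Tri N → ℝ) → ℂ}
    (hf : ∀ i ∈ s, SubExp (f i)) : SubExp fun τ => ∏ i ∈ s, f i τ := by
  classical
  induction s using Finset.induction_on with
  | empty => simpa using subExp_const (N := N) 1
  | insert i s hi ih =>
    simp only [Finset.prod_insert hi]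
    exact (hf i (Finset.mem_insert_self i s)).mul
      (ih fun j hj => hf j (Finset.mem_insert_of_mem hj))

theorem subExp_apply (p : Tri N) : SubExp fun τ => (τ p : ℂ) := by
  intro ε hε
  refine ⟨ε⁻¹, fun τ hτ => ?_⟩
  have h1 : τ p ≤ ∑ p, τ p :=
    Finset.single_le_sum (f := τ) (fun q _ => (hτ q).le) (Finset.mem_univ p)
  have h2 := Real.add_one_le_exp (ε * ∑ p, τ p)
  rw [Complex.norm_real, Real.norm_of_nonneg (hτ p).le, inv_mul_eq_div, le_div_iff₀ hε]
  nlinarith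

theorem subExp_extendZero (q : Fin (N + 1) × ℕ) :
    SubExp fun τ : Tri N → ℝ => (extendZero τ q : ℂ) := by
  simp only [extendZero, Complex.ofReal_sum]
  refine SubExp.sum fun p _ => ?_
  split_ifs
  · exact subExp_apply p
  · simpa using subExp_const (N := N) 0

theorem subExp_shift (i : Fin (N + 1)) (j : ℕ) (l : Fin (N + 1)) (k : ℕ) :
    SubExp fun τ : Tri N → ℝ => (shift τ i j l k : ℂ) := by
  have h : ∀ τ : Tri N → ℝ, (shift τ i j l k : ℂ) =
      ∑ s ∈ Finset.Ico j N, (extendZero τ (i, s) : ℂ) +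
        -1 * ∑ s ∈ Finset.Ico k N, (extendZero τ (l, s) : ℂ) := by
    intro τ
    rw [shift]
    push_cast
    ring
  simp only [h]
  exact (SubExp.sum fun s _ => subExp_extendZero _).add
    ((subExp_const (-1)).mul (SubExp.sum fun s _ => subExp_extendZero _))

theorem subExp_kernelProd (m : ℕ)
    {y z : Fin (N + 1) → ℕ → Fin (N + 1) → ℕ → (Tri N → ℝ) → ℂ}
    (hy : ∀ i j l k, SubExp (y i j l k)) (hz : ∀ i j l k, SubExp (z i j l k)) :
    SubExp fun τ => kernelProd m (fun i j l k => y i j l k τ) fun i j l k => z i j l k τ := by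
  unfold kernelProd
  refine SubExp.prod fun s _ => ((SubExp.pow ?_ m).mul (SubExp.pow ?_ m)).mul (SubExp.pow ?_ m)
  · exact SubExp.prod fun i _ => SubExp.prod fun l _ => hz _ _ _ _
  · exact SubExp.prod fun i _ => SubExp.prod fun l _ => hz _ _ _ _
  · exact SubExp.prod fun i _ => SubExp.prod fun l _ => hy _ _ _ _

theorem one_add_real_ne_zero {x : Fin (N + 1) → ℂ} (hx : ImInjective x) (i l : Fin (N + 1))
    (a : ℝ) : 1 + (x i - x l)⁻¹ * (a : ℂ) ≠ 0 := by
  have := one_add_ne_zero hx (i := i) (l := l) (u := 1) (a := a) fun hil => by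
    rw [Complex.one_im, abs_zero, zero_mul, abs_pos, Complex.sub_im]
    exact sub_ne_zero.mpr fun h => hil (hx h)
  rwa [one_mul] at this

theorem norm_inv_one_add_le {x : Fin (N + 1) → ℂ} (hx : ImInjective x) (i l : Fin (N + 1))
    (a : ℝ) : ‖(1 + (x i - x l)⁻¹ * (a : ℂ))⁻¹‖ ≤ 1 + ‖x i - x l‖ * |(x i - x l).im|⁻¹ := by
  by_cases hil : i = l
  · simp [hil]
  · have hne : x i - x l ≠ 0 := sub_ne_zero.mpr fun h => hil (hx.injective h)
    have him : 0 < |(x i - x l).im| := by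
      rw [abs_pos, Complex.sub_im]
      exact sub_ne_zero.mpr fun h => hil (hx h)
    have h1 : (1 + (x i - x l)⁻¹ * (a : ℂ))⁻¹ = (x i - x l) * (x i - x l + a)⁻¹ := by
      have h2 := one_add_real_ne_zero hx i l a
      have h3 : x i - x l + a = (x i - x l) * (1 + (x i - x l)⁻¹ * (a : ℂ)) := by
        field_simp
      rw [h3, mul_inv, mul_inv_cancel_left₀ hne]
    have h2 : |(x i - x l).im| ≤ ‖x i - x l + a‖ := by
      have := Complex.abs_im_le_norm (x i - x l + a)
      rwa [Complex.add_im, Complex.ofReal_im, add_zero] at this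
    rw [h1, norm_mul, norm_inv]
    have h3 := mul_le_mul_of_nonneg_left (inv_anti₀ him h2) (norm_nonneg (x i - x l))
    linarith

theorem subExp_numKernel (m : ℕ) {x : Fin (N + 1) → ℂ} (hx : ImInjective x) :
    SubExp (numKernel m x) := by
  unfold numKernel
  refine subExp_kernelProd m (fun i j l k => (subExp_const 1).add
    ((subExp_const _).mul (subExp_shift i j l k))) fun i j l k => ?_
  exact subExp_of_bounded (by positivity) fun τ _ => norm_inv_one_add_le hx i l _

theorem continuous_numKernel (m : ℕ) {x : Fin (N + 1) → ℂ} (hx : ImInjective x) :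
    Continuous (numKernel m x) := by
  have h1 : ∀ i j l k, Continuous fun τ : Tri N → ℝ =>
      1 + (x i - x l)⁻¹ * (shift τ i j l k : ℂ) := fun i j l k =>
    continuous_const.add (continuous_const.mul
      (Complex.continuous_ofReal.comp (continuous_shift i j l k)))
  have h2 : ∀ i j l k, Continuous fun τ : Tri N → ℝ =>
      (1 + (x i - x l)⁻¹ * (shift τ i j l k : ℂ))⁻¹ := fun i j l k =>
    (h1 i j l k).inv₀ fun τ => one_add_real_ne_zero hx i l _
  unfold numKernel kernelProd
  refine continuous_finsetProd _ fun s _ => ((Continuous.pow ?_ m).mul (Continuous.pow ?_ m)).mul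
    (Continuous.pow ?_ m)
  · exact continuous_finsetProd _ fun i _ => continuous_finsetProd _ fun l _ => h2 _ _ _ _
  · exact continuous_finsetProd _ fun i _ => continuous_finsetProd _ fun l _ => h2 _ _ _ _
  · exact continuous_finsetProd _ fun i _ => continuous_finsetProd _ fun l _ => h1 _ _ _ _

end Growth

section Integrals

variable {N : ℕ}

theorem gammaDomain_eq_pi (N : ℕ) :
    gammaDomain N = Set.univ.pi fun _ : Tri N => Set.Ioi (0 : ℝ) := by
  ext τ
  simp [gammaDomain]

theorem measurableSet_gammaDomain (N : ℕ) : MeasurableSet (gammaDomain N) := by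
  rw [gammaDomain_eq_pi]
  exact MeasurableSet.univ_pi fun _ => measurableSet_Ioi

theorem restrict_gammaDomain (N : ℕ) : (volume : Measure (Tri N → ℝ)).restrict (gammaDomain N) =
    Measure.pi fun _ => (volume : Measure ℝ).restrict (Set.Ioi 0) := by
  rw [gammaDomain_eq_pi, volume_pi, Measure.restrict_pi_pi]

theorem integrableOn_exp_neg_mul_sum {ε : ℝ} (hε : 0 < ε) :
    IntegrableOn (fun τ : Tri N → ℝ => Real.exp (-ε * ∑ p, τ p)) (gammaDomain N) := by
  have h : (fun τ : Tri N → ℝ => Real.exp (-ε * ∑ p, τ p)) =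
      fun τ => ∏ p, Real.exp (-ε * τ p) := by
    ext τ
    rw [Finset.mul_sum, Real.exp_sum]
  rw [IntegrableOn, restrict_gammaDomain, h]
  exact Integrable.fintype_prod (f := fun (_ : Tri N) (t : ℝ) => Real.exp (-ε * t)) fun _ =>
    exp_neg_integrableOn_Ioi 0 hε

theorem norm_exp_le_of_mem {w : Tri N → ℂ} {ε : ℝ} (hw : ∀ p, ε ≤ (w p).re) {τ : Tri N → ℝ}
    (hτ : τ ∈ gammaDomain N) :
    ‖Complex.exp (-∑ p, w p * (τ p : ℂ))‖ ≤ Real.exp (-ε * ∑ p, τ p) := by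
  rw [Complex.norm_exp, Real.exp_le_exp, Complex.neg_re, Complex.re_sum, neg_mul, neg_le_neg_iff,
    Finset.mul_sum]
  refine Finset.sum_le_sum fun p _ => ?_
  rw [Complex.re_mul_ofReal]
  exact mul_le_mul_of_nonneg_right (hw p) (hτ p).le

/-- Functions of subexponential growth are dominated by a fixed integrable function, uniformly in
the exponents. -/
theorem SubExp.exists_bound {g : (Tri N → ℝ) → ℂ} (hg : SubExp g) {ε : ℝ} (hε : 0 < ε) :
    ∃ C : ℝ, ∀ τ ∈ gammaDomain N, ∀ w : Tri N → ℂ, (∀ p, ε ≤ (w p).re) →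
      ‖g τ * Complex.exp (-∑ p, w p * (τ p : ℂ))‖ ≤ C * Real.exp (-(ε / 2) * ∑ p, τ p) := by
  obtain ⟨C, hC⟩ := hg (ε / 2) (by positivity)
  refine ⟨C, fun τ hτ w hw => ?_⟩
  have h1 := mul_le_mul (hC τ hτ) (norm_exp_le_of_mem hw hτ) (norm_nonneg _)
    ((norm_nonneg _).trans (hC τ hτ))
  rw [norm_mul]
  refine h1.trans_eq ?_
  rw [mul_assoc, ← Real.exp_add]
  congr 2
  ring

theorem SubExp.integrableOn {g : (Tri N → ℝ) → ℂ} (hg : SubExp g) (hc : Continuous g)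
    {w : Tri N → ℂ} (hw : ∀ p, 0 < (w p).re) :
    IntegrableOn (fun τ => g τ * Complex.exp (-∑ p, w p * (τ p : ℂ))) (gammaDomain N) := by
  obtain ⟨ε, hε, hεw⟩ : ∃ ε : ℝ, 0 < ε ∧ ∀ p, ε ≤ (w p).re := by
    rcases isEmpty_or_nonempty (Tri N) with _ | _
    · exact ⟨1, one_pos, isEmptyElim⟩
    · obtain ⟨p, hp⟩ := Finite.exists_min fun p => (w p).re
      exact ⟨(w p).re, hw p, hp⟩
  obtain ⟨C, hC⟩ := hg.exists_bound hε
  refine ((integrableOn_exp_neg_mul_sum (N := N) (half_pos hε)).const_mul C).mono'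
    (Continuous.aestronglyMeasurable (by fun_prop)) ?_
  exact (ae_restrict_iff' (measurableSet_gammaDomain N)).mpr
    (Filter.Eventually.of_forall fun τ hτ => hC τ hτ w hεw)

theorem integral_pow_mul_exp (a : ℕ) {w : ℝ} (hw : 0 < w) :
    ∫ t : ℝ in Set.Ioi 0, (t : ℂ) ^ a * Complex.exp (-((w : ℂ) * t)) =
      a.factorial * ((w : ℂ)⁻¹) ^ (a + 1) := by
  have h := Real.integral_rpow_mul_exp_neg_mul_Ioi (a := (a : ℝ) + 1) (by positivity) hw
  have h1 : ∫ t : ℝ in Set.Ioi 0, (t : ℂ) ^ a * Complex.exp (-((w : ℂ) * t)) =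
      ((∫ t : ℝ in Set.Ioi 0, t ^ ((a : ℝ) + 1 - 1) * Real.exp (-(w * t)) : ℝ) : ℂ) := by
    rw [← integral_complex_ofReal]
    refine setIntegral_congr_fun measurableSet_Ioi fun t _ => ?_
    simp only [add_sub_cancel_right, Real.rpow_natCast]
    push_cast
    rfl
  rw [h1, h, Real.Gamma_nat_eq_factorial, one_div, ← Nat.cast_succ, Real.rpow_natCast,
    Nat.succ_eq_add_one]
  push_cast
  ring

theorem integral_monomial_mul_exp (a : Tri N → ℕ) {w : Tri N → ℝ} (hw : ∀ p, 0 < w p) :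
    ∫ τ in gammaDomain N, (∏ p, (τ p : ℂ) ^ a p) * Complex.exp (-∑ p, (w p : ℂ) * (τ p : ℂ)) =
      ∏ p, ((a p).factorial * ((w p : ℂ)⁻¹) ^ (a p + 1)) := by
  have h : ∀ τ : Tri N → ℝ, (∏ p, (τ p : ℂ) ^ a p) *
      Complex.exp (-∑ p, (w p : ℂ) * (τ p : ℂ)) =
      ∏ p, ((τ p : ℂ) ^ a p * Complex.exp (-((w p : ℂ) * τ p))) := by
    intro τ
    rw [Finset.prod_mul_distrib, ← Complex.exp_sum, Finset.sum_neg_distrib]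
  simp only [h]
  rw [restrict_gammaDomain, integral_fintype_prod_eq_prod
    (f := fun (p : Tri N) (t : ℝ) => (t : ℂ) ^ a p * Complex.exp (-((w p : ℂ) * t)))]
  exact Finset.prod_congr rfl fun p _ => integral_pow_mul_exp (a p) (hw p)

/-- The part of the domain below a level of a linear form. -/
def simplex (w : Tri N → ℝ) (u : ℝ) : Set (Tri N → ℝ) :=
  {τ | τ ∈ gammaDomain N ∧ ∑ p, w p * τ p < u}

theorem measurable_sum_mul (w : Tri N → ℝ) : Measurable fun τ : Tri N → ℝ => ∑ p, w p * τ p :=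
  Continuous.measurable (by fun_prop)

open scoped Pointwise in
theorem smul_simplex (w : Tri N → ℝ) {u : ℝ} (hu : 0 < u) :
    u • simplex w 1 = simplex w u := by
  ext τ
  rw [Set.mem_smul_set_iff_inv_smul_mem₀ hu.ne']
  have h : ∑ p, w p * (u⁻¹ • τ) p = u⁻¹ * ∑ p, w p * τ p := by
    rw [Finset.mul_sum]
    exact Finset.sum_congr rfl fun p _ => by rw [Pi.smul_apply, smul_eq_mul]; ring
  refine and_congr (forall_congr' fun p => ?_) ?_
  · rw [Pi.smul_apply, smul_eq_mul]
    exact mul_pos_iff_of_pos_left (inv_pos.mpr hu)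
  · rw [h, inv_mul_lt_iff₀ hu, mul_one]

open scoped Pointwise in
theorem setIntegral_simplex (w : Tri N → ℝ) {u : ℝ} (hu : 0 < u) (f : (Tri N → ℝ) → ℂ) :
    ∫ τ in simplex w u, f τ =
      (u : ℂ) ^ Fintype.card (Tri N) * ∫ τ in simplex w 1, f (u • τ) := by
  rw [Measure.setIntegral_comp_smul_of_pos volume f _ hu, smul_simplex w hu,
    Module.finrank_fintype_fun_eq_card, Complex.real_smul]
  push_cast
  rw [mul_inv_cancel_left₀]
  exact pow_ne_zero _ (by exact_mod_cast hu.ne')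

/-- A Laplace integral as a one-dimensional Laplace integral. -/
theorem integral_mul_exp_eq {f : (Tri N → ℝ) → ℂ} (hf : SubExp f) (hc : Continuous f)
    {w : Tri N → ℝ} (hw : ∀ p, 0 < w p) :
    ∫ τ in gammaDomain N, f τ * Complex.exp (-∑ p, (w p : ℂ) * (τ p : ℂ)) =
      ∫ u in Set.Ioi (0 : ℝ), Complex.exp (-(u : ℂ)) * ∫ τ in simplex w u, f τ := by
  have hpos : ∀ τ ∈ gammaDomain N, 0 ≤ ∑ p, w p * τ p := fun τ hτ =>
    Finset.sum_nonneg fun p _ => (mul_pos (hw p) (hτ p)).le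
  set F : (Tri N → ℝ) → ℝ → ℂ := fun τ u =>
    if ∑ p, w p * τ p < u then f τ * Complex.exp (-(u : ℂ)) else 0 with hF
  have hexp : ∀ c : ℝ, ∫ u in Set.Ioi c, Complex.exp (-(u : ℂ)) = Complex.exp (-(c : ℂ)) := by
    intro c
    have := integral_exp_neg_Ioi c
    have h1 : ∀ u : ℝ, Complex.exp (-(u : ℂ)) = ((Real.exp (-u) : ℝ) : ℂ) := fun u => by
      push_cast
      rfl
    simp only [h1]
    rw [integral_complex_ofReal, this]
  have hint : ∀ c : ℝ, IntegrableOn (fun u : ℝ => Complex.exp (-(u : ℂ))) (Set.Ioi c) := by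
    intro c
    have h1 : ∀ u : ℝ, Complex.exp (-(u : ℂ)) = ((Real.exp (-1 * u) : ℝ) : ℂ) := fun u => by
      push_cast
      rw [neg_one_mul]
    simp only [h1]
    exact (exp_neg_integrableOn_Ioi c one_pos).ofReal
  have hFind : ∀ τ, F τ = Set.indicator (Set.Ioi (∑ p, w p * τ p))
      fun u => f τ * Complex.exp (-(u : ℂ)) := by
    intro τ
    ext u
    simp only [hF, Set.indicator, Set.mem_Ioi]
  have h1 : ∀ τ ∈ gammaDomain N, ∫ u in Set.Ioi (0 : ℝ), F τ u =
      f τ * Complex.exp (-∑ p, (w p : ℂ) * (τ p : ℂ)) := by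
    intro τ hτ
    rw [hFind, setIntegral_indicator measurableSet_Ioi, Set.Ioi_inter_Ioi,
      max_eq_right (hpos τ hτ), integral_const_mul, hexp]
    push_cast
    rfl
  have h2 : ∀ u : ℝ, ∫ τ in gammaDomain N, F τ u =
      Complex.exp (-(u : ℂ)) * ∫ τ in simplex w u, f τ := by
    intro u
    have : (fun τ => F τ u) = Set.indicator {τ | ∑ p, w p * τ p < u}
        fun τ => f τ * Complex.exp (-(u : ℂ)) := by
      ext τ
      simp only [hF, Set.indicator, Set.mem_ofPred_eq]
    rw [this, setIntegral_indicator (measurableSet_lt (measurable_sum_mul w)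
      measurable_const), integral_mul_const, mul_comm]
    rfl
  have hmeas : Measurable (Function.uncurry F) := by
    refine Measurable.ite (measurableSet_lt ((measurable_sum_mul w).comp measurable_fst)
      measurable_snd)
      ?_ measurable_const
    exact Continuous.measurable (by fun_prop)
  have hint2 : Integrable (Function.uncurry F) ((volume.restrict (gammaDomain N)).prod
      (volume.restrict (Set.Ioi (0 : ℝ)))) := by
    rw [integrable_prod_iff hmeas.aestronglyMeasurable]
    refine ⟨Filter.Eventually.of_forall fun τ => ?_, ?_⟩
    · change Integrable (F τ) _
      rw [hFind, integrable_indicator_iff measurableSet_Ioi]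
      exact ((hint _).const_mul _).mono_measure
        (Measure.restrict_mono le_rfl Measure.restrict_le_self)
    · have h3 : ∀ τ ∈ gammaDomain N, ∫ u in Set.Ioi (0 : ℝ), ‖F τ u‖ =
          ‖f τ * Complex.exp (-∑ p, (w p : ℂ) * (τ p : ℂ))‖ := by
        intro τ hτ
        have h4 : (fun u => ‖F τ u‖) = Set.indicator (Set.Ioi (∑ p, w p * τ p))
            fun u => ‖f τ‖ * Real.exp (-u) := by
          ext u
          rw [hFind, norm_indicator_eq_indicator_norm]
          congr 1
          ext u
          rw [norm_mul, Complex.norm_exp, Complex.neg_re, Complex.ofReal_re]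
        rw [h4, setIntegral_indicator measurableSet_Ioi, Set.Ioi_inter_Ioi,
          max_eq_right (hpos τ hτ), integral_const_mul, integral_exp_neg_Ioi, norm_mul,
          Complex.norm_exp, Complex.neg_re, Complex.re_sum]
        simp only [Complex.re_mul_ofReal, Complex.ofReal_re]
      have h5 := (hf.integrableOn hc (w := fun p => (w p : ℂ)) fun p => by
        rw [Complex.ofReal_re]; exact hw p).norm
      refine h5.congr ?_
      exact (ae_restrict_iff' (measurableSet_gammaDomain N)).mpr
        (Filter.Eventually.of_forall fun τ hτ => (h3 τ hτ).symm)
  rw [← setIntegral_congr_fun (measurableSet_gammaDomain N) h1, integral_integral_swap hint2]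
  exact setIntegral_congr_fun measurableSet_Ioi fun u _ => h2 u

end Integrals

section CompactFamilies

/-- Integration over a measurable subset of a compact set, as a functional on the continuous
functions on the compact set. -/
theorem exists_integral_clm {X : Type*} [TopologicalSpace X] [T2Space X] [MeasurableSpace X]
    [BorelSpace X] {μ : Measure X} [IsFiniteMeasureOnCompacts μ] {K S : Set X} (hK : IsCompact K)
    [CompactSpace K] (hSK : S ⊆ K) :
    ∃ L : C(K, ℂ) →L[ℂ] ℂ, ∀ (f : C(K, ℂ)) (F : X → ℂ), (∀ k : K, f k = F k) →
      L f = ∫ s in S, F s ∂μ := by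
  set ν : Measure K := (μ.restrict S).comap Subtype.val with hν
  have hfin : IsFiniteMeasure ν := by
    refine ⟨?_⟩
    rw [hν, (MeasurableEmbedding.subtype_coe hK.measurableSet).comap_apply, Set.image_univ,
      Subtype.range_coe]
    exact (Measure.restrict_apply_le S K).trans_lt hK.measure_lt_top
  have hint : ∀ f : C(K, ℂ), Integrable f ν := fun f =>
    f.continuous.integrable_of_hasCompactSupport (HasCompactSupport.of_compactSpace f)
  let L : C(K, ℂ) →ₗ[ℂ] ℂ :=
    { toFun := fun f => ∫ k, f k ∂ν
      map_add' := fun f g => integral_add (hint f) (hint g)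
      map_smul' := fun c f => integral_const_mul c f }
  refine ⟨L.mkContinuous (ν.real Set.univ) fun f => ?_, fun f F hF => ?_⟩
  · rw [mul_comm]
    exact norm_integral_le_of_norm_le_const (Filter.Eventually.of_forall f.norm_coe_le_norm)
  · change ∫ k, f k ∂ν = _
    simp only [hF]
    rw [hν, integral_subtype_comap hK.measurableSet, Measure.restrict_restrict hK.measurableSet,
      Set.inter_eq_right.mpr hSK]

variable {N : ℕ}

/-- The compact simplex below a linear form. -/
def closedSimplex (w : Tri N → ℝ) : Set (Tri N → ℝ) :=
  {τ | (∀ p, 0 ≤ τ p) ∧ ∑ p, w p * τ p ≤ 1}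

theorem isCompact_closedSimplex {w : Tri N → ℝ} (hw : ∀ p, 0 < w p) :
    IsCompact (closedSimplex w) := by
  have hclosed : IsClosed (closedSimplex w) := by
    have h1 : IsClosed {τ : Tri N → ℝ | ∀ p, 0 ≤ τ p} := by
      rw [Set.ofPred_forall]
      exact isClosed_iInter fun p => isClosed_le continuous_const (continuous_apply p)
    have h2 : Continuous fun τ : Tri N → ℝ => ∑ p, w p * τ p := by fun_prop
    exact h1.inter (isClosed_le h2 continuous_const)
  refine (isCompact_Icc (a := (0 : Tri N → ℝ)) (b := fun p => (w p)⁻¹)).of_isClosed_subset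
    hclosed fun τ hτ => ⟨fun p => hτ.1 p, fun p => ?_⟩
  have h1 : w p * τ p ≤ ∑ p, w p * τ p :=
    Finset.single_le_sum (f := fun p => w p * τ p)
      (fun q _ => mul_nonneg (hw q).le (hτ.1 q)) (Finset.mem_univ p)
  change τ p ≤ (w p)⁻¹
  rw [← one_div, le_div_iff₀ (hw p), mul_comm]
  exact h1.trans hτ.2

theorem simplex_subset_closedSimplex (w : Tri N → ℝ) : simplex w 1 ⊆ closedSimplex w :=
  fun _ hτ => ⟨fun p => (hτ.1 p).le, hτ.2.le⟩

/-- The coordinates as continuous functions on the simplex. -/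
def simplexCoord (K : Set (Tri N → ℝ)) (q : Fin (N + 1) × ℕ) : C(K, ℂ) :=
  ⟨fun k => (extendZero k.1 q : ℂ), Complex.continuous_ofReal.comp
    ((continuous_extendZero q).comp continuous_subtype_val)⟩

theorem simplexCoord_apply (K : Set (Tri N → ℝ)) (q : Fin (N + 1) × ℕ) (k : K) :
    simplexCoord K q k = (extendZero k.1 q : ℂ) := rfl

theorem rayArg_simplexCoord (K : Set (Tri N → ℝ)) (x : Fin (N + 1) → ℂ) (i : Fin (N + 1)) (j : ℕ)
    (l : Fin (N + 1)) (n : ℕ) (k : K) : rayArg x (simplexCoord K) i j l n k =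
      (x i - x l)⁻¹ * (shift k.1 i j l n : ℂ) := by
  rw [← rayArg_extendZero]
  simp only [rayArg, ContinuousMap.mul_apply, ContinuousMap.sub_apply, ContinuousMap.sum_apply,
    simplexCoord_apply]
  rfl

theorem ringInverse_apply {X : Type*} [TopologicalSpace X] {f : C(X, ℂ)} (hf : IsUnit f) (k : X) :
    Ring.inverse f k = (f k)⁻¹ := by
  have h := congrArg (fun g : C(X, ℂ) => g k) (Ring.mul_inverse_cancel f hf)
  simp only [ContinuousMap.mul_apply, ContinuousMap.one_apply] at h
  exact eq_inv_of_mul_eq_one_right h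

theorem rayKernel_simplexCoord {K : Set (Tri N → ℝ)} (m : ℕ) (x : Fin (N + 1) → ℂ) {u : ℂ}
    (hu : ∀ i j l n, IsUnit (1 + u • rayArg x (simplexCoord K) i j l n)) (k : K) :
    rayKernel m x (simplexCoord K) u k =
      rayKernel m x (fun q => (extendZero k.1 q : ℂ)) u := by
  have h := map_kernelProd (ContinuousMap.evalAlgHom ℂ ℂ k) m
    (fun i j l n => 1 + u • rayArg x (simplexCoord K) i j l n)
    fun i j l n => Ring.inverse (1 + u • rayArg x (simplexCoord K) i j l n)
  have h1 : ∀ i j l n, (1 + u • rayArg x (simplexCoord K) i j l n : C(K, ℂ)) k =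
      1 + u • rayArg x (fun q => (extendZero k.1 q : ℂ)) i j l n := by
    intro i j l n
    rw [rayArg_extendZero, ← rayArg_simplexCoord]
    rfl
  refine h.trans ?_
  rw [rayKernel]
  congr 1
  · ext i j l n
    exact h1 i j l n
  · ext i j l n
    rw [Ring.inverse_eq_inv', ← h1]
    exact ringInverse_apply (hu i j l n) k

theorem exists_strip {K : Set (Tri N → ℝ)} (hK : IsCompact K) {x : Fin (N + 1) → ℂ}
    (hx : ImInjective x) : ∃ δ : ℝ, 0 < δ ∧ ∀ u : ℂ, |u.im| < δ →
      ∀ i j l n, IsUnit (1 + u • rayArg x (simplexCoord K) i j l n) := by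
  obtain ⟨C, hC⟩ := hK.exists_bound_of_continuousOn (f := fun τ : Tri N → ℝ =>
    ∑ i, ∑ s ∈ Finset.range N, |extendZero τ (i, s)|) (continuous_finsetSum _ fun i _ =>
      continuous_finsetSum _ fun s _ => (continuous_extendZero (i, s)).abs).continuousOn
  have hshift : ∀ τ ∈ K, ∀ i j l n, |shift τ i j l n| ≤ 2 * C := by
    intro τ hτ i j l n
    have h1 : ∀ (i : Fin (N + 1)) (j : ℕ), |∑ s ∈ Finset.Ico j N, extendZero τ (i, s)| ≤ C := by
      intro i j
      refine (Finset.abs_sum_le_sum_abs _ _).trans (le_trans ?_ ((Real.le_norm_self _).trans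
        (hC τ hτ)))
      refine le_trans ?_ (Finset.single_le_sum
        (f := fun i => ∑ s ∈ Finset.range N, |extendZero τ (i, s)|)
        (fun i _ => Finset.sum_nonneg fun s _ => abs_nonneg _) (Finset.mem_univ i))
      exact Finset.sum_le_sum_of_subset_of_nonneg (fun s hs => Finset.mem_range.mpr
        (Finset.mem_Ico.mp hs).2) fun _ _ _ => abs_nonneg _
    have h2 := abs_sub (∑ s ∈ Finset.Ico j N, extendZero τ (i, s))
      (∑ s ∈ Finset.Ico n N, extendZero τ (l, s))
    rw [shift]
    linarith [h1 i j, h1 l n]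
  obtain ⟨η, hη, hηx⟩ : ∃ η : ℝ, 0 < η ∧ ∀ i l, i ≠ l → η ≤ |(x i - x l).im| := by
    have hpos : ∀ q : {q : Fin (N + 1) × Fin (N + 1) // q.1 ≠ q.2},
        0 < |(x q.1.1 - x q.1.2).im| := fun q => by
      rw [abs_pos, Complex.sub_im]
      exact sub_ne_zero.mpr fun h => q.2 (hx h)
    rcases isEmpty_or_nonempty {q : Fin (N + 1) × Fin (N + 1) // q.1 ≠ q.2} with h | _
    · exact ⟨1, one_pos, fun i l hil => h.elim ⟨(i, l), hil⟩⟩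
    · obtain ⟨q, hq⟩ := Finite.exists_min
        fun q : {q : Fin (N + 1) × Fin (N + 1) // q.1 ≠ q.2} => |(x q.1.1 - x q.1.2).im|
      exact ⟨_, hpos q, fun i l hil => hq ⟨(i, l), hil⟩⟩
  refine ⟨η / (2 * |C| + 1), by positivity, fun u hu i j l n => ?_⟩
  rw [ContinuousMap.isUnit_iff_forall_ne_zero]
  intro k
  have h1 : (1 + u • rayArg x (simplexCoord K) i j l n : C(K, ℂ)) k =
      1 + u * ((x i - x l)⁻¹ * (shift k.1 i j l n : ℂ)) := by
    rw [← rayArg_simplexCoord]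
    rfl
  rw [h1]
  refine one_add_ne_zero hx fun hil => lt_of_lt_of_le ?_ (hηx i l hil)
  rw [lt_div_iff₀ (by positivity)] at hu
  refine lt_of_le_of_lt (mul_le_mul_of_nonneg_left ?_ (abs_nonneg _)) hu
  linarith [hshift k.1 k.2 i j l n, le_abs_self C]

end CompactFamilies

section RealSpectralParameter

variable {N : ℕ}

/-- The Laplace integral of a function that is polynomial along rays after integration over the
simplex. -/
theorem integral_mul_exp_eq_sum {f : (Tri N → ℝ) → ℂ} (hf : SubExp f) (hc : Continuous f)
    {w : Tri N → ℝ} (hw : ∀ p, 0 < w p) {b D : ℕ} {Q : ℕ → ℂ}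
    (hQ : ∀ u : ℝ, 0 < u → ∫ τ in simplex w 1, f (u • τ) =
      (u : ℂ) ^ b * ∑ k ∈ Finset.range D, (u : ℂ) ^ k * Q k) :
    ∫ τ in gammaDomain N, f τ * Complex.exp (-∑ p, (w p : ℂ) * (τ p : ℂ)) =
      ∑ k ∈ Finset.range D, ((Fintype.card (Tri N) + b + k).factorial : ℂ) * Q k := by
  rw [integral_mul_exp_eq hf hc hw]
  have h1 : ∀ u ∈ Set.Ioi (0 : ℝ), Complex.exp (-(u : ℂ)) * ∫ τ in simplex w u, f τ =
      ∑ k ∈ Finset.range D, Q k * ((u : ℂ) ^ (Fintype.card (Tri N) + b + k) *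
        Complex.exp (-(((1 : ℝ) : ℂ) * u))) := by
    intro u hu
    rw [setIntegral_simplex w hu, hQ u hu, Finset.mul_sum, Finset.mul_sum, Finset.mul_sum]
    refine Finset.sum_congr rfl fun k _ => ?_
    rw [Complex.ofReal_one, one_mul, pow_add, pow_add]
    ring
  have hint : ∀ a : ℕ, IntegrableOn (fun u : ℝ => (u : ℂ) ^ a *
      Complex.exp (-(((1 : ℝ) : ℂ) * u))) (Set.Ioi 0) := by
    intro a
    refine not_imp_comm.mp integral_undef ?_
    rw [integral_pow_mul_exp _ one_pos, Complex.ofReal_one, inv_one, one_pow, mul_one]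
    exact Nat.cast_ne_zero.mpr (Nat.factorial_ne_zero a)
  rw [setIntegral_congr_fun measurableSet_Ioi h1, integral_finsetSum _ fun k _ =>
    (hint _).const_mul _]
  refine Finset.sum_congr rfl fun k _ => ?_
  rw [integral_const_mul, integral_pow_mul_exp _ one_pos]
  simp only [Complex.ofReal_one, inv_one, one_pow, mul_one]
  rw [mul_comm]

theorem integral_simplex_monomial (a : Tri N → ℕ) {w : Tri N → ℝ} (hw : ∀ p, 0 < w p) :
    ((Fintype.card (Tri N) + ∑ p, a p).factorial : ℂ) *
      ∫ τ in simplex w 1, ∏ p, (τ p : ℂ) ^ a p =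
      ∏ p, ((a p).factorial * ((w p : ℂ)⁻¹) ^ (a p + 1)) := by
  have h := integral_mul_exp_eq_sum (f := fun τ => ∏ p, (τ p : ℂ) ^ a p)
    (SubExp.prod fun p _ => (subExp_apply p).pow (a p)) (by fun_prop) hw (b := ∑ p, a p)
    (D := 1) (Q := fun _ => ∫ τ in simplex w 1, ∏ p, (τ p : ℂ) ^ a p) fun u _ => by
      rw [Finset.sum_range_one, pow_zero, one_mul, ← integral_const_mul]
      congr 1
      ext τ
      simp only [Pi.smul_apply, smul_eq_mul, Complex.ofReal_mul, mul_pow,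
        Finset.prod_mul_distrib, Finset.prod_pow_eq_pow_sum]
  rw [integral_monomial_mul_exp a hw, Finset.sum_range_one, add_zero] at h
  exact h.symm

theorem factorial_add_eq (m d : ℕ) : ((m + d).factorial : ℂ) =
    m.factorial * ∏ r ∈ Finset.range d, (((m : ℤ) : ℂ) + 1 + r) := by
  rw [← Nat.factorial_mul_ascFactorial, Nat.ascFactorial_eq_prod_range]
  push_cast
  rfl

theorem integral_simplex_eq_laplaceWeight (m : ℕ) {w : Tri N → ℝ} (hw : ∀ p, 0 < w p)
    {μ : Fin (N + 1) × ℕ → ℂ} (hμ : ∀ p : Tri N, -μ (label p) = w p) {k : ℕ}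
    {d : Fin (N + 1) × ℕ →₀ ℕ} (hd : d ∈ (tri N).finsuppAntidiag k) :
    ((Fintype.card (Tri N) + Fintype.card (Tri N) * m + k).factorial : ℂ) *
      ∫ τ in simplex w 1, ∏ p, (τ p : ℂ) ^ (m + d (label p)) =
      (∏ p, ((m.factorial : ℂ) * ((w p : ℂ)⁻¹) ^ (m + 1))) *
        laplaceWeight (tri N) ((m : ℤ) : ℂ) μ d := by
  have h1 : ∑ p : Tri N, (m + d (label p)) = Fintype.card (Tri N) * m + k := by
    rw [Finset.sum_add_distrib, sum_label (fun q => d q), (Finset.mem_finsuppAntidiag.mp hd).1,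
      Finset.sum_const, Finset.card_univ, smul_eq_mul]
  rw [add_assoc, ← h1, integral_simplex_monomial _ hw, laplaceWeight,
    ← prod_label fun q => (∏ r ∈ Finset.range (d q), (((m : ℤ) : ℂ) + 1 + r)) * (-μ q)⁻¹ ^ d q,
    ← Finset.prod_mul_distrib]
  refine Finset.prod_congr rfl fun p _ => ?_
  rw [factorial_add_eq, hμ]
  ring

theorem exists_integral_rayKernel (m : ℕ) {w : Tri N → ℝ} (hw : ∀ p, 0 < w p)
    {μ : Fin (N + 1) × ℕ → ℂ} (hμ : ∀ p : Tri N, -μ (label p) = w p) {x : Fin (N + 1) → ℂ}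
    (hx : ImInjective x) {D : ℕ}
    (hD : ∀ k, D ≤ k → laplaceCoeff (tri N) ((m : ℤ) : ℂ) μ k (serEval x (kernelSer N m)) = 0) :
    ∃ Q : ℕ → ℂ, (∀ k, ((Fintype.card (Tri N) + Fintype.card (Tri N) * m + k).factorial : ℂ) *
        Q k = (∏ p, ((m.factorial : ℂ) * ((w p : ℂ)⁻¹) ^ (m + 1))) *
          laplaceCoeff (tri N) ((m : ℤ) : ℂ) μ k (serEval x (kernelSer N m))) ∧
      ∀ u : ℝ, ∫ τ in simplex w 1, (∏ p, (τ p : ℂ) ^ m) * numKernel m x (u • τ) =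
        ∑ k ∈ Finset.range D, (u : ℂ) ^ k * Q k := by
  have hK := isCompact_closedSimplex hw
  set K := closedSimplex w with hKdef
  have : CompactSpace K := isCompact_iff_compactSpace.mp hK
  obtain ⟨L, hL⟩ := exists_integral_clm (μ := (volume : Measure (Tri N → ℝ))) hK
    (simplex_subset_closedSimplex w)
  set M : C(K, ℂ) := ∏ p : Tri N, simplexCoord K (label p) ^ m with hM
  have hMk : ∀ k : K, M k = ∏ p, (k.1 p : ℂ) ^ m := by
    intro k
    rw [hM, ContinuousMap.prod_apply]
    refine Finset.prod_congr rfl fun p _ => ?_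
    rw [ContinuousMap.pow_apply, simplexCoord_apply, extendZero_label]
  set L' : C(K, ℂ) →L[ℂ] ℂ := L.comp (ContinuousLinearMap.mul ℂ C(K, ℂ) M) with hL'
  have hL'a : ∀ (f : C(K, ℂ)) (F : (Tri N → ℝ) → ℂ), (∀ k : K, f k = F k) →
      L' f = ∫ τ in simplex w 1, (∏ p, (τ p : ℂ) ^ m) * F τ := by
    intro f F hF
    change L (M * f) = _
    refine hL _ _ fun k => ?_
    rw [ContinuousMap.mul_apply, hMk, hF]
  set F := serEval x (kernelSer N m) with hF
  set e : ℕ → C(K, ℂ) := fun k => PowerSeries.coeff k (raySeries (tri N) (simplexCoord K) F)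
    with he
  have hmon : ∀ k, ∀ d ∈ (tri N).finsuppAntidiag k,
      L' (d.prod fun p n => simplexCoord K p ^ n) =
        ∫ τ in simplex w 1, ∏ p, (τ p : ℂ) ^ (m + d (label p)) := by
    intro k d hd
    rw [hL'a _ (fun τ => ∏ p, (τ p : ℂ) ^ d (label p))]
    · simp only [pow_add, Finset.prod_mul_distrib]
    · intro τ
      rw [Finsupp.prod_of_support_subset _ (Finset.mem_finsuppAntidiag.mp hd).2 _
        fun _ _ => pow_zero _, ← prod_label fun q => simplexCoord K q ^ d q,
        ContinuousMap.prod_apply]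
      refine Finset.prod_congr rfl fun p _ => ?_
      rw [ContinuousMap.pow_apply, simplexCoord_apply, extendZero_label]
  have hQ : ∀ k, ((Fintype.card (Tri N) + Fintype.card (Tri N) * m + k).factorial : ℂ) *
      L' (e k) = (∏ p, ((m.factorial : ℂ) * ((w p : ℂ)⁻¹) ^ (m + 1))) *
        laplaceCoeff (tri N) ((m : ℤ) : ℂ) μ k F := by
    intro k
    rw [show e k = _ from coeff_raySeries _ _ _ k, map_sum, laplaceCoeff_apply,
      Finset.mul_sum, Finset.mul_sum]
    refine Finset.sum_congr rfl fun d hd => ?_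
    rw [map_smul, hmon k d hd, smul_eq_mul, smul_eq_mul, mul_left_comm,
      integral_simplex_eq_laplaceWeight m hw hμ hd]
    ring
  have hQ0 : ∀ k, D ≤ k → L' (e k) = 0 := by
    intro k hk
    have h := hQ k
    rw [hD k hk, mul_zero] at h
    exact (mul_eq_zero.mp h).resolve_left (Nat.cast_ne_zero.mpr (Nat.factorial_ne_zero _))
  refine ⟨fun k => L' (e k), hQ, fun u => ?_⟩
  obtain ⟨δ, hδ, hunit⟩ := exists_strip hK hx
  set U : Set ℂ := {u | |u.im| < δ} with hU
  have hUopen : IsOpen U := isOpen_lt (Complex.continuous_im.abs) continuous_const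
  have hUconv : Convex ℝ U := by
    have : U = Complex.imLm ⁻¹' (Set.Ioo (-δ) δ) := by
      ext z
      simp [hU, abs_lt]
    rw [this]
    exact (convex_Ioo _ _).linear_preimage _
  have h0U : (0 : ℂ) ∈ U := by simpa [hU] using hδ
  have hdiff : DifferentiableOn ℂ (fun u => L' (rayKernel m x (simplexCoord K) u)) U :=
    fun u hu => ((L'.differentiableAt).comp u
      (differentiableAt_rayKernel m (hunit u hu))).differentiableWithinAt
  have hdiff2 : DifferentiableOn ℂ
      (fun u : ℂ => ∑ k ∈ Finset.range D, u ^ k * L' (e k)) U := by fun_prop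
  have hexp := isExpansion_rayKernel m x (σ := simplexCoord K) fun p hp => by
    ext k
    rw [simplexCoord_apply, extendZero_of_notMem _ hp]
    simp
  have hev : (fun u => L' (rayKernel m x (simplexCoord K) u)) =ᶠ[nhds 0]
      fun u : ℂ => ∑ k ∈ Finset.range D, u ^ k * L' (e k) := by
    filter_upwards [hexp] with u hu
    rw [hu.2, L'.map_tsum (Summable.of_norm hu.1), tsum_eq_sum (s := Finset.range D)]
    · refine Finset.sum_congr rfl fun k _ => ?_
      rw [map_smul, smul_eq_mul]
    · intro k hk
      rw [map_smul, hQ0 k (by simpa using hk), smul_zero]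
  have heq := (hdiff.analyticOnNhd hUopen).eqOn_of_preconnected_of_eventuallyEq
    (hdiff2.analyticOnNhd hUopen) hUconv.isPreconnected h0U hev
  have huU : (u : ℂ) ∈ U := by simpa [hU] using hδ
  have h1 := heq huU
  simp only at h1
  rw [← h1, hL'a _ fun τ => numKernel m x (u • τ)]
  intro k
  rw [rayKernel_simplexCoord m x (hunit _ huU), numKernel_smul]

theorem continuous_prod_mul_numKernel (m : ℕ) {x : Fin (N + 1) → ℂ} (hx : ImInjective x) :
    Continuous fun τ : Tri N → ℝ => (∏ p, (τ p : ℂ) ^ m) * numKernel m x τ := by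
  have h : Continuous fun τ : Tri N → ℝ => ∏ p, (τ p : ℂ) ^ m := by fun_prop
  exact h.mul (continuous_numKernel m hx)

theorem subExp_prod_mul_numKernel (m : ℕ) {x : Fin (N + 1) → ℂ} (hx : ImInjective x) :
    SubExp fun τ : Tri N → ℝ => (∏ p, (τ p : ℂ) ^ m) * numKernel m x τ :=
  (SubExp.prod fun p _ => (subExp_apply p).pow m).mul (subExp_numKernel m hx)

theorem neg_mu_label (lam : Fin (N + 1) → ℂ) (p : Tri N) :
    -mu lam (label p) = lam p.1.2.succ - lam p.1.1.castSucc := by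
  have h : (Fin.ofNat (N + 1) (p.1.2.val + 1)) = p.1.2.succ := by
    ext
    rw [Fin.val_ofNat, Nat.mod_eq_of_lt (Nat.succ_lt_succ p.1.2.isLt), Fin.val_succ]
  rw [mu, label, h, neg_sub]

/-- The Laplace integral of the kernel for real spectral parameters. -/
theorem integral_numKernel_of_real (m : ℕ) {x : Fin (N + 1) → ℂ} (hx : ImInjective x)
    {r : Fin (N + 1) → ℝ} (hr : StrictMono r) :
    ∫ τ in gammaDomain N, ((∏ p, (τ p : ℂ) ^ m) * numKernel m x τ) *
        Complex.exp (-∑ p, -mu (fun i => (r i : ℂ)) (label p) * (τ p : ℂ)) =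
      (∏ p : Tri N, ((m.factorial : ℂ) *
        ((-mu (fun i => (r i : ℂ)) (label p))⁻¹) ^ (m + 1))) *
        coefEval x (baSum m fun i => (r i : ℂ)) := by
  set lam : Fin (N + 1) → ℂ := fun i => (r i : ℂ) with hlam
  set w : Tri N → ℝ := fun p => r p.1.2.succ - r p.1.1.castSucc with hw
  have hw0 : ∀ p, 0 < w p := fun p => sub_pos.mpr (hr (Fin.castSucc_lt_succ_iff.mpr p.2))
  have hμ : ∀ p : Tri N, -mu lam (label p) = w p := by
    intro p
    rw [neg_mu_label, hw, hlam]
    push_cast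
    rfl
  have hcoef : ∀ k, laplaceCoeff (tri N) ((m : ℤ) : ℂ) (mu lam) k (serEval x (kernelSer N m)) =
      coefEval x (baCoef (-(m : ℤ) - 1) lam k) := fun k => by
    rw [← coefEval_baCoef, hlam, coefEval_baCoef_eq m hr.injective k hx]
  obtain ⟨Q, hQ1, hQ2⟩ := exists_integral_rayKernel m hw0 hμ hx
    (D := m * ((N + 1) * N / 2) + 1) fun k hk => by
      rw [hcoef, baCoef_eq_zero lam (by rw [card_tri]; omega), map_zero]
  simp only [hμ]
  rw [integral_mul_exp_eq_sum (b := Fintype.card (Tri N) * m) (D := m * ((N + 1) * N / 2) + 1)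
    (Q := Q) (subExp_prod_mul_numKernel m hx) (continuous_prod_mul_numKernel m hx) hw0]
  · rw [baSum, map_sum, Finset.mul_sum]
    refine Finset.sum_congr rfl fun k _ => ?_
    rw [hQ1, hcoef]
  · intro u _
    rw [← hQ2, ← integral_const_mul]
    congr 1
    ext τ
    simp only [Pi.smul_apply, smul_eq_mul, Complex.ofReal_mul, mul_pow, Finset.prod_mul_distrib,
      Finset.prod_const, Finset.card_univ]
    rw [← pow_mul, mul_comm m, mul_assoc]

end RealSpectralParameter

section ComplexSpectralParameter

variable {N : ℕ}

/-- A Laplace integral depends holomorphically on the exponents. -/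
theorem differentiableOn_integral {f : (Tri N → ℝ) → ℂ} (hf : SubExp f) (hc : Continuous f)
    {U : Set ℂ} (hU : IsOpen U) (a b : Tri N → ℂ) {ε : ℝ} (hε : 0 < ε)
    (hab : ∀ z ∈ U, ∀ p, ε ≤ (a p + b p * z).re) :
    DifferentiableOn ℂ (fun z => ∫ τ in gammaDomain N,
      f τ * Complex.exp (-∑ p, (a p + b p * z) * (τ p : ℂ))) U := by
  set g : (Tri N → ℝ) → ℂ := fun τ => f τ * -∑ p, b p * (τ p : ℂ) with hg
  have hgs : SubExp g := by
    have h := hf.mul ((subExp_const (-1)).mul (SubExp.sum (s := Finset.univ) fun p _ =>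
      (subExp_const (b p)).mul (subExp_apply p)))
    simp only [neg_one_mul] at h
    exact h
  have hgc : Continuous g := by fun_prop
  obtain ⟨C, hC⟩ := hgs.exists_bound hε
  intro z hz
  refine (HasDerivAt.differentiableAt (f' := ∫ τ in gammaDomain N,
    g τ * Complex.exp (-∑ p, (a p + b p * z) * (τ p : ℂ))) ?_).differentiableWithinAt
  refine (hasDerivAt_integral_of_dominated_loc_of_deriv_le
    (μ := volume.restrict (gammaDomain N)) (s := U)
    (F := fun z τ => f τ * Complex.exp (-∑ p, (a p + b p * z) * (τ p : ℂ)))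
    (F' := fun z τ => g τ * Complex.exp (-∑ p, (a p + b p * z) * (τ p : ℂ)))
    (bound := fun τ => C * Real.exp (-(ε / 2) * ∑ p, τ p)) (hU.mem_nhds hz)
    (Filter.Eventually.of_forall fun z => Continuous.aestronglyMeasurable (by fun_prop))
    (hf.integrableOn hc fun p => hε.trans_le (hab z hz p))
    (Continuous.aestronglyMeasurable (by fun_prop)) ?_
    ((integrableOn_exp_neg_mul_sum (N := N) (half_pos hε)).const_mul C) ?_).2
  · exact (ae_restrict_iff' (measurableSet_gammaDomain N)).mpr
      (Filter.Eventually.of_forall fun τ hτ z hz => hC τ hτ _ (hab z hz))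
  · refine Filter.Eventually.of_forall fun τ z _ => ?_
    have h1 : HasDerivAt (fun z : ℂ => -∑ p, (a p + b p * z) * (τ p : ℂ))
        (-∑ p, b p * (τ p : ℂ)) z := by
      refine (HasDerivAt.fun_sum fun p _ => ?_).neg
      have := (((hasDerivAt_id z).const_mul (b p)).const_add (a p)).mul_const (τ p : ℂ)
      simpa using this
    have h2 := (h1.cexp).const_mul (f τ)
    refine h2.congr_deriv ?_
    rw [hg]
    ring

theorem differentiableOn_coefEval_baSum (m : ℕ) (x : Fin (N + 1) → ℂ) {U : Set ℂ}
    {lam : ℂ → Fin (N + 1) → ℂ} (hlam : ∀ i, Differentiable ℂ fun z => lam z i)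
    (hU : ∀ z ∈ U, ∀ p ∈ tri N, mu (lam z) p ≠ 0) :
    DifferentiableOn ℂ (fun z => coefEval x (baSum m (lam z))) U := by
  simp only [baSum, map_sum, coefEval_baCoef, laplaceCoeff_apply, laplaceWeight, smul_eq_mul]
  refine DifferentiableOn.fun_sum fun k _ => DifferentiableOn.fun_sum fun d _ =>
    DifferentiableOn.mul_const ?_ _
  refine DifferentiableOn.fun_finsetProd fun p hp => DifferentiableOn.const_mul ?_ _
  refine DifferentiableOn.fun_pow (DifferentiableOn.fun_inv ?_ fun z hz => ?_) _
  · exact (((hlam _).sub (hlam _)).neg).differentiableOn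
  · exact neg_ne_zero.mpr (hU z hz p hp)

/-- The Laplace integral of the kernel. -/
theorem integral_numKernel (m : ℕ) {x : Fin (N + 1) → ℂ} (hx : ImInjective x)
    {lam : Fin (N + 1) → ℂ} (hlam : ∀ i j : Fin (N + 1), i < j → (lam i - lam j).re < 0) :
    ∫ τ in gammaDomain N, ((∏ p, (τ p : ℂ) ^ m) * numKernel m x τ) *
        Complex.exp (-∑ p, -mu lam (label p) * (τ p : ℂ)) =
      (∏ p : Tri N, ((m.factorial : ℂ) * ((-mu lam (label p))⁻¹) ^ (m + 1))) *
        coefEval x (baSum m lam) := by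
  set ℓ : ℂ → Fin (N + 1) → ℂ := fun z i => ((lam i).re : ℂ) + (lam i).im * z with hℓ
  set a : Tri N → ℝ := fun p => (lam p.1.2.succ).re - (lam p.1.1.castSucc).re with ha
  set b : Tri N → ℝ := fun p => (lam p.1.2.succ).im - (lam p.1.1.castSucc).im with hb
  have hmu : ∀ z p, -mu (ℓ z) (label p) = (a p : ℂ) + b p * z := by
    intro z p
    rw [neg_mu_label, hℓ, ha, hb]
    push_cast
    ring
  have hapos : ∀ p, 0 < a p := fun p => by
    have := hlam p.1.1.castSucc p.1.2.succ (Fin.castSucc_lt_succ_iff.mpr p.2)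
    rw [Complex.sub_re] at this
    rw [ha]
    linarith
  obtain ⟨ε, δ, hε, hδ, hεδ⟩ : ∃ ε δ : ℝ, 0 < ε ∧ 0 < δ ∧ ∀ t : ℝ, |t| < δ → ∀ p,
      ε ≤ a p + b p * t := by
    rcases isEmpty_or_nonempty (Tri N) with _ | _
    · exact ⟨1, 1, one_pos, one_pos, fun _ _ => isEmptyElim⟩
    · obtain ⟨p, hp⟩ := Finite.exists_min a
      have hB : ∀ q, |b q| ≤ ∑ q, |b q| := fun q =>
        Finset.single_le_sum (f := fun q => |b q|) (fun _ _ => abs_nonneg _) (Finset.mem_univ q)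
      have hB0 : 0 ≤ ∑ q, |b q| := Finset.sum_nonneg fun _ _ => abs_nonneg _
      refine ⟨a p / 2, a p / (2 * (∑ q, |b q| + 1)), half_pos (hapos p),
        div_pos (hapos p) (by positivity), fun t ht q => ?_⟩
      rw [lt_div_iff₀ (by positivity)] at ht
      have h1 : |b q * t| ≤ (∑ q, |b q|) * |t| := by
        rw [abs_mul]
        exact mul_le_mul_of_nonneg_right (hB q) (abs_nonneg t)
      have h2 := neg_abs_le (b q * t)
      have h3 := abs_nonneg t
      have h4 := hp q
      linarith
  set U : Set ℂ := {z | |z.re| < δ} with hU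
  have hUopen : IsOpen U := isOpen_lt Complex.continuous_re.abs continuous_const
  have hUconv : Convex ℝ U := by
    have : U = Complex.reLm ⁻¹' (Set.Ioo (-δ) δ) := by
      ext z
      simp [hU, abs_lt]
    rw [this]
    exact (convex_Ioo _ _).linear_preimage _
  have hre : ∀ z ∈ U, ∀ p, ε ≤ ((a p : ℂ) + b p * z).re := fun z hz p => by
    simpa using hεδ z.re hz p
  have hne : ∀ z ∈ U, ∀ p : Tri N, mu (ℓ z) (label p) ≠ 0 := fun z hz p h => by
    have h1 := hre z hz p
    rw [← hmu, h, neg_zero, Complex.zero_re] at h1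
    exact absurd h1 (not_le.mpr hε)
  have hℓd : ∀ i, Differentiable ℂ fun z => ℓ z i := fun i => by
    rw [hℓ]
    fun_prop
  have hleft := differentiableOn_integral (subExp_prod_mul_numKernel m hx)
    (continuous_prod_mul_numKernel m hx) hUopen (fun p => (a p : ℂ)) (fun p => (b p : ℂ)) hε hre
  have hright : DifferentiableOn ℂ (fun z => (∏ p : Tri N, ((m.factorial : ℂ) *
      (((a p : ℂ) + b p * z)⁻¹) ^ (m + 1))) * coefEval x (baSum m (ℓ z))) U := by
    refine DifferentiableOn.fun_mul (DifferentiableOn.fun_finsetProd fun p _ =>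
      (DifferentiableOn.fun_pow (DifferentiableOn.fun_inv (by fun_prop) fun z hz h => ?_)
        _).const_mul _)
      (differentiableOn_coefEval_baSum m x hℓd fun z hz p hp => ?_)
    · have h1 := hre z hz p
      rw [h, Complex.zero_re] at h1
      exact absurd h1 (not_le.mpr hε)
    · rw [← image_label, Finset.mem_image] at hp
      obtain ⟨q, -, rfl⟩ := hp
      exact hne z hz q
  have hreal : ∀ᶠ t : ℝ in nhdsWithin 0 {0}ᶜ, ∫ τ in gammaDomain N,
      ((∏ p, (τ p : ℂ) ^ m) * numKernel m x τ) *
        Complex.exp (-∑ p, ((a p : ℂ) + b p * (t : ℂ)) * (τ p : ℂ)) =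
      (∏ p : Tri N, ((m.factorial : ℂ) * (((a p : ℂ) + b p * (t : ℂ))⁻¹) ^ (m + 1))) *
        coefEval x (baSum m (ℓ t)) := by
    refine Filter.Eventually.filter_mono nhdsWithin_le_nhds ?_
    have h0 : ∀ᶠ t : ℝ in nhds 0, |t| < δ :=
      continuous_abs.continuousAt.eventually_lt continuousAt_const (by simpa using hδ)
    filter_upwards [h0] with t ht
    set r : Fin (N + 1) → ℝ := fun i => (lam i).re + (lam i).im * t with hr
    have hrℓ : ℓ t = fun i => (r i : ℂ) := by
      ext i
      rw [hℓ, hr]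
      push_cast
      rfl
    have hmono : StrictMono r := by
      refine Fin.strictMono_iff_lt_succ.mpr fun i => ?_
      have h1 := hεδ t ht ⟨(i, i), le_rfl⟩
      rw [ha, hb] at h1
      simp only at h1
      rw [hr]
      simp only
      linarith
    have := integral_numKernel_of_real m hx hmono
    rw [← hrℓ] at this
    simpa only [hmu] using this
  have htend : Filter.Tendsto (fun t : ℝ => (t : ℂ)) (nhdsWithin 0 {0}ᶜ)
      (nhdsWithin 0 {0}ᶜ) := by
    refine tendsto_nhdsWithin_iff.mpr ⟨?_, ?_⟩
    · exact (Complex.continuous_ofReal.tendsto' 0 0 Complex.ofReal_zero).mono_left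
        nhdsWithin_le_nhds
    · filter_upwards [self_mem_nhdsWithin] with t ht
      exact Complex.ofReal_ne_zero.mpr ht
  have heq := (hleft.analyticOnNhd hUopen).eqOn_of_preconnected_of_frequently_eq
    (hright.analyticOnNhd hUopen) hUconv.isPreconnected (z₀ := 0) (by simpa [hU] using hδ)
    (htend.frequently hreal.frequently)
  have hI : Complex.I ∈ U := by simpa [hU] using hδ
  have h1 := heq hI
  have hℓI : ℓ Complex.I = lam := by
    ext i
    exact Complex.re_add_im (lam i)
  simp only [← hmu, hℓI] at h1
  exact h1

end ComplexSpectralParameter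

section PairProducts

variable {N : ℕ} {S : Type*}

/-- The product over the pairs of particles of a level. -/
def pairProd [CommMonoid S] (f : Fin (N + 1) → Fin (N + 1) → S) (s : ℕ) : S :=
  ∏ i ∈ level N s, ∏ l ∈ level N s with i < l, f i l

/-- The product over the pairs of particles of consecutive levels. -/
def crossProd [CommMonoid S] (f : Fin (N + 1) → Fin (N + 1) → S) (s : ℕ) : S :=
  ∏ i ∈ level N s, ∏ l ∈ level N (s + 1), f i l

theorem pairProd_zero [CommMonoid S] (f : Fin (N + 1) → Fin (N + 1) → S) : pairProd f 0 = 1 := by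
  simp [pairProd, level_zero, Finset.filter_singleton]

theorem pairProd_succ [CommMonoid S] (f : Fin (N + 1) → Fin (N + 1) → S) {s : ℕ} (hs : s < N) :
    pairProd f (s + 1) =
      pairProd f s * ∏ i ∈ level N s, f i (Fin.ofNat (N + 1) (s + 1)) := by
  have hlt : ∀ i ∈ level N s, i < Fin.ofNat (N + 1) (s + 1) := by
    intro i hi
    rw [Fin.lt_def, Fin.val_ofNat, Nat.mod_eq_of_lt (Nat.succ_lt_succ hs)]
    exact Nat.lt_succ_of_le (mem_level.mp hi)
  have htop : ∏ l ∈ level N (s + 1) with Fin.ofNat (N + 1) (s + 1) < l,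
      f (Fin.ofNat (N + 1) (s + 1)) l = 1 := by
    refine Finset.prod_eq_one fun l hl => ?_
    rw [Finset.mem_filter, mem_level, Fin.lt_def, Fin.val_ofNat,
      Nat.mod_eq_of_lt (Nat.succ_lt_succ hs)] at hl
    omega
  rw [pairProd, level_succ hs, Finset.prod_insert (top_notMem_level hs), ← level_succ hs, htop,
    one_mul, pairProd, ← Finset.prod_mul_distrib]
  refine Finset.prod_congr rfl fun i hi => ?_
  rw [level_succ hs, Finset.filter_insert, if_pos (hlt i hi), Finset.prod_insert, mul_comm]
  exact fun h => top_notMem_level hs (Finset.mem_filter.mp h).1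

theorem pairProd_const_neg_one {s : ℕ} (hs : s ≤ N) :
    pairProd (fun _ _ : Fin (N + 1) => (-1 : ℂ)) s = (-1) ^ (s + 1).choose 2 := by
  have hcard : ∀ s ≤ N, (level N s).card = s + 1 := by
    intro s
    induction s with
    | zero => simp [level_zero]
    | succ s ih =>
      intro h
      rw [level_succ h, Finset.card_insert_of_notMem (top_notMem_level h), ih (Nat.le_of_succ_le h)]
  induction s with
  | zero => simp [pairProd_zero]
  | succ s ih =>
    rw [pairProd_succ _ hs, ih (Nat.le_of_succ_le hs), Finset.prod_const,
      hcard s (Nat.le_of_succ_le hs), ← pow_add, Nat.choose_succ_succ' (s + 1) 1,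
      Nat.choose_one_right, add_comm]

theorem prod_ne_eq_pairProd [CommMonoid S] (f : Fin (N + 1) → Fin (N + 1) → S) (s : ℕ) :
    ∏ i ∈ level N s, ∏ l ∈ level N s with l ≠ i, f i l =
      pairProd f s * pairProd (fun i l => f l i) s := by
  have h1 : ∏ i ∈ level N s, ∏ l ∈ level N s with l < i, f i l =
      pairProd (fun i l => f l i) s := by
    refine Finset.prod_comm' fun i l => ?_
    simp only [Finset.mem_filter]
    tauto
  rw [← h1, pairProd, ← Finset.prod_mul_distrib]
  refine Finset.prod_congr rfl fun i _ => ?_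
  rw [← Finset.prod_union]
  · refine Finset.prod_congr ?_ fun _ _ => rfl
    ext l
    simp only [Finset.mem_filter, Finset.mem_union]
    rw [← and_or_left, or_comm, lt_or_lt_iff_ne]
  · exact Finset.disjoint_filter.mpr fun l _ h1 h2 => lt_asymm h1 h2

/-- The product over consecutive levels without the pairs of equal columns. -/
theorem prod_cross_ne [CommMonoid S] (f : Fin (N + 1) → Fin (N + 1) → S) {s : ℕ} (hs : s < N) :
    ∏ i ∈ level N s, ∏ l ∈ level N (s + 1) with l ≠ i, f i l =
      pairProd (fun i l => f l i) s * pairProd f (s + 1) := by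
  have h1 : ∀ i ∈ level N s, ∏ l ∈ level N (s + 1) with l ≠ i, f i l =
      f i (Fin.ofNat (N + 1) (s + 1)) * ∏ l ∈ level N s with l ≠ i, f i l := by
    intro i hi
    rw [level_succ hs, Finset.filter_insert, if_pos, Finset.prod_insert]
    · exact fun h => top_notMem_level hs (Finset.mem_filter.mp h).1
    · rintro rfl
      exact top_notMem_level hs hi
  rw [Finset.prod_congr rfl h1, Finset.prod_mul_distrib, prod_ne_eq_pairProd, pairProd_succ f hs,
    mul_comm, mul_comm (pairProd f s), mul_assoc]

theorem crossProd_eq [CommMonoid S] (f : Fin (N + 1) → Fin (N + 1) → S) (s : ℕ) :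
    crossProd f s = (∏ i ∈ level N s, f i i) *
      ∏ i ∈ level N s, ∏ l ∈ level N (s + 1) with l ≠ i, f i l := by
  rw [crossProd, ← Finset.prod_mul_distrib]
  refine Finset.prod_congr rfl fun i hi => ?_
  rw [Finset.filter_ne', Finset.mul_prod_erase _ _ (level_subset s hi)]

theorem pairProd_mul [CommMonoid S] (f g : Fin (N + 1) → Fin (N + 1) → S) (s : ℕ) :
    pairProd (fun i l => f i l * g i l) s = pairProd f s * pairProd g s := by
  simp only [pairProd, Finset.prod_mul_distrib]

theorem pairProd_congr [CommMonoid S] {f g : Fin (N + 1) → Fin (N + 1) → S} {s : ℕ}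
    (h : ∀ i l, i ≠ l → f i l = g i l) : pairProd f s = pairProd g s :=
  Finset.prod_congr rfl fun i _ => Finset.prod_congr rfl fun l hl =>
    h i l (Finset.mem_filter.mp hl).2.ne

theorem pairProd_ne_zero {f : Fin (N + 1) → Fin (N + 1) → ℂ} (h : ∀ i l, i ≠ l → f i l ≠ 0)
    (s : ℕ) : pairProd f s ≠ 0 :=
  Finset.prod_ne_zero_iff.mpr fun i _ => Finset.prod_ne_zero_iff.mpr fun l hl =>
    h i l (Finset.mem_filter.mp hl).2.ne

theorem pairProd_self (x : Fin (N + 1) → ℂ) : pairProd (fun i l => x i - x l) N = diffProd x := by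
  simp only [pairProd, level_self, diffProd]
  refine Finset.prod_congr rfl fun i _ => Finset.prod_congr ?_ fun _ _ => rfl
  ext l
  simp

theorem prod_range_div_of_ne_zero {f : ℕ → ℂ} (h : ∀ s, f s ≠ 0) (n : ℕ) :
    ∏ s ∈ Finset.range n, f (s + 1) / f s = f n / f 0 := by
  induction n with
  | zero => simp [h 0]
  | succ n ih =>
    rw [Finset.prod_range_succ, ih, mul_comm, div_mul_div_cancel₀ (h n)]

theorem sum_range_choose_two (n : ℕ) :
    ∑ s ∈ Finset.range n, (s + 1).choose 2 = (n + 1).choose 3 := by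
  induction n with
  | zero => rfl
  | succ n ih => rw [Finset.sum_range_succ, ih, Nat.choose_succ_succ' (n + 1) 2, add_comm]

end PairProducts

section Contour

variable {N : ℕ}

theorem Iic_castSucc_eq (j : Fin N) : Finset.Iic j.castSucc = level N j.val := by
  ext i
  rw [Finset.mem_Iic, mem_level, Fin.le_def, Fin.val_castSucc]

theorem Iic_succ_eq (j : Fin N) : Finset.Iic j.succ = level N (j.val + 1) := by
  ext i
  rw [Finset.mem_Iic, mem_level, Fin.le_def, Fin.val_succ]

/-- The integrand, with levels indexed by natural numbers. -/
theorem alphaForm_eq (m : ℕ) (lam : Fin (N + 1) → ℂ) {t : Fin (N + 1) → Fin (N + 1) → ℂ}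
    {T : Fin (N + 1) → ℕ → ℂ} (hT : ∀ i j, t i j = T i j.val) :
    alphaForm (m : ℤ) lam t =
      (∏ s ∈ Finset.range N, crossProd (fun i l => T i s - T l (s + 1)) s ^ m *
        ((pairProd (fun i l => T i s - T l s) s ^ m)⁻¹) ^ 2) *
      Complex.exp (∑ s ∈ Finset.range N, ∑ l ∈ level N s,
        (lam (Fin.ofNat (N + 1) s) - lam (Fin.ofNat (N + 1) (s + 1))) * T l s) := by
  have e1 : -(-(m : ℤ) - 1) - 1 = (m : ℤ) := by ring
  have e2 : 2 + 2 * (-(m : ℤ) - 1) = -((2 * m : ℕ) : ℤ) := by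
    push_cast
    ring
  have hpow : ∀ z : ℂ, z ^ (-((2 * m : ℕ) : ℤ)) = ((z ^ m)⁻¹) ^ 2 := fun z => by
    rw [zpow_neg, zpow_natCast, mul_comm, pow_mul, inv_pow]
  have h2 : ∀ (s : ℕ) (f : Fin (N + 1) → Fin (N + 1) → ℂ),
      ∏ l ∈ level N s, ∏ i ∈ Finset.Iio l, f i l = pairProd f s := by
    intro s f
    refine Finset.prod_comm' fun l i => ?_
    simp only [Finset.mem_filter, Finset.mem_Iio, mem_level, Fin.lt_def]
    omega
  have hc : ∀ j : Fin N, j.castSucc = Fin.ofNat (N + 1) j.val := fun j => by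
    ext
    rw [Fin.val_ofNat, Nat.mod_eq_of_lt (Nat.lt_succ_of_lt j.isLt), Fin.val_castSucc]
  have hs : ∀ j : Fin N, j.succ = Fin.ofNat (N + 1) (j.val + 1) := fun j => by
    ext
    rw [Fin.val_ofNat, Nat.mod_eq_of_lt (Nat.succ_lt_succ j.isLt), Fin.val_succ]
  simp only [alphaForm, omegaForm, e1, e2, hpow, zpow_natCast, hT, Fin.val_castSucc, Fin.val_succ,
    Iic_castSucc_eq, Iic_succ_eq, h2]
  rw [← Finset.prod_mul_distrib, Complex.exp_sum, ← Fin.prod_univ_eq_prod_range (fun s =>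
    crossProd (fun i l => T i s - T l (s + 1)) s ^ m *
        ((pairProd (fun i l => T i s - T l s) s ^ m)⁻¹) ^ 2), ← Fin.prod_univ_eq_prod_range
    (fun s => Complex.exp (∑ l ∈ level N s,
        (lam (Fin.ofNat (N + 1) s) - lam (Fin.ofNat (N + 1) (s + 1))) * T l s))]
  congr 1
  · refine Finset.prod_congr rfl fun j _ => ?_
    simp only [crossProd, pairProd, Finset.prod_pow, Finset.prod_inv_distrib]
  · refine Finset.prod_congr rfl fun j _ => ?_
    rw [Complex.exp_sum]
    refine Finset.prod_congr rfl fun l _ => ?_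
    rw [← hc, ← hs]

theorem sum_Ico_telescope (ℓ e : ℕ → ℂ) (y : ℂ) {a b : ℕ} (hab : a ≤ b) :
    ∑ j ∈ Finset.Ico a b, (ℓ j - ℓ (j + 1)) * (y + ∑ s ∈ Finset.Ico j b, e s) =
      (ℓ a - ℓ b) * y + ∑ s ∈ Finset.Ico a b, (ℓ a - ℓ (s + 1)) * e s := by
  induction b, hab using Nat.le_induction with
  | base => simp
  | succ b hab ih =>
    have h1 : ∀ j ∈ Finset.Ico a b, (ℓ j - ℓ (j + 1)) * (y + ∑ s ∈ Finset.Ico j (b + 1), e s) =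
        (ℓ j - ℓ (j + 1)) * (y + ∑ s ∈ Finset.Ico j b, e s) + (ℓ j - ℓ (j + 1)) * e b := by
      intro j hj
      rw [Finset.sum_Ico_succ_top (Finset.mem_Ico.mp hj).2.le]
      ring
    have h2 : ∑ j ∈ Finset.Ico a b, (ℓ j - ℓ (j + 1)) = ℓ a - ℓ b := by
      have := Finset.sum_Ico_sub (fun j => -ℓ j) hab
      simp only [neg_sub_neg] at this
      exact this
    rw [Finset.sum_Ico_succ_top hab, Finset.sum_congr rfl h1, Finset.sum_add_distrib, ih,
      ← Finset.sum_mul, h2, Finset.sum_Ico_succ_top hab, Finset.sum_Ico_succ_top le_rfl,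
      Finset.Ico_self, Finset.sum_empty]
    ring

theorem sum_exponent (lam x : Fin (N + 1) → ℂ) (e : Fin (N + 1) × ℕ → ℂ) :
    ∑ s ∈ Finset.range N, ∑ l ∈ level N s,
        (lam (Fin.ofNat (N + 1) s) - lam (Fin.ofNat (N + 1) (s + 1))) *
          (x l + ∑ r ∈ Finset.Ico s N, e (l, r)) =
      ∑ i, lam i * x i - lam (Fin.last N) * ∑ i, x i + ∑ p ∈ tri N, mu lam p * e p := by
  have hcomm : ∀ f : ℕ → Fin (N + 1) → ℂ, ∑ s ∈ Finset.range N, ∑ l ∈ level N s, f s l =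
      ∑ l, ∑ s ∈ Finset.Ico l.val N, f s l := by
    intro f
    refine Finset.sum_comm' fun s l => ?_
    simp only [Finset.mem_range, mem_level, Finset.mem_Ico, Finset.mem_univ]
    tauto
  have hof : ∀ l : Fin (N + 1), Fin.ofNat (N + 1) l.val = l := fun l => by
    ext
    rw [Fin.val_ofNat, Nat.mod_eq_of_lt l.isLt]
  have hlast : Fin.ofNat (N + 1) N = Fin.last N := hof (Fin.last N)
  rw [sum_tri, hcomm, hcomm, Finset.mul_sum, ← Finset.sum_sub_distrib, ← Finset.sum_add_distrib]
  refine Finset.sum_congr rfl fun l _ => ?_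
  rw [sum_Ico_telescope (fun j => lam (Fin.ofNat (N + 1) j)) (fun r => e (l, r)) (x l)
    (Nat.lt_succ_iff.mp l.isLt)]
  simp only [hof, hlast, mu]
  ring

/-- The integrand on the contour. -/
theorem alphaForm_gammaPath (m : ℕ) (lam : Fin (N + 1) → ℂ) {x : Fin (N + 1) → ℂ}
    (hx : ImInjective x) (τ : Tri N → ℝ) :
    alphaForm (m : ℤ) lam (gammaPath x τ) =
      (-1) ^ (m * (N + 1).choose 3) * diffProd x ^ m *
        Complex.exp (∑ i, lam i * x i - lam (Fin.last N) * ∑ i, x i) *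
        (((∏ p, (τ p : ℂ) ^ m) * numKernel m x τ) *
          Complex.exp (-∑ p, -mu lam (label p) * (τ p : ℂ))) := by
  set T : Fin (N + 1) → ℕ → ℂ := fun i j =>
    x i + ∑ s ∈ Finset.Ico j N, (extendZero τ (i, s) : ℂ) with hT
  set Y : Fin (N + 1) → ℕ → Fin (N + 1) → ℕ → ℂ := fun i j l k =>
    1 + (x i - x l)⁻¹ * (shift τ i j l k : ℂ) with hY
  have hYne : ∀ i j l k, Y i j l k ≠ 0 := fun i j l k => one_add_real_ne_zero hx i l _
  have hYself : ∀ i j k, Y i j i k = 1 := fun i j k => by simp [hY]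
  have hxne : ∀ i l, i ≠ l → x i - x l ≠ 0 := fun i l h =>
    sub_ne_zero.mpr fun h' => h (hx.injective h')
  have hTY : ∀ i j l k, i ≠ l → T i j - T l k = (x i - x l) * Y i j l k := by
    intro i j l k hil
    rw [hY]
    simp only
    rw [mul_add, mul_one, mul_inv_cancel_left₀ (hxne i l hil), hT, shift]
    push_cast
    ring
  have hTdiag : ∀ i s, s < N → T i s - T i (s + 1) = (extendZero τ (i, s) : ℂ) := by
    intro i s hs
    rw [hT]
    simp only
    rw [Finset.sum_eq_sum_Ico_succ_bot hs]
    ring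
  set V : ℕ → ℂ := pairProd fun i l => x i - x l with hV
  set Z : ℕ → ℂ := fun s => pairProd (fun i l => Y i s l s) s with hZ
  have hVne : ∀ s, V s ≠ 0 := pairProd_ne_zero hxne
  have hZne : ∀ s, Z s ≠ 0 := fun s => pairProd_ne_zero (fun i l _ => hYne i s l s) s
  have hZ0 : Z 0 = 1 := pairProd_zero _
  have hZN : Z N = 1 := by
    refine Finset.prod_eq_one fun i _ => Finset.prod_eq_one fun l _ => ?_
    simp [hY, shift]
  have hpair : ∀ s, pairProd (fun i l => T i s - T l s) s = V s * Z s := by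
    intro s
    rw [hV, hZ, ← pairProd_mul]
    exact pairProd_congr fun i l hil => hTY i s l s hil
  have hcross : ∀ s < N, crossProd (fun i l => T i s - T l (s + 1)) s =
      (∏ i ∈ level N s, (extendZero τ (i, s) : ℂ)) * ((-1) ^ (s + 1).choose 2 * V s * V (s + 1)) *
        crossProd (fun i l => Y i s l (s + 1)) s := by
    intro s hs
    have h1 : ∏ i ∈ level N s, ∏ l ∈ level N (s + 1) with l ≠ i, (T i s - T l (s + 1)) =
        (∏ i ∈ level N s, ∏ l ∈ level N (s + 1) with l ≠ i, (x i - x l)) *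
          ∏ i ∈ level N s, ∏ l ∈ level N (s + 1) with l ≠ i, Y i s l (s + 1) := by
      simp only [← Finset.prod_mul_distrib]
      exact Finset.prod_congr rfl fun i _ => Finset.prod_congr rfl fun l hl =>
        hTY i s l (s + 1) (Finset.mem_filter.mp hl).2.symm
    have h2 : pairProd (fun i l => x l - x i) s = (-1) ^ (s + 1).choose 2 * V s := by
      rw [← pairProd_const_neg_one hs.le, hV, ← pairProd_mul]
      exact pairProd_congr fun i l _ => by ring
    rw [crossProd_eq, crossProd_eq, h1, prod_cross_ne _ hs, h2,
      Finset.prod_congr rfl fun i _ => hTdiag i s hs]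
    simp only [hYself, Finset.prod_const_one, one_mul]
    ring
  have hprod : ∏ s ∈ Finset.range N, crossProd (fun i l => T i s - T l (s + 1)) s ^ m *
        ((pairProd (fun i l => T i s - T l s) s ^ m)⁻¹) ^ 2 =
      (-1) ^ (m * (N + 1).choose 3) * diffProd x ^ m *
        ((∏ p, (τ p : ℂ) ^ m) * numKernel m x τ) := by
    have h1 : ∀ s ∈ Finset.range N, crossProd (fun i l => T i s - T l (s + 1)) s ^ m *
        ((pairProd (fun i l => T i s - T l s) s ^ m)⁻¹) ^ 2 =
        ((-1) ^ (s + 1).choose 2) ^ m * (V (s + 1) ^ m / V s ^ m) * (Z (s + 1) ^ m / Z s ^ m) *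
          (∏ i ∈ level N s, (extendZero τ (i, s) : ℂ) ^ m) *
          ((pairProd (fun i l => (Y i (s + 1) l (s + 1))⁻¹) (s + 1)) ^ m *
            (pairProd (fun i l => (Y i s l s)⁻¹) s) ^ m *
            (crossProd (fun i l => Y i s l (s + 1)) s) ^ m) := by
      intro s hs
      have h2 : ∀ r, pairProd (fun i l => (Y i r l r)⁻¹) r = (Z r)⁻¹ := fun r => by
        simp only [hZ, pairProd, Finset.prod_inv_distrib]
      have h3 := hVne s
      have h4 := hZne s
      have h5 := hZne (s + 1)
      rw [hcross s (Finset.mem_range.mp hs), hpair, h2, h2, Finset.prod_pow]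
      simp only [mul_pow, inv_pow]
      field_simp
    have h6 : numKernel m x τ = ∏ s ∈ Finset.range N,
        ((pairProd (fun i l => (Y i (s + 1) l (s + 1))⁻¹) (s + 1)) ^ m *
            (pairProd (fun i l => (Y i s l s)⁻¹) s) ^ m *
            (crossProd (fun i l => Y i s l (s + 1)) s) ^ m) := rfl
    rw [Finset.prod_congr rfl h1, Finset.prod_mul_distrib, ← h6, Finset.prod_mul_distrib,
      Finset.prod_mul_distrib, Finset.prod_mul_distrib, Finset.prod_pow,
      Finset.prod_pow_eq_pow_sum, sum_range_choose_two,
      prod_range_div_of_ne_zero (f := fun s => V s ^ m) fun s => pow_ne_zero m (hVne s),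
      prod_range_div_of_ne_zero (f := fun s => Z s ^ m) fun s => pow_ne_zero m (hZne s),
      hZ0, hZN, hV, pairProd_self, pairProd_zero,
      ← prod_tri fun q => (extendZero τ q : ℂ) ^ m, ← prod_label]
    simp only [extendZero_label, one_pow, div_one, mul_one]
    rw [← pow_mul, mul_comm m, mul_assoc]
  rw [alphaForm_eq m lam (T := T) (gammaPath_eq x τ), hprod,
    sum_exponent lam x fun q => (extendZero τ q : ℂ), ← sum_label, Complex.exp_add]
  simp only [extendZero_label, neg_mul, Finset.sum_neg_distrib, neg_neg]
  ring

end Contour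

section Evaluation

variable {N : ℕ}

theorem integrableOn_alphaForm (m : ℕ) {x lam : Fin (N + 1) → ℂ} (hx : ImInjective x)
    (hlam : ∀ i j : Fin (N + 1), i < j → (lam i - lam j).re < 0) :
    IntegrableOn (fun τ : Tri N → ℝ => alphaForm (m : ℤ) lam (gammaPath x τ))
      (gammaDomain N) := by
  simp only [alphaForm_gammaPath m lam hx]
  refine ((subExp_prod_mul_numKernel m hx).integrableOn (continuous_prod_mul_numKernel m hx)
    fun p => ?_).const_mul _
  have h := hlam _ _ (Fin.castSucc_lt_succ_iff.mpr p.2)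
  rw [neg_mu_label, ← neg_sub, Complex.neg_re]
  linarith

theorem selbergIntegral_eq (m : ℕ) {x lam : Fin (N + 1) → ℂ} (hx : ImInjective x)
    (hlam : ∀ i j : Fin (N + 1), i < j → (lam i - lam j).re < 0) :
    selbergIntegral (m : ℤ) x lam =
      (-1) ^ (m * (N + 1).choose 3) *
        ((-1) ^ (m + 1) * (m.factorial : ℂ)) ^ ((N + 1) * N / 2) *
        Complex.exp (-(lam (Fin.last N) * ∑ i, x i)) * diffProd x ^ m *
        (diffProd lam ^ (m + 1))⁻¹ *
        (coefEval x (baSum m lam) * Complex.exp (∑ i, lam i * x i)) := by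
  have h1 : ∏ p : Tri N, ((m.factorial : ℂ) * ((-mu lam (label p))⁻¹) ^ (m + 1)) =
      ((-1) ^ (m + 1) * (m.factorial : ℂ)) ^ ((N + 1) * N / 2) * (diffProd lam ^ (m + 1))⁻¹ := by
    rw [prod_label fun q => (m.factorial : ℂ) * ((-mu lam q)⁻¹) ^ (m + 1), ← prod_mu,
      ← card_tri, ← Finset.prod_const, ← Finset.prod_pow, ← Finset.prod_inv_distrib,
      ← Finset.prod_mul_distrib]
    refine Finset.prod_congr rfl fun q _ => ?_
    rw [inv_neg, neg_pow, inv_pow]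
    ring
  rw [selbergIntegral]
  simp only [alphaForm_gammaPath m lam hx]
  rw [integral_const_mul, integral_numKernel m hx hlam, h1, sub_eq_add_neg, Complex.exp_add]
  ring

end Evaluation

end

theorem mainTheorem4 (N m : ℕ) (hm : 1 ≤ m) :
    (∃! P : MvPolynomial (Fin (N + 1) ⊕ Fin (N + 1)) ℂ, IsBakerAkhiezer (N + 1) m P) ∧
    ∀ P : MvPolynomial (Fin (N + 1) ⊕ Fin (N + 1)) ℂ, IsBakerAkhiezer (N + 1) m P →
      ∀ x lam : Fin (N + 1) → ℂ,
        Function.Injective (fun i => (x i).im) →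
        (∀ i j : Fin (N + 1), i < j → (lam i - lam j).re < 0) →
        IntegrableOn (fun τ : Tri N → ℝ => alphaForm (m : ℤ) lam (gammaPath x τ)) (gammaDomain N) ∧
        baFun m P x lam =
          (-1) ^ (m * (N + 1).choose 3) *
            (((-1) ^ (m + 1) * (m.factorial : ℂ)) ^ ((N + 1) * N / 2))⁻¹ *
            Complex.exp (lam (Fin.last N) * ∑ i, x i) *
            (diffProd x ^ m)⁻¹ * diffProd lam ^ (m + 1) * selbergIntegral (m : ℤ) x lam ∧
        selbergIntegral (m : ℤ) x lam =
          (-1) ^ (m * (N + 1).choose 3) *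
            ((-1) ^ (m + 1) * (m.factorial : ℂ)) ^ ((N + 1) * N / 2) *
            Complex.exp (-(lam (Fin.last N) * ∑ i, x i)) *
            diffProd x ^ m * (diffProd lam ^ (m + 1))⁻¹ * baFun m P x lam := by
  refine ⟨existsUnique_isBakerAkhiezer N m, fun P hP x lam hx hlam => ?_⟩
  have hx' : ImInjective x := hx
  have hlam' : Function.Injective lam := by
    intro i j h
    by_contra hij
    rcases lt_or_gt_of_ne hij with h1 | h1
    · have := hlam i j h1
      rw [h, sub_self, Complex.zero_re] at this
      exact lt_irrefl _ this
    · have := hlam j i h1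
      rw [h, sub_self, Complex.zero_re] at this
      exact lt_irrefl _ this
  have hS := selbergIntegral_eq m hx' hlam
  rw [← hP.baFun_eq hx'.injective hlam'] at hS
  refine ⟨integrableOn_alphaForm m hx' hlam, ?_, hS⟩
  have h1 : diffProd x ^ m ≠ 0 := pow_ne_zero _ (diffProd_ne_zero hx'.injective)
  have h2 : diffProd lam ^ (m + 1) ≠ 0 := pow_ne_zero _ (diffProd_ne_zero hlam')
  have h3 : ((-1) ^ (m + 1) * (m.factorial : ℂ)) ^ ((N + 1) * N / 2) ≠ 0 :=
    pow_ne_zero _ (mul_ne_zero (pow_ne_zero _ (neg_ne_zero.mpr one_ne_zero))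
      (Nat.cast_ne_zero.mpr m.factorial_ne_zero))
  have h4 : ((-1 : ℂ) ^ (m * (N + 1).choose 3)) * (-1) ^ (m * (N + 1).choose 3) = 1 := by
    rw [← mul_pow, neg_mul_neg, one_mul, one_pow]
  have h5 : Complex.exp (lam (Fin.last N) * ∑ i, x i) *
      Complex.exp (-(lam (Fin.last N) * ∑ i, x i)) = 1 := by
    rw [← Complex.exp_add, add_neg_cancel, Complex.exp_zero]
  rw [hS]
  generalize diffProd x ^ m = a at *
  generalize diffProd lam ^ (m + 1) = b at *
  generalize ((-1) ^ (m + 1) * (m.factorial : ℂ)) ^ ((N + 1) * N / 2) = c at *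
  generalize (-1 : ℂ) ^ (m * (N + 1).choose 3) = s at *
  generalize Complex.exp (lam (Fin.last N) * ∑ i, x i) = e at *
  generalize Complex.exp (-(lam (Fin.last N) * ∑ i, x i)) = e' at *
  generalize baFun m P x lam = Ψ
  have h6 : s * c⁻¹ * e * a⁻¹ * b * (s * c * e' * a * b⁻¹ * Ψ) =
      (s * s) * (e * e') * (c⁻¹ * c) * (a⁻¹ * a) * (b * b⁻¹) * Ψ := by ring
  rw [h6, h4, h5, inv_mul_cancel₀ h3, inv_mul_cancel₀ h1, mul_inv_cancel₀ h2]
  ring
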